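/- Let $\mathbb{D}$ be the unit disc and $\mathbb{T}$ the unit circle with arc length measure $d\theta$. For $\alpha\ge 0$ let $g_\alpha(z)=(z-1)^\alpha$ (a holomorphic branch on $\mathbb{D}$, continuous on $\overline{\mathbb{D}}$) and $\mu_\alpha(z)=|g_\alpha(z)|^2=|z-1|^{2\alpha}$. For $1\le p<\infty$ let $L^p(\mathbb{T},\mu_\alpha)$ be the space of measurable functions on $\mathbb{T}$ with $\|f\|_{p,\mu_\alpha}^p=\int_{\mathbb{T}}|f|^p\mu_\alpha\,d\theta<\infty$. Let $\mathcal{H}^2(\mathbb{T},\mu_\alpha)$ be the space of holomorphic functions $F$ on $\mathbb{D}$ with $\sup_{0\le r<1}\int_0^{2\pi}|F(re^{i\theta})|^2\mu_\alpha(re^{i\theta})\,d\theta<\infty$, regarded through radial boundary values as a closed subspace of $L^2(\mathbb{T},\mu_\alpha)$, and let $\mathbf{S}_{\mu_\alpha}$ be the orthogonal projection of $L^2(\mathbb{T},\mu_\alpha)$ onto $\mathcal{H}^2(\mathbb{T},\mu_\alpha)$ (the weighted Szegő projection). Call $\mathbf{S}_{\mu_\alpha}$ bounded on $L^p(\mathbb{T},\mu_\alpha)$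 if there is a constant $C<\infty$ with $\|\mathbf{S}_{\mu_\alpha}f\|_{p,\mu_\alpha}\le C\|f\|_{p,\mu_\alpha}$ for all $f\in L^2(\mathbb{T},\mu_\alpha)\cap L^p(\mathbb{T},\mu_\alpha)$. Theorem. For every $\alpha\ge 0$ and $1\le p<\infty$, $\mathbf{S}_{\mu_\alpha}$ is bounded on $L^p(\mathbb{T},\mu_\alpha)$ if and only if $$p\in\left(\frac{2\alpha+1}{\alpha+1},\ \frac{2\alpha+1}{\alpha}\right),$$ where the right end point is read as $+\infty$ when $\alpha=0$. -/

import Mathlib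

open MeasureTheory Set Filter Topology
open scoped ENNReal NNReal

namespace WeightedSzego

/-- The unit circle, parametrized by the angle `θ ∈ ℝ / 2πℤ`. Its `volume` is the arc length
measure `dθ` (of total mass `2π`). -/
abbrev Torus : Type := AddCircle (2 * Real.pi)

instance : Fact (0 < 2 * Real.pi) := ⟨Real.two_pi_pos⟩

/-- The point `r e^{iθ}`. -/
noncomputable def polar (r : ℝ) (θ : Torus) : ℂ := (r : ℂ) * (AddCircle.toCircle θ : ℂ)

/-- `polar r` is the usual polar parametrization of the circle of radius `r`. -/
theorem polar_coe (r θ : ℝ) : polar r (θ : Torus) = r * Complex.exp (θ * Complex.I) := by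
  have h : 2 * Real.pi / (2 * Real.pi) * θ = θ := by
    rw [div_self Real.two_pi_pos.ne', one_mul]
  rw [polar, AddCircle.toCircle_apply_mk, h, Circle.coe_exp]

theorem continuous_polar (r : ℝ) : Continuous (polar r) :=
  continuous_const.mul (continuous_subtype_val.comp AddCircle.continuous_toCircle)

theorem norm_polar (r : ℝ) (θ : Torus) : ‖polar r θ‖ = |r| := by
  rw [polar, norm_mul, Circle.norm_coe, mul_one, Complex.norm_real, Real.norm_eq_abs]

theorem polar_mem_ball {r : ℝ} (hr : r ∈ Ico (0 : ℝ) 1) (θ : Torus) :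
    polar r θ ∈ Metric.ball (0 : ℂ) 1 := by
  rw [mem_ball_zero_iff, norm_polar, abs_of_nonneg hr.1]
  exact hr.2

/-- The functions `g` that generate the weights `|g|²`: holomorphic on the open unit disc,
continuous on the closed disc, without zeros inside the disc. -/
structure Generator where
  g : ℂ → ℂ
  diffContOnCl : DiffContOnCl ℂ g (Metric.ball 0 1)
  ne_zero : ∀ z ∈ Metric.ball (0 : ℂ) 1, g z ≠ 0

namespace Generator

variable (G : Generator)

/-- The measure `μ dθ` on the circle, with `μ = |g|²`. -/
noncomputable def measure : Measure Torus :=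
  (volume : Measure Torus).withDensity fun θ => ‖G.g (polar 1 θ)‖ₑ ^ 2

/-- The weighted Hardy space `H²(𝕋, |g|²)` as a space of functions on the disc: `F` is holomorphic
on the open unit disc and `sup_{0 ≤ r < 1} ∫ |F(re^{iθ})|² |g(re^{iθ})|² dθ < ∞`. -/
def MemHardy (F : ℂ → ℂ) : Prop :=
  DifferentiableOn ℂ F (Metric.ball 0 1) ∧
    (⨆ r ∈ Ico (0 : ℝ) 1,
      ∫⁻ θ : Torus, ‖F (polar r θ)‖ₑ ^ 2 * ‖G.g (polar r θ)‖ₑ ^ 2) < ∞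

/-- `f` is the radial boundary function of `F`: `F(re^{iθ}) → f(e^{iθ})` as `r → 1⁻`, for almost
every `θ`. -/
def HasBoundaryValue (F : ℂ → ℂ) (f : Torus → ℂ) : Prop :=
  ∀ᵐ θ ∂G.measure, Tendsto (fun r : ℝ => F (polar r θ)) (𝓝[<] 1) (𝓝 (f θ))

variable {G}

theorem continuous_comp_polar {F : ℂ → ℂ} (hF : DifferentiableOn ℂ F (Metric.ball 0 1))
    {r : ℝ} (hr : r ∈ Ico (0 : ℝ) 1) : Continuous fun θ : Torus => F (polar r θ) :=
  hF.continuousOn.comp_continuous (continuous_polar r) (polar_mem_ball hr)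

theorem MemHardy.zero : G.MemHardy 0 :=
  ⟨differentiableOn_const 0, by simp⟩

theorem MemHardy.smul (c : ℂ) {F : ℂ → ℂ} (hF : G.MemHardy F) : G.MemHardy (c • F) := by
  refine ⟨hF.1.const_smul c, ?_⟩
  refine lt_of_le_of_lt (iSup₂_le fun r hr => ?_)
    (ENNReal.mul_lt_top (a := ‖c‖ₑ ^ 2) (by simp) hF.2)
  calc ∫⁻ θ : Torus, ‖(c • F) (polar r θ)‖ₑ ^ 2 * ‖G.g (polar r θ)‖ₑ ^ 2
      = ∫⁻ θ : Torus, ‖c‖ₑ ^ 2 * (‖F (polar r θ)‖ₑ ^ 2 * ‖G.g (polar r θ)‖ₑ ^ 2) := by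
        simp only [Pi.smul_apply, smul_eq_mul, enorm_mul, mul_pow, mul_assoc]
    _ = ‖c‖ₑ ^ 2 * ∫⁻ θ : Torus, ‖F (polar r θ)‖ₑ ^ 2 * ‖G.g (polar r θ)‖ₑ ^ 2 :=
        lintegral_const_mul' _ _ (by simp)
    _ ≤ _ := by
        gcongr
        exact le_iSup₂ (f := fun r (_ : r ∈ Ico (0 : ℝ) 1) =>
          ∫⁻ θ : Torus, ‖F (polar r θ)‖ₑ ^ 2 * ‖G.g (polar r θ)‖ₑ ^ 2) r hr

theorem MemHardy.add {F₁ F₂ : ℂ → ℂ} (h₁ : G.MemHardy F₁) (h₂ : G.MemHardy F₂) :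
    G.MemHardy (F₁ + F₂) := by
  refine ⟨h₁.1.add h₂.1, ?_⟩
  refine lt_of_le_of_lt (iSup₂_le fun r hr => ?_)
    (ENNReal.mul_lt_top (a := 2) (by simp) (ENNReal.add_lt_top.2 ⟨h₁.2, h₂.2⟩))
  have hm : Measurable fun θ : Torus => ‖F₁ (polar r θ)‖ₑ ^ 2 * ‖G.g (polar r θ)‖ₑ ^ 2 :=
    ((continuous_comp_polar h₁.1 hr).measurable.enorm.pow_const 2).mul
      ((continuous_comp_polar G.diffContOnCl.differentiableOn hr).measurable.enorm.pow_const 2)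
  calc ∫⁻ θ : Torus, ‖(F₁ + F₂) (polar r θ)‖ₑ ^ 2 * ‖G.g (polar r θ)‖ₑ ^ 2
      ≤ ∫⁻ θ : Torus, 2 * (‖F₁ (polar r θ)‖ₑ ^ 2 * ‖G.g (polar r θ)‖ₑ ^ 2
          + ‖F₂ (polar r θ)‖ₑ ^ 2 * ‖G.g (polar r θ)‖ₑ ^ 2) := by
        refine lintegral_mono fun θ => ?_
        rw [← add_mul, ← mul_assoc]
        gcongr
        refine (pow_le_pow_left' (enorm_add_le _ _) 2).trans ?_
        have h := ENNReal.rpow_add_le_mul_rpow_add_rpow ‖F₁ (polar r θ)‖ₑ ‖F₂ (polar r θ)‖ₑ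
          (one_le_two : (1 : ℝ) ≤ 2)
        have e : (2 : ℝ) - 1 = 1 := by norm_num
        rw [e, ENNReal.rpow_one] at h
        exact_mod_cast h
    _ = 2 * ((∫⁻ θ : Torus, ‖F₁ (polar r θ)‖ₑ ^ 2 * ‖G.g (polar r θ)‖ₑ ^ 2)
          + ∫⁻ θ : Torus, ‖F₂ (polar r θ)‖ₑ ^ 2 * ‖G.g (polar r θ)‖ₑ ^ 2) := by
        rw [lintegral_const_mul' _ _ (by simp), lintegral_add_left hm]
    _ ≤ _ := by
        gcongr
        · exact le_iSup₂ (f := fun r (_ : r ∈ Ico (0 : ℝ) 1) =>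
            ∫⁻ θ : Torus, ‖F₁ (polar r θ)‖ₑ ^ 2 * ‖G.g (polar r θ)‖ₑ ^ 2) r hr
        · exact le_iSup₂ (f := fun r (_ : r ∈ Ico (0 : ℝ) 1) =>
            ∫⁻ θ : Torus, ‖F₂ (polar r θ)‖ₑ ^ 2 * ‖G.g (polar r θ)‖ₑ ^ 2) r hr

variable (G)

/-- The weighted Hardy space `H²(𝕋, |g|²)` as a subspace of `L²(𝕋, |g|²)`, through radial
boundary values. -/
noncomputable def hardySpace : Submodule ℂ (Lp ℂ 2 G.measure) where
  carrier := {f | ∃ F : ℂ → ℂ, G.MemHardy F ∧ G.HasBoundaryValue F f}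
  zero_mem' := by
    refine ⟨0, MemHardy.zero, ?_⟩
    filter_upwards [Lp.coeFn_zero ℂ 2 G.measure] with θ hθ
    rw [hθ]
    exact tendsto_const_nhds
  add_mem' := by
    rintro f₁ f₂ ⟨F₁, h₁, b₁⟩ ⟨F₂, h₂, b₂⟩
    refine ⟨F₁ + F₂, h₁.add h₂, ?_⟩
    filter_upwards [Lp.coeFn_add f₁ f₂, b₁, b₂] with θ hθ t₁ t₂
    rw [hθ]
    exact t₁.add t₂
  smul_mem' := by
    rintro c f ⟨F, h, b⟩
    refine ⟨c • F, h.smul c, ?_⟩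
    filter_upwards [Lp.coeFn_smul c f, b] with θ hθ t
    rw [hθ]
    exact t.const_smul c

/-- The weighted Szegő projection `S_μ`: the orthogonal projection of `L²(𝕋, μ)` onto
`H²(𝕋, μ)`, where `μ = |g|²`. The space `H²(𝕋, μ)` is closed in `L²(𝕋, μ)`, so taking its closure
changes nothing; it is written only because Mathlib asks for a complete subspace. -/
noncomputable def szegoProjection : Lp ℂ 2 G.measure →L[ℂ] Lp ℂ 2 G.measure :=
  G.hardySpace.topologicalClosure.starProjection

/-- `S_μ` is bounded on `L^p(𝕋, μ)`: there is a finite constant `C` with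
`‖S_μ f‖_{p,μ} ≤ C ‖f‖_{p,μ}` for all `f ∈ L²(𝕋, μ) ∩ L^p(𝕋, μ)`. As this intersection is dense in
`L^p(𝕋, μ)` for `1 ≤ p < ∞`, this says that `S_μ` extends to a bounded operator on
`L^p(𝕋, μ)`. -/
def SzegoBoundedOn (p : ℝ≥0∞) : Prop :=
  ∃ C : ℝ≥0, ∀ f : Lp ℂ 2 G.measure, MemLp f p G.measure →
    eLpNorm (G.szegoProjection f) p G.measure ≤ C * eLpNorm f p G.measure

end Generator

/-- The function `g_α(z) = (z - 1)^α`, for the branch `(-1)^α (1 - z)^α`, which is holomorphic on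
the unit disc because `1 - z` has positive real part there. -/
noncomputable def gAlpha (α : ℝ) (hα : 0 ≤ α) : Generator where
  g z := (-1 : ℂ) ^ (α : ℂ) * (1 - z) ^ (α : ℂ)
  diffContOnCl := by
    have hc : ContinuousOn (fun z : ℂ => (1 - z) ^ (α : ℂ)) (Metric.closedBall 0 1) := by
      rcases hα.eq_or_lt with rfl | hpos
      · simpa using continuousOn_const
      intro z hz
      refine ContinuousAt.continuousWithinAt ?_
      have hsub : ContinuousAt (fun z : ℂ => 1 - z) z := by fun_prop
      by_cases h1 : z = 1
      · subst h1
        have h := (Complex.continuousAt_cpow_zero_of_re_pos (z := (α : ℂ)) (by simpa using hpos))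
        have hp : ContinuousAt (fun z : ℂ => ((1 - z, (α : ℂ)) : ℂ × ℂ)) 1 := by fun_prop
        exact ContinuousAt.comp_of_eq h hp (by simp)
      · refine ContinuousAt.cpow hsub continuousAt_const (Or.inl ?_)
        have hz' : ‖z‖ ≤ 1 := by simpa using hz
        have hre : z.re < 1 := by
          refine lt_of_le_of_ne ((Complex.re_le_norm z).trans hz') fun h => h1 ?_
          have h2 := Complex.sq_norm z
          rw [Complex.normSq_apply] at h2
          have h4 : z.im = 0 := by nlinarith [norm_nonneg z, mul_self_nonneg z.im]
          exact Complex.ext (by simp [h]) (by simp [h4])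
        simpa using hre
    refine ⟨?_, ?_⟩
    · refine DifferentiableOn.const_mul (fun z hz => ?_) _
      refine DifferentiableAt.differentiableWithinAt ?_
      refine DifferentiableAt.cpow_const (by fun_prop) (Or.inl ?_)
      have hz' : ‖z‖ < 1 := by simpa using hz
      have := (Complex.re_le_norm z).trans_lt hz'
      simpa using this
    · rw [closure_ball _ one_ne_zero]
      exact continuousOn_const.mul hc
  ne_zero z hz := by
    have hz' : z ≠ 1 := by rintro rfl; simp at hz
    exact mul_ne_zero (by simp [Complex.cpow_eq_zero_iff])
      (by simp [Complex.cpow_eq_zero_iff, sub_eq_zero, hz'.symm])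

/-- The weight is `μ_α(z) = |g_α(z)|² = |z - 1|^{2α}`. -/
theorem norm_gAlpha_sq (α : ℝ) (hα : 0 ≤ α) (z : ℂ) :
    ‖(gAlpha α hα).g z‖ ^ 2 = ‖z - 1‖ ^ (2 * α) := by
  have h : ‖(gAlpha α hα).g z‖ = ‖z - 1‖ ^ α := by
    simp only [gAlpha, norm_mul, Complex.norm_cpow_real, norm_neg, norm_one, Real.one_rpow,
      one_mul, norm_sub_rev]
  rw [h, mul_comm, Real.rpow_mul (norm_nonneg _)]
  norm_cast

end WeightedSzego

namespace WeightedSzego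

-- Dividing by the generator removes the weight from the Hilbert space. Since `g_α` has no zeros in
-- the disc, `h ↦ h / (√(2π) g_α)` is a unitary map from `L²` of normalized arc length onto
-- `L²(μ_α)`, and it carries the closed span of the characters `e^{inθ}`, `n ≥ 0`, onto the closure
-- of the weighted Hardy space. Hence `S_μ` is unitarily conjugate to the Riesz projection `P`
-- (`szegoProjection_divIsometry`). As `∫ |h/g|^p |g|² = ∫ |g|^{2-p} |h|^p`, boundedness of `S_μ` on
-- `L^p(μ_α)` means boundedness of `P` for the weight `|g_α|^{2-p}`, which is comparable to `|θ|^a`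
-- with `a = α(2-p)`. For `p > 1` the condition is `-1 < a < p - 1`, whose two halves are the two
-- end points of the interval; `p = 1` is never admissible.
--
-- Sufficiency: `P` is an a.e. limit of dilated Cauchy transforms, so by Fatou bounds uniform in the
-- radius are enough. Without weight this is M. Riesz's theorem: for `1 < p ≤ 2` and `f ≥ 0` one
-- integrates `|Φ|^p ≤ A (Re Φ)^p - B Re Φ^p` for the Cauchy transform `Φ` of `f`, and `p > 2`
-- follows by duality. With weight, the commutator of the Cauchy transform with multiplication by
-- `|θ|^{a/p}` is dominated by a kernel homogeneous of degree `-1`, which the Schur test bounds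
-- exactly in this range of `a`.
--
-- Necessity: `P h - e^{iθ} P(e^{-iθ} h)` is the mean of `h`, so boundedness gives `|mean h|^p ∫ w ≤
-- D ∫ w |h|^p`. Truncations of `|θ|⁻¹` then exclude `a ≤ -1` and `a ≥ p - 1`. For `p = 1`, Cauchy
-- kernels with pole near `-1`, away from the zero of the weight, have real parts of bounded norm
-- and projections of unbounded norm.

local notation "𝔪" => (AddCircle.haarAddCircle : Measure Torus)

/-! ### Arc distance, chord length and integrals of radial functions -/

theorem norm_torus_le_pi (θ : Torus) : ‖θ‖ ≤ Real.pi := by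
  have h := AddCircle.norm_le_half_period (x := θ) (2 * Real.pi) Real.two_pi_pos.ne'
  rwa [abs_of_pos Real.two_pi_pos, mul_div_cancel_left₀ _ two_ne_zero] at h

theorem norm_coe_torus {x : ℝ} (hx : |x| ≤ Real.pi) : ‖(x : Torus)‖ = |x| := by
  rw [AddCircle.norm_coe_eq_abs_iff _ Real.two_pi_pos.ne', abs_of_pos Real.two_pi_pos,
    mul_div_cancel_left₀ _ two_ne_zero]
  exact hx

theorem exists_coe_torus (θ : Torus) : ∃ x : ℝ, |x| ≤ Real.pi ∧ (x : Torus) = θ := by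
  refine ⟨AddCircle.equivIoc (2 * Real.pi) (-Real.pi) θ, ?_, AddCircle.coe_equivIoc⟩
  have h := (AddCircle.equivIoc (2 * Real.pi) (-Real.pi) θ).2
  rw [abs_le]
  exact ⟨h.1.le, by linarith [h.2]⟩

theorem toCircle_coe (x : ℝ) :
    (AddCircle.toCircle (x : Torus) : ℂ) = Complex.exp (Complex.I * x) := by
  have h := polar_coe 1 x
  rw [polar, Complex.ofReal_one, one_mul, one_mul] at h
  rw [h, mul_comm]

theorem norm_toCircle_sub_one_le (θ : Torus) :
    ‖(AddCircle.toCircle θ : ℂ) - 1‖ ≤ ‖θ‖ := by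
  obtain ⟨x, hx, rfl⟩ := exists_coe_torus θ
  rw [toCircle_coe, norm_coe_torus hx]
  exact Real.norm_exp_I_mul_ofReal_sub_one_le

theorem mul_norm_le_norm_toCircle_sub_one (θ : Torus) :
    2 / Real.pi * ‖θ‖ ≤ ‖(AddCircle.toCircle θ : ℂ) - 1‖ := by
  obtain ⟨x, hx, rfl⟩ := exists_coe_torus θ
  rw [toCircle_coe, norm_coe_torus hx, Complex.norm_exp_I_mul_ofReal_sub_one, norm_mul,
    Real.norm_eq_abs, Real.norm_eq_abs, abs_two]
  have h := Real.mul_abs_le_abs_sin (x := x / 2) (by rw [abs_div, abs_two]; linarith)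
  rw [abs_div, abs_two] at h
  linarith

/-- The reflection `θ ↦ -θ` folds one half circle onto the other, whence the factor 2. -/
theorem lintegral_comp_norm_torus (F : ℝ → ℝ≥0∞) :
    ∫⁻ θ : Torus, F ‖θ‖ = 2 * ∫⁻ t in Ioc 0 Real.pi, F t := by
  have hpi := Real.pi_pos
  rw [← AddCircle.lintegral_preimage (2 * Real.pi) (-Real.pi)]
  have e : Ioc (-Real.pi) (-Real.pi + 2 * Real.pi) = Ioc (-Real.pi) 0 ∪ Ioc 0 Real.pi := by
    rw [Ioc_union_Ioc_eq_Ioc (by linarith) hpi.le]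
    congr 1
    ring
  rw [e, lintegral_union measurableSet_Ioc
    (by rw [Set.disjoint_left]; intro x h1 h2; exact absurd h1.2 (not_le.2 h2.1))]
  have h1 : ∫⁻ a in Ioc (-Real.pi) 0, F ‖(a : Torus)‖ = ∫⁻ t in Ioc 0 Real.pi, F t := by
    have h2 : ∫⁻ a in Ioc (-Real.pi) 0, F ‖(a : Torus)‖
        = ∫⁻ a, (Ico 0 Real.pi).indicator F (-a) := by
      rw [← lintegral_indicator measurableSet_Ioc]
      refine lintegral_congr fun a => ?_
      by_cases ha : a ∈ Ioc (-Real.pi) 0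
      · have hb : -a ∈ Ico 0 Real.pi := ⟨by linarith [ha.2], by linarith [ha.1]⟩
        rw [indicator_of_mem ha, indicator_of_mem hb, norm_coe_torus (by
          rw [abs_of_nonpos ha.2]; exact hb.2.le), abs_of_nonpos ha.2]
      · have hb : -a ∉ Ico 0 Real.pi := fun h => ha ⟨by linarith [h.2], by linarith [h.1]⟩
        rw [indicator_of_notMem ha, indicator_of_notMem hb]
    rw [h2, lintegral_neg_eq_self (f := (Ico 0 Real.pi).indicator F),
      lintegral_indicator measurableSet_Ico]
    exact setLIntegral_congr Ico_ae_eq_Ioc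
  rw [h1, two_mul (∫⁻ t in Ioc 0 Real.pi, F t)]
  congr 1
  refine setLIntegral_congr_fun measurableSet_Ioc fun a ha => ?_
  rw [norm_coe_torus (by rw [abs_of_pos ha.1]; exact ha.2), abs_of_pos ha.1]

theorem lintegral_haar_eq (f : Torus → ℝ≥0∞) :
    ∫⁻ θ : Torus, f θ = ENNReal.ofReal (2 * Real.pi) * ∫⁻ θ, f θ ∂AddCircle.haarAddCircle := by
  rw [AddCircle.volume_eq_smul_haarAddCircle, lintegral_smul_measure, smul_eq_mul]

theorem lintegral_haar_le (f : Torus → ℝ≥0∞) :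
    ∫⁻ θ, f θ ∂AddCircle.haarAddCircle ≤ ∫⁻ θ : Torus, f θ := by
  rw [lintegral_haar_eq]
  have : 1 ≤ ENNReal.ofReal (2 * Real.pi) := by
    rw [ENNReal.one_le_ofReal]
    linarith [Real.pi_gt_three]
  calc _ = 1 * ∫⁻ θ, f θ ∂AddCircle.haarAddCircle := (one_mul _).symm
    _ ≤ _ := by gcongr

theorem volume_torus_singleton (θ : Torus) : volume {θ} = 0 := by
  have h := AddCircle.volume_closedBall (2 * Real.pi) (x := θ) 0
  rwa [Metric.closedBall_zero, mul_zero, min_eq_right Real.two_pi_pos.le,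
    ENNReal.ofReal_zero] at h

theorem ae_norm_torus_pos : ∀ᵐ θ : Torus, 0 < ‖θ‖ := by
  rw [ae_iff]
  have : {θ : Torus | ¬0 < ‖θ‖} = {0} := by
    ext θ
    simp
  rw [this, volume_torus_singleton]

/-! ### The Schur test and kernels homogeneous of degree -1 -/

/-- **Schur test** on `L^p`. -/
theorem lintegral_rpow_lintegral_mul_le {β : Type*} [MeasurableSpace β] {ν : Measure β}
    [SFinite ν] {p : ℝ} (hp : 1 < p) {K : β → β → ℝ≥0∞} (hK : Measurable (Function.uncurry K))
    {ψ : β → ℝ≥0∞} (hψ : Measurable ψ) (hψ0 : ∀ᵐ y ∂ν, ψ y ≠ 0 ∧ ψ y ≠ ∞) {A B : ℝ≥0∞}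
    (h₁ : ∀ᵐ x ∂ν, ∫⁻ y, K x y * ψ y ∂ν ≤ A * ψ x)
    (h₂ : ∀ᵐ y ∂ν, ∫⁻ x, K x y * ψ x ^ (p - 1) ∂ν ≤ B * ψ y ^ (p - 1))
    {f : β → ℝ≥0∞} (hf : Measurable f) :
    ∫⁻ x, (∫⁻ y, K x y * f y ∂ν) ^ p ∂ν ≤ A ^ (p - 1) * B * ∫⁻ y, f y ^ p ∂ν := by
  have hp0 : 0 < p := by linarith
  have hp1 : 0 < p - 1 := by linarith
  have hKx : ∀ x, Measurable (K x) := fun x => hK.comp (measurable_const.prodMk measurable_id)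
  have hKy : ∀ y, Measurable fun x => K x y :=
    fun y => hK.comp (measurable_id.prodMk measurable_const)
  set q : ℝ := p / (p - 1) with hq
  have hpq : q.HolderConjugate p := (Real.HolderConjugate.conjExponent hp).symm
  have hq0 : 0 < q := hpq.pos
  have hq1 : 1 / q = (p - 1) / p := by rw [hq, one_div_div]
  have point : ∀ᵐ x ∂ν, (∫⁻ y, K x y * f y ∂ν) ^ p
      ≤ A ^ (p - 1) * (ψ x ^ (p - 1) * ∫⁻ y, K x y * (ψ y ^ (-(p - 1)) * f y ^ p) ∂ν) := by
    filter_upwards [h₁] with x hx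
    -- Hölder splitting `K f = (K ψ)^{1/q} (K ψ^{-(p-1)} f^p)^{1/p}`: the first factor is controlled
    -- by `h₁`, the second by `h₂` after exchanging the integrals.
    have e : ∫⁻ y, K x y * f y ∂ν = ∫⁻ y, ((fun y => (K x y * ψ y) ^ (1 / q)) *
        fun y => (K x y * (ψ y ^ (-(p - 1)) * f y ^ p)) ^ (1 / p)) y ∂ν := by
      refine lintegral_congr_ae ?_
      filter_upwards [hψ0] with y hy
      have s1 : K x y = K x y ^ (1 / q) * K x y ^ (1 / p) := by
        rw [← ENNReal.rpow_add_of_nonneg _ _ (by positivity) (by positivity)]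
        have : 1 / q + 1 / p = 1 := by
          simpa [one_div] using hpq.inv_add_inv_eq_one
        rw [this, ENNReal.rpow_one]
      have s2 : ψ y ^ (1 / q) * (ψ y ^ (-(p - 1))) ^ (1 / p) = 1 := by
        rw [← ENNReal.rpow_mul, ← ENNReal.rpow_add _ _ hy.1 hy.2, hq1]
        have : (p - 1) / p + -(p - 1) * (1 / p) = 0 := by field_simp; ring
        rw [this, ENNReal.rpow_zero]
      have s3 : (f y ^ p) ^ (1 / p) = f y := by
        rw [← ENNReal.rpow_mul, mul_one_div_cancel hp0.ne', ENNReal.rpow_one]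
      simp only [Pi.mul_apply]
      rw [ENNReal.mul_rpow_of_nonneg _ _ (by positivity : 0 ≤ 1 / q),
        ENNReal.mul_rpow_of_nonneg _ _ (by positivity : 0 ≤ 1 / p),
        ENNReal.mul_rpow_of_nonneg _ _ (by positivity : 0 ≤ 1 / p), s3]
      calc K x y * f y = (K x y ^ (1 / q) * K x y ^ (1 / p)) * 1 * f y := by rw [← s1, mul_one]
        _ = _ := by rw [← s2]; ring
    have hol := ENNReal.lintegral_mul_le_Lp_mul_Lq ν hpq
      (f := fun y => (K x y * ψ y) ^ (1 / q))
      (g := fun y => (K x y * (ψ y ^ (-(p - 1)) * f y ^ p)) ^ (1 / p))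
      (((hKx x).mul hψ).pow_const _).aemeasurable
      (((hKx x).mul ((hψ.pow_const _).mul (hf.pow_const _))).pow_const _).aemeasurable
    rw [← e] at hol
    simp only [← ENNReal.rpow_mul, one_div_mul_cancel hq0.ne', one_div_mul_cancel hp0.ne',
      ENNReal.rpow_one] at hol
    calc (∫⁻ y, K x y * f y ∂ν) ^ p
        ≤ ((∫⁻ y, K x y * ψ y ∂ν) ^ (1 / q) *
          (∫⁻ y, K x y * (ψ y ^ (-(p - 1)) * f y ^ p) ∂ν) ^ (1 / p)) ^ p := by gcongr
      _ = (∫⁻ y, K x y * ψ y ∂ν) ^ (p - 1) *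
          ∫⁻ y, K x y * (ψ y ^ (-(p - 1)) * f y ^ p) ∂ν := by
        rw [ENNReal.mul_rpow_of_nonneg _ _ hp0.le, ← ENNReal.rpow_mul, ← ENNReal.rpow_mul,
          one_div_mul_cancel hp0.ne', ENNReal.rpow_one, hq1, div_mul_cancel₀ _ hp0.ne']
      _ ≤ (A * ψ x) ^ (p - 1) * ∫⁻ y, K x y * (ψ y ^ (-(p - 1)) * f y ^ p) ∂ν := by gcongr
      _ = _ := by rw [ENNReal.mul_rpow_of_nonneg _ _ hp1.le, mul_assoc]
  have hmeas : Measurable (Function.uncurry fun x y =>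
      ψ x ^ (p - 1) * (K x y * (ψ y ^ (-(p - 1)) * f y ^ p))) :=
    ((hψ.comp measurable_fst).pow_const _).mul (hK.mul
      (((hψ.comp measurable_snd).pow_const _).mul ((hf.comp measurable_snd).pow_const _)))
  have hmx : ∀ x, Measurable fun y => K x y * (ψ y ^ (-(p - 1)) * f y ^ p) := fun x =>
    (hKx x).mul ((hψ.pow_const _).mul (hf.pow_const _))
  calc ∫⁻ x, (∫⁻ y, K x y * f y ∂ν) ^ p ∂ν
      ≤ ∫⁻ x, A ^ (p - 1) *
        ∫⁻ y, ψ x ^ (p - 1) * (K x y * (ψ y ^ (-(p - 1)) * f y ^ p)) ∂ν ∂ν := by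
        refine lintegral_mono_ae ?_
        filter_upwards [point] with x hx
        rwa [lintegral_const_mul _ (hmx x)]
    _ = A ^ (p - 1) * ∫⁻ x,
        ∫⁻ y, ψ x ^ (p - 1) * (K x y * (ψ y ^ (-(p - 1)) * f y ^ p)) ∂ν ∂ν :=
        lintegral_const_mul _ hmeas.lintegral_prod_right'
    _ = A ^ (p - 1) * ∫⁻ y,
        ∫⁻ x, ψ x ^ (p - 1) * (K x y * (ψ y ^ (-(p - 1)) * f y ^ p)) ∂ν ∂ν := by
        rw [lintegral_lintegral_swap hmeas.aemeasurable]
    _ ≤ A ^ (p - 1) * ∫⁻ y, B * f y ^ p ∂ν := by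
        refine mul_le_mul_right ?_ _
        refine lintegral_mono_ae ?_
        filter_upwards [h₂, hψ0] with y hy hy0
        calc ∫⁻ x, ψ x ^ (p - 1) * (K x y * (ψ y ^ (-(p - 1)) * f y ^ p)) ∂ν
            = ∫⁻ x, (ψ y ^ (-(p - 1)) * f y ^ p) * (K x y * ψ x ^ (p - 1)) ∂ν :=
              lintegral_congr fun x => by ring
          _ = (ψ y ^ (-(p - 1)) * f y ^ p) * ∫⁻ x, K x y * ψ x ^ (p - 1) ∂ν :=
              lintegral_const_mul _ ((hKy y).mul (hψ.pow_const _))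
          _ ≤ (ψ y ^ (-(p - 1)) * f y ^ p) * (B * ψ y ^ (p - 1)) := by gcongr
          _ = B * f y ^ p * (ψ y ^ (-(p - 1)) * ψ y ^ (p - 1)) := by ring
          _ = B * f y ^ p := by
              rw [← ENNReal.rpow_add _ _ hy0.1 hy0.2, neg_add_cancel, ENNReal.rpow_zero, mul_one]
    _ = _ := by rw [lintegral_const_mul _ (hf.pow_const _), mul_assoc]

/-- The homogeneous kernel `|t^{-b} - 1| / |1 - t| * t^{-s}` on the half line. -/
noncomputable def powerKernel (b s t : ℝ) : ℝ := |t ^ (-b) - 1| / |1 - t| * t ^ (-s)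

/-- Substitute `y = x t`. By homogeneity a power `y ^ (-s)` is an eigenfunction of the kernel, which
makes powers the natural test functions for the Schur test. -/
theorem lintegral_powerKernel_scale (b s : ℝ) {x : ℝ} (hx : 0 < x) :
    ∫⁻ y in Ioi (0 : ℝ), ENNReal.ofReal (|x ^ b * y ^ (-b) - 1| / |x - y| * y ^ (-s))
      = ENNReal.ofReal (x ^ (-s)) * ∫⁻ t in Ioi (0 : ℝ), ENNReal.ofReal (powerKernel b s t) := by
  have him : (fun t => x * t) '' Ioi (0 : ℝ) = Ioi 0 := by
    ext y
    simp only [mem_image, mem_Ioi]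
    refine ⟨?_, fun hy => ⟨y / x, by positivity, by field_simp⟩⟩
    rintro ⟨t, ht, rfl⟩
    positivity
  conv_lhs => rw [← him]
  rw [lintegral_image_eq_lintegral_abs_deriv_mul (f := fun t => x * t) (f' := fun _ => x)
    measurableSet_Ioi (fun t _ => by simpa using ((hasDerivAt_id t).const_mul x).hasDerivWithinAt)
    (fun a _ c _ h => mul_left_cancel₀ hx.ne' h),
    ← lintegral_const_mul' _ _ ENNReal.ofReal_ne_top]
  refine setLIntegral_congr_fun measurableSet_Ioi fun t ht => ?_
  have ht : 0 < t := ht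
  rw [← ENNReal.ofReal_mul (abs_nonneg _), ← ENNReal.ofReal_mul (by positivity)]
  congr 1
  rw [Real.mul_rpow hx.le ht.le, Real.mul_rpow hx.le ht.le, ← mul_assoc (x ^ b),
    ← Real.rpow_add hx, add_neg_cancel, Real.rpow_zero, one_mul, powerKernel, abs_of_pos hx]
  have : |x - x * t| = x * |1 - t| := by
    rw [← abs_of_pos hx, ← abs_mul, abs_of_pos hx]
    congr 1
    ring
  rw [this]
  field_simp

theorem lintegral_rpow_Ioo_lt_top {s : ℝ} (hs : -1 < s) {a : ℝ} (ha : 0 < a) :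
    ∫⁻ t in Ioo (0 : ℝ) a, ENNReal.ofReal (t ^ s) < ∞ := by
  have h := ((intervalIntegral.integrableOn_Ioo_rpow_iff ha).2 hs).2
  refine lt_of_eq_of_lt (setLIntegral_congr_fun measurableSet_Ioo fun t ht => ?_) h
  have ht : 0 < t := ht.1
  simp only
  rw [← ofReal_norm, Real.norm_of_nonneg (by positivity)]

theorem lintegral_rpow_Ioi_lt_top {s : ℝ} (hs : s < -1) {a : ℝ} (ha : 0 < a) :
    ∫⁻ t in Ioi a, ENNReal.ofReal (t ^ s) < ∞ := by
  have h := (integrableOn_Ioi_rpow_of_lt hs ha).2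
  refine lt_of_eq_of_lt (setLIntegral_congr_fun measurableSet_Ioi fun t ht => ?_) h
  have ht : 0 < t := ha.trans ht
  simp only
  rw [← ofReal_norm, Real.norm_of_nonneg (by positivity)]

/-- The integrand is dominated by `t^{-(b+s)} + t^{-s}` near 0 and by `t^{-(b+s)-1} + t^{-s-1}` near
infinity, so convergence needs both exponents in `(0, 1)`. At `t = 1` there is no real singularity,
because `t^{-b}` is Lipschitz there. -/
theorem lintegral_powerKernel_lt_top {b s : ℝ} (h1 : b + s < 1) (h2 : s < 1) (h3 : 0 < b + s)
    (h4 : 0 < s) : ∫⁻ t in Ioi (0 : ℝ), ENNReal.ofReal (powerKernel b s t) < ∞ := by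
  obtain ⟨L, hL⟩ : ∃ L : ℝ, ∀ t ∈ Icc (1 / 2 : ℝ) 2, powerKernel b s t ≤ L := by
    have hne : ∀ t ∈ Icc (1 / 2 : ℝ) 2, t ≠ 0 := fun t ht => by
      have := ht.1
      positivity
    have hc : ∀ u : ℝ, ContinuousOn (fun t : ℝ => t ^ u) (Icc (1 / 2 : ℝ) 2) := fun u =>
      continuousOn_id.rpow_const fun t ht => Or.inl (hne t ht)
    obtain ⟨D, hD⟩ := isCompact_Icc.exists_bound_of_continuousOn
      (continuousOn_const.mul (hc (-b - 1)) : ContinuousOn (fun t : ℝ => -b * t ^ (-b - 1))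
        (Icc (1 / 2 : ℝ) 2))
    obtain ⟨E, hE⟩ := isCompact_Icc.exists_bound_of_continuousOn (hc (-s))
    have hlip : ∀ t ∈ Icc (1 / 2 : ℝ) 2, |t ^ (-b) - 1| ≤ D * |1 - t| := fun t ht => by
      have := (convex_Icc (1 / 2 : ℝ) 2).norm_image_sub_le_of_norm_hasDerivWithin_le
        (f := fun t : ℝ => t ^ (-b)) (fun u hu =>
          (Real.hasDerivAt_rpow_const (Or.inl (hne u hu))).hasDerivWithinAt) hD
        (by norm_num : (1 : ℝ) ∈ Icc (1 / 2 : ℝ) 2) ht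
      simpa [Real.norm_eq_abs, abs_sub_comm] using this
    refine ⟨D * E, fun t ht => ?_⟩
    have hE' := hE t ht
    have ht0 : 0 < t := by have := ht.1; positivity
    rw [Real.norm_of_nonneg (by positivity)] at hE'
    have hD0 : 0 ≤ D := (norm_nonneg _).trans (hD t ht)
    have : |t ^ (-b) - 1| / |1 - t| ≤ D := by
      rcases eq_or_ne t 1 with rfl | h
      · simpa using hD0
      · exact (div_le_iff₀ (abs_pos.2 (sub_ne_zero.2 h.symm))).2 (hlip t ht)
    exact mul_le_mul this hE' (by positivity) hD0
  have hnum : ∀ t : ℝ, 0 < t → |t ^ (-b) - 1| ≤ t ^ (-b) + 1 := fun t ht => by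
    have : 0 ≤ t ^ (-b) := by positivity
    rw [abs_le]
    constructor <;> linarith
  have b1 : ∀ t ∈ Ioo (0 : ℝ) (1 / 2), powerKernel b s t ≤ 2 * (t ^ (-(b + s)) + t ^ (-s)) := by
    intro t ht
    have ht0 := ht.1
    have h1t : 1 / 2 ≤ |1 - t| := by
      rw [abs_of_pos (by linarith [ht.2])]
      linarith [ht.2]
    calc powerKernel b s t ≤ (t ^ (-b) + 1) / (1 / 2) * t ^ (-s) := by
          unfold powerKernel
          gcongr
          exact hnum t ht0
      _ = 2 * (t ^ (-b) * t ^ (-s) + t ^ (-s)) := by ring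
      _ = _ := by rw [← Real.rpow_add ht0]; ring_nf
  have b2 : ∀ t ∈ Ioi (2 : ℝ), powerKernel b s t ≤ 2 * (t ^ (-(b + s) - 1) + t ^ (-s - 1)) := by
    intro t ht
    have ht2 : 2 < t := ht
    have ht0 : 0 < t := by linarith
    have h1t : t / 2 ≤ |1 - t| := by
      rw [abs_sub_comm, abs_of_pos (by linarith)]
      linarith
    calc powerKernel b s t ≤ (t ^ (-b) + 1) / (t / 2) * t ^ (-s) := by
          unfold powerKernel
          gcongr
          exact hnum t ht0
      _ = 2 * (t ^ (-b) * t ^ (-s) / t + t ^ (-s) / t) := by ring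
      _ = _ := by
        rw [← Real.rpow_add ht0, Real.rpow_sub_one ht0.ne', Real.rpow_sub_one ht0.ne', neg_add]
  have two_sum : ∀ (S : Set ℝ) (u v : ℝ), MeasurableSet S → (∀ t ∈ S, 0 < t) →
      (∀ t ∈ S, powerKernel b s t ≤ 2 * (t ^ u + t ^ v)) →
      ∫⁻ t in S, ENNReal.ofReal (t ^ u) < ∞ → ∫⁻ t in S, ENNReal.ofReal (t ^ v) < ∞ →
      ∫⁻ t in S, ENNReal.ofReal (powerKernel b s t) < ∞ := by
    intro S u v hS hpos hle hu hv
    calc ∫⁻ t in S, ENNReal.ofReal (powerKernel b s t)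
        ≤ ∫⁻ t in S, 2 * (ENNReal.ofReal (t ^ u) + ENNReal.ofReal (t ^ v)) := by
          refine setLIntegral_mono' hS fun t ht => ?_
          have ht0 := hpos t ht
          refine (ENNReal.ofReal_le_ofReal (hle t ht)).trans_eq ?_
          rw [ENNReal.ofReal_mul two_pos.le, ENNReal.ofReal_add (by positivity) (by positivity)]
          simp
      _ = 2 * ((∫⁻ t in S, ENNReal.ofReal (t ^ u)) + ∫⁻ t in S, ENNReal.ofReal (t ^ v)) := by
          rw [lintegral_const_mul' _ _ (by simp), lintegral_add_left (by fun_prop)]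
      _ < ∞ := ENNReal.mul_lt_top (by simp) (ENNReal.add_lt_top.2 ⟨hu, hv⟩)
  have hsub : Ioi (0 : ℝ) ⊆ Ioo 0 (1 / 2) ∪ (Icc (1 / 2) 2 ∪ Ioi 2) := fun t ht => by
    have ht : 0 < t := ht
    rcases lt_or_ge t (1 / 2) with h | h
    · exact Or.inl ⟨ht, h⟩
    · rcases le_or_gt t 2 with h' | h'
      · exact Or.inr (Or.inl ⟨h, h'⟩)
      · exact Or.inr (Or.inr h')
  refine (lintegral_mono_set hsub).trans_lt ((lintegral_union_le _ _ _).trans_lt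
    (ENNReal.add_lt_top.2 ⟨?_, (lintegral_union_le _ _ _).trans_lt (ENNReal.add_lt_top.2 ⟨?_, ?_⟩)⟩))
  · exact two_sum _ _ _ measurableSet_Ioo (fun t ht => ht.1) b1
      (lintegral_rpow_Ioo_lt_top (by linarith) (by norm_num))
      (lintegral_rpow_Ioo_lt_top (by linarith) (by norm_num))
  · refine (setLIntegral_mono' measurableSet_Icc fun t ht =>
      ENNReal.ofReal_le_ofReal (hL t ht)).trans_lt ?_
    rw [setLIntegral_const]
    exact ENNReal.mul_lt_top (by simp) (by simp)
  · exact two_sum _ _ _ measurableSet_Ioi (fun t ht => two_pos.trans ht) b2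
      (lintegral_rpow_Ioi_lt_top (by linarith) two_pos)
      (lintegral_rpow_Ioi_lt_top (by linarith) two_pos)

/-- The integral operator on the circle with kernel
`| |θ|^b |φ|^{-b} - 1 | / | |θ| - |φ| |` is bounded on `L^p` for `-1/p < b < 1 - 1/p`. -/
theorem exists_lintegral_powerKernel_torus_le {p b : ℝ} (hp : 1 < p) (hb1 : -1 < b * p)
    (hb2 : b * p < p - 1) : ∃ C : ℝ≥0, ∀ f : Torus → ℝ≥0∞, Measurable f →
      ∫⁻ θ : Torus, (∫⁻ φ : Torus, ENNReal.ofReal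
        (|‖θ‖ ^ b * ‖φ‖ ^ (-b) - 1| / |‖θ‖ - ‖φ‖|) * f φ) ^ p ≤ C * ∫⁻ φ : Torus, f φ ^ p := by
  have hp0 : 0 < p := by linarith
  have hip : p * p⁻¹ = 1 := mul_inv_cancel₀ hp0.ne'
  have hi0 : 0 < p⁻¹ := inv_pos.2 hp0
  have c1 : 0 < b + p⁻¹ := by nlinarith
  have c2 : b + p⁻¹ < 1 := by nlinarith
  have c3 : p⁻¹ < 1 := inv_lt_one_of_one_lt₀ hp
  set A := 2 * ∫⁻ t in Ioi (0 : ℝ), ENNReal.ofReal (powerKernel b p⁻¹ t) with hA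
  set B := 2 * ∫⁻ t in Ioi (0 : ℝ), ENNReal.ofReal (powerKernel (-b) (1 - p⁻¹) t) with hB
  have hAt : A < ∞ := ENNReal.mul_lt_top (by simp) (lintegral_powerKernel_lt_top c2 c3 c1 hi0)
  have hBt : B < ∞ := ENNReal.mul_lt_top (by simp)
    (lintegral_powerKernel_lt_top (by linarith) (by linarith) (by linarith) (by linarith))
  have hne := ae_norm_torus_pos
  -- The circle is two copies of `(0, π]`; enlarging to the half line makes scaling available.
  have half : ∀ (c s x : ℝ), 0 < x → ∫⁻ φ : Torus,
      ENNReal.ofReal (|x ^ c * ‖φ‖ ^ (-c) - 1| / |x - ‖φ‖| * ‖φ‖ ^ (-s)) ≤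
      (2 * ∫⁻ t in Ioi (0 : ℝ), ENNReal.ofReal (powerKernel c s t)) *
        ENNReal.ofReal (x ^ (-s)) := by
    intro c s x hx
    rw [lintegral_comp_norm_torus (fun y =>
      ENNReal.ofReal (|x ^ c * y ^ (-c) - 1| / |x - y| * y ^ (-s))), mul_assoc,
      mul_comm _ (ENNReal.ofReal (x ^ (-s))), ← lintegral_powerKernel_scale c s hx]
    gcongr
    exact Ioc_subset_Ioi_self
  refine ⟨(A ^ (p - 1) * B).toNNReal, fun f hf => ?_⟩
  rw [ENNReal.coe_toNNReal (ENNReal.mul_lt_top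
    (ENNReal.rpow_lt_top_of_nonneg (by linarith) hAt.ne) hBt).ne]
  -- With `ψ = |φ|^{-1/p}` one has `ψ^{p-1} = |φ|^{-(1-1/p)}`. The two Schur conditions use `(b,
  -- 1/p)` and `(-b, 1 - 1/p)`, and both reduce to `0 < b + 1/p < 1`.
  refine lintegral_rpow_lintegral_mul_le hp (ψ := fun φ => ENNReal.ofReal (‖φ‖ ^ (-p⁻¹)))
    (K := fun θ φ => ENNReal.ofReal (|‖θ‖ ^ b * ‖φ‖ ^ (-b) - 1| / |‖θ‖ - ‖φ‖|))
    ?_ (by fun_prop) ?_ ?_ ?_ hf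
  · simp only [Function.uncurry_def]
    fun_prop
  · filter_upwards [hne] with φ hφ
    exact ⟨by simpa using by positivity, ENNReal.ofReal_ne_top⟩
  · filter_upwards [hne] with θ hθ
    refine le_trans (le_of_eq ?_) (half b p⁻¹ ‖θ‖ hθ)
    refine lintegral_congr fun φ => ?_
    rw [← ENNReal.ofReal_mul (by positivity)]
  · filter_upwards [hne] with φ hφ
    have hpow : ∀ θ : Torus, 0 < ‖θ‖ →
        ENNReal.ofReal (‖θ‖ ^ (-p⁻¹)) ^ (p - 1) = ENNReal.ofReal (‖θ‖ ^ (-(1 - p⁻¹))) := by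
      intro θ hθ
      rw [ENNReal.ofReal_rpow_of_pos (by positivity), ← Real.rpow_mul hθ.le]
      congr 2
      linear_combination -hip
    rw [hpow φ hφ]
    refine le_trans (le_of_eq ?_) (half (-b) (1 - p⁻¹) ‖φ‖ hφ)
    refine lintegral_congr_ae ?_
    filter_upwards [hne] with θ hθ
    rw [hpow θ hθ, ← ENNReal.ofReal_mul (by positivity), neg_neg, abs_sub_comm ‖φ‖ ‖θ‖,
      mul_comm (‖φ‖ ^ (-b))]

/-! ### The Cauchy transform and its Fourier coefficients -/

/-- The Cauchy transform `z ↦ ∫ h(φ) / (1 - z e^{-iφ}) dm(φ)` of a function on the circle. -/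
noncomputable def cauchyTransform (h : Torus → ℂ) (z : ℂ) : ℂ :=
  ∫ φ, (1 - z * fourier (-1) φ)⁻¹ * h φ ∂𝔪

theorem norm_fourier_apply (n : ℤ) (φ : Torus) : ‖fourier n φ‖ = 1 := by
  rw [fourier_apply, Circle.norm_coe]

theorem fourier_natCast_neg (n : ℕ) (φ : Torus) :
    fourier (-(n : ℤ)) φ = (fourier (-1) φ : ℂ) ^ n := by
  induction n with
  | zero => simp
  | succ k ih =>
    rw [pow_succ, ← ih, ← fourier_add]
    congr 2
    push_cast
    ring

theorem fourier_natCast (n : ℕ) (φ : Torus) :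
    fourier (n : ℤ) φ = (AddCircle.toCircle φ : ℂ) ^ n := by
  induction n with
  | zero => simp
  | succ k ih => rw [pow_succ, ← ih, ← fourier_one, ← fourier_add]; push_cast; rfl

theorem polar_pow (r : ℝ) (θ : Torus) (n : ℕ) : polar r θ ^ n = (r : ℂ) ^ n * fourier n θ := by
  rw [fourier_natCast, polar, mul_pow]

theorem norm_mul_fourier_lt_one {z : ℂ} (hz : ‖z‖ < 1) (n : ℤ) (φ : Torus) :
    ‖z * fourier n φ‖ < 1 := by
  rwa [norm_mul, norm_fourier_apply, mul_one]

theorem norm_fourierCoeff_le (h : Torus → ℂ) (n : ℤ) :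
    ‖fourierCoeff h n‖ ≤ ∫ φ, ‖h φ‖ ∂𝔪 := by
  refine (norm_integral_le_integral_norm _).trans_eq ?_
  simp only [smul_eq_mul, norm_mul, norm_fourier_apply, one_mul]

theorem hasSum_cauchyTransform {h : Torus → ℂ} (hh : Integrable h 𝔪) {z : ℂ} (hz : ‖z‖ < 1) :
    HasSum (fun n : ℕ => fourierCoeff h n * z ^ n) (cauchyTransform h z) := by
  have key := hasSum_integral_of_summable_integral_norm (μ := 𝔪)
    (F := fun (n : ℕ) φ => z ^ n * (fourier (-(n : ℤ)) φ • h φ))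
    (fun n => (hh.fourier_smul (-(n : ℤ))).const_mul _) (by
      simp only [norm_mul, smul_eq_mul, norm_fourier_apply, one_mul, norm_pow, integral_const_mul]
      exact (summable_geometric_of_lt_one (norm_nonneg _) hz).mul_right _)
  have e1 : ∀ n : ℕ, ∫ φ, z ^ n * (fourier (-(n : ℤ)) φ • h φ) ∂𝔪 = fourierCoeff h n * z ^ n :=
    fun n => by rw [integral_const_mul, mul_comm]; rfl
  have e2 : ∫ φ, ∑' n : ℕ, z ^ n * (fourier (-(n : ℤ)) φ • h φ) ∂𝔪 = cauchyTransform h z := by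
    refine integral_congr_ae (ae_of_all _ fun φ => ?_)
    simp only [smul_eq_mul, fourier_natCast_neg, ← mul_assoc, ← mul_pow]
    rw [tsum_mul_right, tsum_geometric_of_norm_lt_one (norm_mul_fourier_lt_one hz _ _)]
  simp only [e1] at key
  rwa [e2] at key

theorem differentiableOn_cauchyTransform {h : Torus → ℂ} (hh : Integrable h 𝔪) :
    DifferentiableOn ℂ (cauchyTransform h) (Metric.ball 0 1) := by
  intro z hz
  obtain ⟨ρ, hρ1, hρ2⟩ := exists_between (mem_ball_zero_iff.1 hz)
  have hd : DifferentiableOn ℂ (fun w => ∑' n : ℕ, fourierCoeff h n * w ^ n) (Metric.ball 0 ρ) := by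
    refine Complex.differentiableOn_tsum_of_summable_norm
      (u := fun n => (∫ φ, ‖h φ‖ ∂𝔪) * ρ ^ n)
      ((summable_geometric_of_lt_one ((norm_nonneg z).trans hρ1.le) hρ2).mul_left _)
      (fun n => by fun_prop) Metric.isOpen_ball fun n w hw => ?_
    rw [norm_mul, norm_pow]
    have := (mem_ball_zero_iff.1 hw).le
    exact mul_le_mul (norm_fourierCoeff_le h n) (by gcongr) (by positivity)
      (integral_nonneg fun _ => norm_nonneg _)
  have hnhds : Metric.ball (0 : ℂ) ρ ∈ 𝓝 z := Metric.isOpen_ball.mem_nhds (by simpa using hρ1)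
  refine ((hd.differentiableAt hnhds).congr_of_eventuallyEq ?_).differentiableWithinAt
  filter_upwards [hnhds] with w hw
  exact (hasSum_cauchyTransform hh ((mem_ball_zero_iff.1 hw).trans hρ2)).tsum_eq.symm

/-- The restriction of the Cauchy transform of `h` to the circle of radius `r`. -/
noncomputable def cauchyDilate (h : Torus → ℂ) (r : ℝ) (θ : Torus) : ℂ :=
  cauchyTransform h (polar r θ)

theorem continuous_cauchyDilate {h : Torus → ℂ} (hh : Integrable h 𝔪) {r : ℝ}
    (hr : r ∈ Ico (0 : ℝ) 1) : Continuous (cauchyDilate h r) :=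
  Generator.continuous_comp_polar (differentiableOn_cauchyTransform hh) hr

theorem norm_polar_lt_one {r : ℝ} (hr : r ∈ Ico (0 : ℝ) 1) (θ : Torus) : ‖polar r θ‖ < 1 :=
  mem_ball_zero_iff.1 (polar_mem_ball hr θ)

/-- Termwise integration of the power series leaves only the matching character: dilates are Abel
means of the analytic part of `h`. -/
theorem fourierCoeff_cauchyDilate {h : Torus → ℂ} (hh : Integrable h 𝔪) {r : ℝ}
    (hr : r ∈ Ico (0 : ℝ) 1) (k : ℤ) :
    fourierCoeff (cauchyDilate h r) k = if 0 ≤ k then (r : ℂ) ^ k.toNat * fourierCoeff h k else 0 := by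
  have hsm : Summable fun n : ℕ => r ^ n := summable_geometric_of_lt_one hr.1 hr.2
  have key := hasSum_integral_of_summable_integral_norm (μ := 𝔪)
    (F := fun (n : ℕ) θ => (fourierCoeff h n * (r : ℂ) ^ n) * (fourier (-k) θ • fourier n θ))
    (fun n => ((map_continuous (fourier (T := 2 * Real.pi) n)).integrable_of_hasCompactSupport
      (HasCompactSupport.of_compactSpace _)).fourier_smul (-k) |>.const_mul _) (by
      simp only [norm_mul, smul_eq_mul, norm_fourier_apply, norm_pow, mul_one,
        integral_const, smul_eq_mul, Complex.norm_real, Real.norm_eq_abs, abs_of_nonneg hr.1]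
      simp only [measureReal_def, measure_univ, ENNReal.toReal_one, one_mul]
      exact Summable.of_nonneg_of_le (fun n => by have := hr.1; positivity)
        (fun n => mul_le_mul_of_nonneg_right (norm_fourierCoeff_le h n)
          (by have := hr.1; positivity)) (hsm.mul_left _))
  have e1 : ∀ n : ℕ, ∫ θ, (fourierCoeff h n * (r : ℂ) ^ n) *
      (fourier (-k) θ • fourier n θ) ∂𝔪 =
      (fourierCoeff h n * (r : ℂ) ^ n) * (Pi.single (n : ℤ) (1 : ℂ) : ℤ → ℂ) k := fun n => by
    rw [integral_const_mul, ← fourierCoeff_fourier (T := 2 * Real.pi) n]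
    rfl
  have e2 : ∫ θ, ∑' n : ℕ, (fourierCoeff h n * (r : ℂ) ^ n) *
      (fourier (-k) θ • fourier n θ) ∂𝔪 = fourierCoeff (cauchyDilate h r) k := by
    refine integral_congr_ae (ae_of_all _ fun θ => ?_)
    have hs := (hasSum_cauchyTransform hh (norm_polar_lt_one hr θ)).mul_left (fourier (-k) θ : ℂ)
    simp only [smul_eq_mul]
    rw [cauchyDilate, ← hs.tsum_eq]
    refine tsum_congr fun n => ?_
    rw [polar_pow]
    ring
  simp only [e1] at key
  rw [e2] at key
  rw [← key.tsum_eq]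
  split_ifs with hk
  · rw [tsum_eq_single k.toNat fun n hn => ?_]
    · rw [Int.toNat_of_nonneg hk, Pi.single_eq_same, mul_one, mul_comm]
    · rw [Pi.single_eq_of_ne (fun h => hn (by omega)), mul_zero]
  · refine (tsum_congr fun n => ?_).trans tsum_zero
    rw [Pi.single_eq_of_ne (fun h => hk (by omega)), mul_zero]

/-! ### Parseval's identity and convergence of Abel means -/

theorem norm_sq_eq_tsum_fourierCoeff (f : Lp ℂ 2 𝔪) :
    ‖f‖ ^ 2 = ∑' n : ℤ, ‖fourierCoeff f n‖ ^ 2 := by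
  have h := lp.norm_rpow_eq_tsum (p := 2) (by norm_num) (fourierBasis.repr f)
  simp only [fourierBasis_repr, LinearIsometryEquiv.norm_map, ENNReal.toReal_ofNat] at h
  exact_mod_cast h

theorem summable_sq_fourierCoeff (f : Lp ℂ 2 𝔪) : Summable fun n : ℤ => ‖fourierCoeff f n‖ ^ 2 :=
  (hasSum_sq_fourierCoeff f).summable

theorem fourierCoeff_eq_inner (f : Lp ℂ 2 𝔪) (n : ℤ) :
    fourierCoeff f n = inner ℂ (fourierLp 2 n) f := by
  rw [← fourierBasis_repr, HilbertBasis.repr_apply_apply, coe_fourierBasis]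

theorem fourierCoeff_sub_Lp (f g : Lp ℂ 2 𝔪) (n : ℤ) :
    fourierCoeff (f - g : Lp ℂ 2 𝔪) n = fourierCoeff f n - fourierCoeff g n := by
  simp only [fourierCoeff_eq_inner, inner_sub_right]

theorem eq_of_fourierCoeff_eq {f g : Lp ℂ 2 𝔪} (h : ∀ n, fourierCoeff f n = fourierCoeff g n) :
    f = g := by
  rw [← sub_eq_zero, ← norm_eq_zero, ← sq_eq_zero_iff, norm_sq_eq_tsum_fourierCoeff]
  simp only [fourierCoeff_sub_Lp, h, sub_self, norm_zero]
  simp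

/-- By Parseval the squared distance is `∑ ((1 - r^n) |f̂(n)|)²`, which tends to 0 by dominated
convergence for sums. -/
theorem tendsto_Lp_of_fourierCoeff {f : Lp ℂ 2 𝔪} (hf : ∀ n : ℤ, n < 0 → fourierCoeff f n = 0)
    {G : ℕ → Lp ℂ 2 𝔪} {r : ℕ → ℝ} (hr : ∀ k, r k ∈ Ico (0 : ℝ) 1) (hr1 : Tendsto r atTop (𝓝 1))
    (hG : ∀ k (n : ℤ), fourierCoeff (G k) n =
      if 0 ≤ n then (r k : ℂ) ^ n.toNat * fourierCoeff f n else 0) :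
    Tendsto G atTop (𝓝 f) := by
  rw [tendsto_iff_norm_sub_tendsto_zero]
  have hc : ∀ k (n : ℤ), ‖fourierCoeff (G k - f : Lp ℂ 2 𝔪) n‖ =
      (1 - r k ^ n.toNat) * ‖fourierCoeff f n‖ := by
    intro k n
    rw [fourierCoeff_sub_Lp, hG]
    split_ifs with hn
    · have : (r k : ℂ) ^ n.toNat * fourierCoeff f n - fourierCoeff f n =
        -(((1 - r k ^ n.toNat : ℝ) : ℂ) * fourierCoeff f n) := by push_cast; ring
      rw [this, norm_neg, norm_mul, Complex.norm_real, Real.norm_of_nonneg]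
      exact sub_nonneg.2 (pow_le_one₀ (hr k).1 (hr k).2.le)
    · rw [hf n (not_le.1 hn)]
      simp
  have hsq : Tendsto (fun k => ‖G k - f‖ ^ 2) atTop (𝓝 0) := by
    have := tendsto_tsum_of_dominated_convergence (𝓕 := atTop)
      (f := fun k (n : ℤ) => ((1 - r k ^ n.toNat) * ‖fourierCoeff f n‖) ^ 2) (g := fun _ => 0)
      (summable_sq_fourierCoeff f) (fun n => by
        have h : Tendsto (fun k => ((1 - r k ^ n.toNat) * ‖fourierCoeff f n‖) ^ 2) atTop
          (𝓝 (((1 - 1 ^ n.toNat) * ‖fourierCoeff f n‖) ^ 2)) :=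
          (((tendsto_const_nhds.sub (hr1.pow _)).mul_const _).pow 2)
        simpa using h) (Eventually.of_forall fun k n => by
        have h0 : 0 ≤ r k ^ n.toNat := pow_nonneg (hr k).1 _
        have h1 : r k ^ n.toNat ≤ 1 := pow_le_one₀ (hr k).1 (hr k).2.le
        rw [Real.norm_of_nonneg (by positivity), mul_pow]
        refine mul_le_of_le_one_left (by positivity) (pow_le_one₀ (by linarith) (by linarith)))
    simpa only [norm_sq_eq_tsum_fourierCoeff, hc, tsum_zero] using this
  have := (Real.continuous_sqrt.tendsto 0).comp hsq
  simpa [Function.comp_def, Real.sqrt_sq] using this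

/-- Convergence in `L²` gives a.e. convergence along a subsequence. This is all the pointwise
information that Fatou's lemma and the identification of boundary values require. -/
theorem exists_subseq_tendsto_ae {f : Lp ℂ 2 𝔪} (hf : ∀ n : ℤ, n < 0 → fourierCoeff f n = 0)
    {G : ℕ → Torus → ℂ} (hGc : ∀ k, Continuous (G k)) {r : ℕ → ℝ}
    (hr : ∀ k, r k ∈ Ico (0 : ℝ) 1) (hr1 : Tendsto r atTop (𝓝 1))
    (hG : ∀ k (n : ℤ), fourierCoeff (G k) n =
      if 0 ≤ n then (r k : ℂ) ^ n.toNat * fourierCoeff f n else 0) :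
    ∃ ns : ℕ → ℕ, StrictMono ns ∧
      ∀ᵐ θ ∂𝔪, Tendsto (fun k => G (ns k) θ) atTop (𝓝 (f θ)) := by
  let Gl : ℕ → Lp ℂ 2 𝔪 := fun k => ContinuousMap.toLp 2 𝔪 ℂ ⟨G k, hGc k⟩
  have hGl : ∀ k, Gl k =ᵐ[𝔪] G k := fun k => ContinuousMap.coeFn_toLp 𝔪 ⟨G k, hGc k⟩
  have ht : Tendsto Gl atTop (𝓝 f) := tendsto_Lp_of_fourierCoeff hf hr hr1 fun k n => by
    rw [fourierCoeff_congr_ae (hGl k), hG]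
  rw [Lp.tendsto_Lp_iff_tendsto_eLpNorm'] at ht
  obtain ⟨ns, hns, hae⟩ := (tendstoInMeasure_of_tendsto_eLpNorm two_ne_zero
    (fun k => (Lp.aestronglyMeasurable (Gl k))) (Lp.aestronglyMeasurable f)
    ht).exists_seq_tendsto_ae
  refine ⟨ns, hns, ?_⟩
  filter_upwards [hae, ae_all_iff.2 hGl] with θ h1 h2
  simpa only [h2] using h1

/-! ### M. Riesz's theorem -/

theorem exists_norm_rpow_le_re_rpow_sub {p : ℝ} (hp : 1 < p) (hp2 : p ≤ 2) :
    ∃ A B : ℝ, 0 ≤ A ∧ 0 ≤ B ∧ ∀ z : ℂ, 0 < z.re →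
      ‖z‖ ^ p ≤ A * z.re ^ p - B * (z ^ (p : ℂ)).re := by
  have hpi := Real.pi_pos
  have hp0 : 0 < p := by linarith
  -- In polar coordinates the claim is `1 ≤ A cos^p t - B cos(pt)` for `t = |arg z| < π/2`. The
  -- angle `p t₀` is the midpoint of `π/2` and `pπ/2`, so `cos` is negative there, while `t₀ < π/2`.
  set t₀ : ℝ := (1 + p) * Real.pi / (4 * p) with ht₀
  have hpt : p * t₀ = (1 + p) * Real.pi / 4 := by rw [ht₀]; field_simp
  have ht₀pos : 0 < t₀ := by positivity
  have ht₀lt : t₀ < Real.pi / 2 := by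
    rw [ht₀, div_lt_div_iff₀ (by positivity) (by positivity)]
    nlinarith
  have hc : 0 < -Real.cos (p * t₀) := by
    have := Real.cos_neg_of_pi_div_two_lt_of_lt (x := p * t₀) (by rw [hpt]; nlinarith)
      (by rw [hpt]; nlinarith)
    linarith
  have hcos : 0 < Real.cos t₀ := Real.cos_pos_of_mem_Ioo ⟨by linarith, ht₀lt⟩
  -- For `t ≥ t₀` the term `-B cos(pt)` is at least 1, because `pt ≤ π` when `p ≤ 2`.
  set B : ℝ := 1 / -Real.cos (p * t₀) with hB
  have hB0 : 0 < B := by positivity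
  have hBc : B * Real.cos (p * t₀) = -1 := by
    rw [hB]
    have : Real.cos (p * t₀) ≠ 0 := by linarith
    field_simp
  -- For `t < t₀` the term `A cos^p t` is at least `1 + B` and absorbs `B cos(pt) ≤ B`.
  set A : ℝ := (1 + B) / Real.cos t₀ ^ p with hA
  have hA0 : 0 ≤ A := by positivity
  refine ⟨A, B, hA0, hB0.le, fun z hz => ?_⟩
  have harg : |z.arg| < Real.pi / 2 := Complex.abs_arg_lt_pi_div_two_iff.2 (Or.inl hz)
  have hcosz : 0 < Real.cos z.arg := Real.cos_pos_of_mem_Ioo (abs_lt.1 harg)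
  rw [Complex.cpow_ofReal_re, ← Complex.norm_mul_cos_arg z,
    Real.mul_rpow (norm_nonneg _) hcosz.le]
  have key : 1 ≤ A * Real.cos z.arg ^ p - B * Real.cos (z.arg * p) := by
    rw [← Real.cos_abs z.arg, ← Real.cos_abs (z.arg * p), abs_mul, abs_of_pos hp0]
    set t := |z.arg|
    have ht0 : 0 ≤ t := abs_nonneg _
    rcases le_or_gt t₀ t with h | h
    · have h1 : Real.cos (t * p) ≤ Real.cos (p * t₀) :=
        Real.cos_le_cos_of_nonneg_of_le_pi (by positivity) (by nlinarith) (by nlinarith)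
      have h2 : 0 ≤ A * Real.cos t ^ p := by
        have : 0 ≤ Real.cos t := Real.cos_nonneg_of_mem_Icc ⟨by linarith, harg.le⟩
        positivity
      nlinarith
    · have h1 : Real.cos t₀ ≤ Real.cos t :=
        Real.cos_le_cos_of_nonneg_of_le_pi ht0 (by linarith) h.le
      have h2 : 1 + B ≤ A * Real.cos t ^ p := by
        calc 1 + B = A * Real.cos t₀ ^ p := by rw [hA]; field_simp
          _ ≤ _ := by gcongr
      nlinarith [Real.cos_le_one (t * p)]
  calc ‖z‖ ^ p = ‖z‖ ^ p * 1 := (mul_one _).symm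
    _ ≤ ‖z‖ ^ p * (A * Real.cos z.arg ^ p - B * Real.cos (z.arg * p)) := by gcongr
    _ = _ := by ring

theorem integral_comp_polar {E : Type*} [NormedAddCommGroup E] [NormedSpace ℂ E] [CompleteSpace E]
    {Φ : ℂ → E} (hΦ : DifferentiableOn ℂ Φ (Metric.ball 0 1)) {r : ℝ} (hr : r ∈ Ico (0 : ℝ) 1) :
    ∫ θ, Φ (polar r θ) ∂𝔪 = Φ 0 := by
  have hd : DiffContOnCl ℂ Φ (Metric.ball 0 |r|) := by
    refine DifferentiableOn.diffContOnCl (hΦ.mono ?_)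
    rw [abs_of_nonneg hr.1]
    exact Metric.closure_ball_subset_closedBall.trans (Metric.closedBall_subset_ball hr.2)
  rw [AddCircle.integral_haarAddCircle, ← hd.circleAverage, Real.circleAverage_def,
    ← AddCircle.intervalIntegral_preimage (2 * Real.pi) 0, zero_add]
  congr 1
  refine intervalIntegral.integral_congr fun θ _ => ?_
  simp only [polar_coe, circleMap, zero_add]

theorem one_sub_mul_fourier_ne_zero {z : ℂ} (hz : ‖z‖ < 1) (n : ℤ) (φ : Torus) :
    1 - z * fourier n φ ≠ 0 := by
  intro h
  have := norm_mul_fourier_lt_one hz n φ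
  rw [← sub_eq_zero.1 h, norm_one] at this
  exact lt_irrefl _ this

/-- The map `ζ ↦ 1/(1-ζ)` sends the disc into the half plane `Re > 1/2`. So the real part of the
Cauchy kernel is positive, and Cauchy transforms of nonnegative functions avoid the branch cut of
`z^p`. -/
theorem half_le_re_inv_one_sub {ζ : ℂ} (hζ : ‖ζ‖ < 1) : 1 / 2 ≤ ((1 - ζ)⁻¹).re := by
  have hre : ζ.re < 1 := (Complex.re_le_norm ζ).trans_lt hζ
  have hsq : Complex.normSq ζ < 1 := by
    rw [Complex.normSq_eq_norm_sq]
    nlinarith [norm_nonneg ζ]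
  rw [Complex.normSq_apply] at hsq
  have hn : Complex.normSq (1 - ζ) = 1 - 2 * ζ.re + (ζ.re * ζ.re + ζ.im * ζ.im) := by
    rw [Complex.normSq_apply]
    simp
    ring
  have hpos : 0 < Complex.normSq (1 - ζ) := by
    rw [hn]
    nlinarith [mul_self_nonneg ζ.im]
  rw [Complex.inv_re, le_div_iff₀ hpos, hn]
  simp
  linarith

theorem norm_inv_one_sub_le {ζ : ℂ} {ρ : ℝ} (hρ : ρ < 1) (hζ : ‖ζ‖ ≤ ρ) :
    ‖(1 - ζ)⁻¹‖ ≤ (1 - ρ)⁻¹ := by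
  rw [norm_inv]
  refine inv_anti₀ (by linarith) ?_
  have := norm_sub_norm_le (1 : ℂ) ζ
  rw [norm_one] at this
  linarith

theorem continuous_cauchyKernel {z : ℂ} (hz : ‖z‖ < 1) :
    Continuous fun φ : Torus => (1 - z * fourier (-1) φ)⁻¹ :=
  (continuous_const.sub (continuous_const.mul (map_continuous _))).inv₀
    fun φ => one_sub_mul_fourier_ne_zero hz _ φ

theorem integrable_cauchyKernel_mul {h : Torus → ℂ} (hh : Integrable h 𝔪) {z : ℂ} (hz : ‖z‖ < 1) :
    Integrable (fun φ => (1 - z * fourier (-1) φ)⁻¹ * h φ) 𝔪 :=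
  hh.bdd_mul (c := (1 - ‖z‖)⁻¹) (continuous_cauchyKernel hz).aestronglyMeasurable
    (ae_of_all _ fun φ => norm_inv_one_sub_le hz (by rw [norm_mul, norm_fourier_apply, mul_one]))

theorem integrable_re_cauchyKernel_mul {f : Torus → ℝ} (hf : Integrable f 𝔪) {z : ℂ}
    (hz : ‖z‖ < 1) : Integrable (fun φ => ((1 - z * fourier (-1) φ)⁻¹).re * f φ) 𝔪 := by
  have := (integrable_cauchyKernel_mul hf.ofReal hz).re
  simpa using this

theorem cauchyTransform_ofReal_re {f : Torus → ℝ} (hf : Integrable f 𝔪) {z : ℂ} (hz : ‖z‖ < 1) :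
    (cauchyTransform (fun φ => (f φ : ℂ)) z).re =
      ∫ φ, ((1 - z * fourier (-1) φ)⁻¹).re * f φ ∂𝔪 := by
  have := integral_re (integrable_cauchyKernel_mul hf.ofReal hz)
  rw [cauchyTransform]
  refine this.symm.trans (integral_congr_ae (ae_of_all _ fun φ => ?_))
  simp

theorem half_integral_le_cauchyTransform_re {f : Torus → ℝ} (hf : Integrable f 𝔪)
    (hf0 : ∀ φ, 0 ≤ f φ) {z : ℂ} (hz : ‖z‖ < 1) :
    1 / 2 * ∫ φ, f φ ∂𝔪 ≤ (cauchyTransform (fun φ => (f φ : ℂ)) z).re := by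
  rw [cauchyTransform_ofReal_re hf hz, ← integral_const_mul]
  refine integral_mono (hf.const_mul _) (integrable_re_cauchyKernel_mul hf hz) fun φ => ?_
  exact mul_le_mul_of_nonneg_right (half_le_re_inv_one_sub (norm_mul_fourier_lt_one hz _ _)) (hf0 φ)

theorem star_fourier_neg_one (φ : Torus) :
    (starRingEnd ℂ) (fourier (-1) φ : ℂ) = AddCircle.toCircle φ := by
  rw [← fourier_neg, neg_neg, fourier_one]

theorem star_polar_mul_fourier (r : ℝ) (θ φ : Torus) :
    (starRingEnd ℂ) (polar r θ * fourier (-1) φ) = polar r φ * fourier (-1) θ := by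
  rw [map_mul, star_fourier_neg_one, polar, map_mul, Complex.conj_ofReal, polar, fourier_neg,
    fourier_one]
  ring

theorem continuous_cauchyKernel_polar {r : ℝ} (hr : r ∈ Ico (0 : ℝ) 1) :
    Continuous fun x : Torus × Torus => (1 - polar r x.1 * fourier (-1) x.2)⁻¹ :=
  (continuous_const.sub (((continuous_polar r).comp continuous_fst).mul
    ((map_continuous (fourier (T := 2 * Real.pi) (-1))).comp continuous_snd))).inv₀
    fun _ => one_sub_mul_fourier_ne_zero (norm_polar_lt_one hr _) _ _

/-- Mean value property: the kernel is holomorphic in its first variable, with value 1 at the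
centre, and its real part is positive. -/
theorem lintegral_re_cauchyKernel_left {r : ℝ} (hr : r ∈ Ico (0 : ℝ) 1) (φ : Torus) :
    ∫⁻ θ, ENNReal.ofReal ((1 - polar r θ * fourier (-1) φ)⁻¹).re ∂𝔪 = 1 := by
  have hc : Continuous fun θ => (1 - polar r θ * fourier (-1) φ)⁻¹ :=
    (continuous_const.sub ((continuous_polar r).mul continuous_const)).inv₀
      fun θ => one_sub_mul_fourier_ne_zero (norm_polar_lt_one hr θ) _ φ
  have hi : Integrable (fun θ => (1 - polar r θ * fourier (-1) φ)⁻¹) 𝔪 :=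
    hc.integrable_of_hasCompactSupport (HasCompactSupport.of_compactSpace _)
  have hir : Integrable (fun θ => ((1 - polar r θ * fourier (-1) φ)⁻¹).re) 𝔪 := hi.re
  rw [← ofReal_integral_eq_lintegral_ofReal hir (ae_of_all _ fun θ => le_trans (by norm_num)
    (half_le_re_inv_one_sub (norm_mul_fourier_lt_one (norm_polar_lt_one hr θ) _ _)))]
  have h1 := integral_re hi
  have h2 := integral_comp_polar (Φ := fun z => (1 - z * fourier (-1) φ)⁻¹) (fun z hz => by
    refine DifferentiableAt.differentiableWithinAt (DifferentiableAt.inv (by fun_prop)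
      (one_sub_mul_fourier_ne_zero (mem_ball_zero_iff.1 hz) _ _))) hr
  rw [h2] at h1
  refine (congrArg ENNReal.ofReal h1).trans ?_
  simp

theorem lintegral_re_cauchyKernel_right {r : ℝ} (hr : r ∈ Ico (0 : ℝ) 1) (θ : Torus) :
    ∫⁻ φ, ENNReal.ofReal ((1 - polar r θ * fourier (-1) φ)⁻¹).re ∂𝔪 = 1 := by
  rw [← lintegral_re_cauchyKernel_left hr θ]
  refine lintegral_congr fun φ => ?_
  rw [← star_polar_mul_fourier, ← map_one (starRingEnd ℂ), ← map_sub, ← map_inv₀, Complex.conj_re,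
    map_one]

/-- The real part of the kernel is positive with both marginals equal to 1, so the Schur test with
`ψ = 1` gives a contraction. -/
theorem lintegral_re_cauchyDilate_rpow_le {p : ℝ} (hp : 1 < p) {f : Torus → ℝ}
    (hfm : Measurable f) (hf : Integrable f 𝔪) (hf0 : ∀ φ, 0 ≤ f φ) {r : ℝ}
    (hr : r ∈ Ico (0 : ℝ) 1) :
    ∫⁻ θ, ENNReal.ofReal (cauchyDilate (fun φ => (f φ : ℂ)) r θ).re ^ p ∂𝔪 ≤
      ∫⁻ φ, ENNReal.ofReal (f φ) ^ p ∂𝔪 := by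
  have key := lintegral_rpow_lintegral_mul_le (ν := 𝔪) hp
    (K := fun θ φ => ENNReal.ofReal ((1 - polar r θ * fourier (-1) φ)⁻¹).re)
    (ψ := fun _ => 1) (A := 1) (B := 1)
    (ENNReal.measurable_ofReal.comp (Complex.measurable_re.comp
      (continuous_cauchyKernel_polar hr).measurable)) measurable_const (by simp)
    (ae_of_all _ fun θ => by
      simp only [mul_one]
      exact (lintegral_re_cauchyKernel_right hr θ).le)
    (ae_of_all _ fun φ => by
      simp only [mul_one, ENNReal.one_rpow]
      exact (lintegral_re_cauchyKernel_left hr φ).le)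
    (f := fun φ => ENNReal.ofReal (f φ)) hfm.ennreal_ofReal
  rw [ENNReal.one_rpow, one_mul, one_mul] at key
  refine le_trans (le_of_eq (lintegral_congr fun θ => ?_)) key
  have hk : ∀ φ, 0 ≤ ((1 - polar r θ * fourier (-1) φ)⁻¹).re := fun φ => le_trans (by norm_num)
    (half_le_re_inv_one_sub (norm_mul_fourier_lt_one (norm_polar_lt_one hr θ) _ _))
  rw [cauchyDilate, cauchyTransform_ofReal_re hf (norm_polar_lt_one hr θ),
    ofReal_integral_eq_lintegral_ofReal
      (integrable_re_cauchyKernel_mul hf (norm_polar_lt_one hr θ))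
      (ae_of_all _ fun φ => mul_nonneg (hk φ) (hf0 φ))]
  congr 1
  refine lintegral_congr fun φ => ?_
  rw [ENNReal.ofReal_mul (hk φ)]

theorem cauchyTransform_zero (h : Torus → ℂ) : cauchyTransform h 0 = ∫ φ, h φ ∂𝔪 := by
  simp [cauchyTransform]

/-- Integrate `|Φ|^p ≤ A (Re Φ)^p - B Re Φ^p` over a circle. By the mean value property the last
term contributes `-B (∫ f)^p ≤ 0`, and the real part is controlled by the Schur test. -/
theorem exists_lintegral_cauchyDilate_le_of_nonneg {p : ℝ} (hp : 1 < p) (hp2 : p ≤ 2) :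
    ∃ C : ℝ≥0, ∀ f : Torus → ℝ, Measurable f → Integrable f 𝔪 → (∀ φ, 0 ≤ f φ) →
      ∀ r ∈ Ico (0 : ℝ) 1, ∫⁻ θ, ‖cauchyDilate (fun φ => (f φ : ℂ)) r θ‖ₑ ^ p ∂𝔪 ≤
        C * ∫⁻ φ, ENNReal.ofReal (f φ) ^ p ∂𝔪 := by
  obtain ⟨A, B, hA, hB, hAB⟩ := exists_norm_rpow_le_re_rpow_sub hp hp2
  have hp0 : 0 < p := by linarith
  refine ⟨A.toNNReal, fun f hfm hf hf0 r hr => ?_⟩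
  set Φ := cauchyTransform (fun φ => (f φ : ℂ)) with hΦ
  have hI0 : 0 ≤ ∫ φ, f φ ∂𝔪 := integral_nonneg hf0
  rcases hI0.eq_or_lt with h0 | hpos
  -- When `f` vanishes a.e., `Re Φ` is not strictly positive, but then `Φ = 0`.
  · have hz : f =ᵐ[𝔪] 0 := (integral_eq_zero_iff_of_nonneg hf0 hf).1 h0.symm
    have : ∀ θ, cauchyDilate (fun φ => (f φ : ℂ)) r θ = 0 := fun θ => by
      rw [cauchyDilate, cauchyTransform, integral_eq_zero_of_ae]
      filter_upwards [hz] with φ hφ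
      simp [hφ]
    simp [this, hp0]
  have hre : ∀ z ∈ Metric.ball (0 : ℂ) 1, 0 < (Φ z).re := fun z hz =>
    lt_of_lt_of_le (by positivity)
      (half_integral_le_cauchyTransform_re hf hf0 (mem_ball_zero_iff.1 hz))
  have hd : DifferentiableOn ℂ Φ (Metric.ball 0 1) := differentiableOn_cauchyTransform hf.ofReal
  have hdp : DifferentiableOn ℂ (fun z => Φ z ^ (p : ℂ)) (Metric.ball 0 1) :=
    hd.cpow_const fun z hz => Or.inl (hre z hz)
  have hc := Generator.continuous_comp_polar hd hr
  have hcp := Generator.continuous_comp_polar hdp hr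
  have comp : ∀ {E : Type} [NormedAddCommGroup E] (u : Torus → E), Continuous u → Integrable u 𝔪 :=
    fun u hu => hu.integrable_of_hasCompactSupport (HasCompactSupport.of_compactSpace _)
  have hmean : 0 ≤ ∫ θ, (Φ (polar r θ) ^ (p : ℂ)).re ∂𝔪 := by
    have h1 := integral_re (comp _ hcp)
    have h2 := integral_comp_polar hdp hr
    rw [h2, hΦ, cauchyTransform_zero, integral_complex_ofReal, ← Complex.ofReal_cpow hI0] at h1
    refine le_of_le_of_eq ?_ h1.symm
    simpa using Real.rpow_nonneg hI0 p
  have hcn : Continuous fun θ => ‖Φ (polar r θ)‖ ^ p := hc.norm.rpow_const fun _ => Or.inr hp0.le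
  have hcr : Continuous fun θ => (Φ (polar r θ)).re ^ p :=
    (Complex.continuous_re.comp hc).rpow_const fun _ => Or.inr hp0.le
  have hcpr : Continuous fun θ => (Φ (polar r θ) ^ (p : ℂ)).re := Complex.continuous_re.comp hcp
  have hle : ∫ θ, ‖Φ (polar r θ)‖ ^ p ∂𝔪 ≤ A * ∫ θ, (Φ (polar r θ)).re ^ p ∂𝔪 := by
    calc ∫ θ, ‖Φ (polar r θ)‖ ^ p ∂𝔪
        ≤ ∫ θ, (A * (Φ (polar r θ)).re ^ p - B * (Φ (polar r θ) ^ (p : ℂ)).re) ∂𝔪 :=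
          integral_mono (comp _ hcn) (((comp _ hcr).const_mul A).sub ((comp _ hcpr).const_mul B))
            fun θ => hAB _ (hre _ (polar_mem_ball hr θ))
      _ = A * ∫ θ, (Φ (polar r θ)).re ^ p ∂𝔪 - B * ∫ θ, (Φ (polar r θ) ^ (p : ℂ)).re ∂𝔪 := by
          rw [integral_sub ((comp _ hcr).const_mul A) ((comp _ hcpr).const_mul B),
            integral_const_mul, integral_const_mul]
      _ ≤ _ := by nlinarith
  have hre' : ∀ θ, 0 ≤ (Φ (polar r θ)).re := fun θ => (hre _ (polar_mem_ball hr θ)).le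
  calc ∫⁻ θ, ‖cauchyDilate (fun φ => (f φ : ℂ)) r θ‖ₑ ^ p ∂𝔪
      = ∫⁻ θ, ENNReal.ofReal (‖Φ (polar r θ)‖ ^ p) ∂𝔪 := by
        refine lintegral_congr fun θ => ?_
        rw [← ENNReal.ofReal_rpow_of_nonneg (norm_nonneg _) hp0.le, ofReal_norm]
        rfl
    _ = ENNReal.ofReal (∫ θ, ‖Φ (polar r θ)‖ ^ p ∂𝔪) :=
        (ofReal_integral_eq_lintegral_ofReal (comp _ hcn)
          (ae_of_all _ fun θ => by positivity)).symm
    _ ≤ ENNReal.ofReal (A * ∫ θ, (Φ (polar r θ)).re ^ p ∂𝔪) := ENNReal.ofReal_le_ofReal hle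
    _ = ENNReal.ofReal A * ∫⁻ θ, ENNReal.ofReal ((Φ (polar r θ)).re ^ p) ∂𝔪 := by
        rw [ENNReal.ofReal_mul hA, ofReal_integral_eq_lintegral_ofReal (comp _ hcr)
          (ae_of_all _ fun θ => Real.rpow_nonneg (hre' θ) p)]
    _ = ENNReal.ofReal A *
        ∫⁻ θ, ENNReal.ofReal (cauchyDilate (fun φ => (f φ : ℂ)) r θ).re ^ p ∂𝔪 := by
        congr 1
        refine lintegral_congr fun θ => ?_
        rw [← ENNReal.ofReal_rpow_of_nonneg (hre' θ) hp0.le]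
        rfl
    _ ≤ _ := by
        refine mul_le_mul_right (lintegral_re_cauchyDilate_rpow_le hp hfm hf hf0 hr) _

theorem integrable_of_continuous_torus {E : Type*} [NormedAddCommGroup E] {u : Torus → E}
    (hu : Continuous u) : Integrable u 𝔪 :=
  hu.integrable_of_hasCompactSupport (HasCompactSupport.of_compactSpace _)

theorem cauchyTransform_sub {h k : Torus → ℂ} (hh : Integrable h 𝔪) (hk : Integrable k 𝔪) {z : ℂ}
    (hz : ‖z‖ < 1) : cauchyTransform (fun φ => h φ - k φ) z =
      cauchyTransform h z - cauchyTransform k z := by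
  simp only [cauchyTransform, mul_sub]
  exact integral_sub (integrable_cauchyKernel_mul hh hz) (integrable_cauchyKernel_mul hk hz)

theorem cauchyTransform_add {h k : Torus → ℂ} (hh : Integrable h 𝔪) (hk : Integrable k 𝔪) {z : ℂ}
    (hz : ‖z‖ < 1) : cauchyTransform (fun φ => h φ + k φ) z =
      cauchyTransform h z + cauchyTransform k z := by
  simp only [cauchyTransform, mul_add]
  exact integral_add (integrable_cauchyKernel_mul hh hz) (integrable_cauchyKernel_mul hk hz)

theorem cauchyTransform_const_mul (c : ℂ) (h : Torus → ℂ) (z : ℂ) :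
    cauchyTransform (fun φ => c * h φ) z = c * cauchyTransform h z := by
  simp only [cauchyTransform, mul_left_comm _ c]
  exact integral_const_mul c _

theorem enorm_add_rpow_le {p : ℝ} (hp : 1 ≤ p) (a b : ℂ) :
    ‖a + b‖ₑ ^ p ≤ 2 ^ (p - 1) * (‖a‖ₑ ^ p + ‖b‖ₑ ^ p) :=
  (ENNReal.rpow_le_rpow (enorm_add_le a b) (by linarith)).trans
    (ENNReal.rpow_add_le_mul_rpow_add_rpow _ _ hp)

theorem enorm_sub_rpow_le {p : ℝ} (hp : 1 ≤ p) (a b : ℂ) :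
    ‖a - b‖ₑ ^ p ≤ 2 ^ (p - 1) * (‖a‖ₑ ^ p + ‖b‖ₑ ^ p) := by
  rw [sub_eq_add_neg, ← enorm_neg b]
  exact enorm_add_rpow_le hp a (-b)

theorem lintegral_add_rpow_le {β : Type*} [MeasurableSpace β] {ν : Measure β} {p : ℝ} (hp : 1 ≤ p)
    {u v : β → ℂ} (hu : Measurable u) {D E : ℝ≥0∞}
    (hD : ∫⁻ x, ‖u x‖ₑ ^ p ∂ν ≤ D) (hE : ∫⁻ x, ‖v x‖ₑ ^ p ∂ν ≤ E) :
    ∫⁻ x, ‖u x + v x‖ₑ ^ p ∂ν ≤ 2 ^ (p - 1) * (D + E) := by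
  calc ∫⁻ x, ‖u x + v x‖ₑ ^ p ∂ν ≤ ∫⁻ x, 2 ^ (p - 1) * (‖u x‖ₑ ^ p + ‖v x‖ₑ ^ p) ∂ν :=
        lintegral_mono fun x => enorm_add_rpow_le hp _ _
    _ = 2 ^ (p - 1) * (∫⁻ x, ‖u x‖ₑ ^ p ∂ν + ∫⁻ x, ‖v x‖ₑ ^ p ∂ν) := by
        rw [lintegral_const_mul' _ _ (ENNReal.rpow_ne_top_of_nonneg (by linarith) (by simp)),
          lintegral_add_left (hu.enorm.pow_const p)]
    _ ≤ _ := by gcongr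

theorem exists_lintegral_cauchyDilate_le_of_real {p : ℝ} (hp : 1 < p) (hp2 : p ≤ 2) :
    ∃ C : ℝ≥0, ∀ f : Torus → ℝ, Measurable f → Integrable f 𝔪 →
      ∀ r ∈ Ico (0 : ℝ) 1, ∫⁻ θ, ‖cauchyDilate (fun φ => (f φ : ℂ)) r θ‖ₑ ^ p ∂𝔪 ≤
        C * ∫⁻ φ, ‖f φ‖ₑ ^ p ∂𝔪 := by
  obtain ⟨C, hC⟩ := exists_lintegral_cauchyDilate_le_of_nonneg hp hp2
  refine ⟨2 ^ (p - 1) * (2 * C), fun f hfm hf r hr => ?_⟩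
  have hneg : ∀ g : Torus → ℝ, Measurable g → Integrable g 𝔪 → (∀ φ, ‖g φ‖ ≤ ‖f φ‖) →
      ∫⁻ θ, ‖cauchyDilate (fun φ => ((max (g φ) 0 : ℝ) : ℂ)) r θ‖ₑ ^ p ∂𝔪 ≤
        C * ∫⁻ φ, ‖f φ‖ₑ ^ p ∂𝔪 := by
    intro g hgm hg hgf
    refine (hC _ (hgm.max measurable_const) hg.pos_part (fun φ => le_max_right _ _) r hr).trans ?_
    gcongr with φ
    rw [← ofReal_norm]
    exact ENNReal.ofReal_le_ofReal ((max_le (le_abs_self _) (abs_nonneg _)).trans (hgf φ))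
  have h1 := hneg f hfm hf fun φ => le_rfl
  have h2 := hneg (fun φ => -f φ) hfm.neg hf.neg fun φ => (norm_neg _).le
  have i1 : Integrable (fun φ => ((max (f φ) 0 : ℝ) : ℂ)) 𝔪 := hf.pos_part.ofReal
  have i2 : Integrable (fun φ => ((max (-f φ) 0 : ℝ) : ℂ)) 𝔪 := hf.neg.pos_part.ofReal
  have e : ∀ θ, cauchyDilate (fun φ => (f φ : ℂ)) r θ =
      cauchyDilate (fun φ => ((max (f φ) 0 : ℝ) : ℂ)) r θ +
        -cauchyDilate (fun φ => ((max (-f φ) 0 : ℝ) : ℂ)) r θ := by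
    intro θ
    rw [← sub_eq_add_neg, cauchyDilate, cauchyDilate, cauchyDilate,
      ← cauchyTransform_sub i1 i2 (norm_polar_lt_one hr θ)]
    congr 1
    ext φ
    rw [← Complex.ofReal_sub, max_zero_sub_eq_self]
  simp only [e]
  refine (lintegral_add_rpow_le hp.le (continuous_cauchyDilate i1 hr).measurable h1
    (by simpa only [enorm_neg] using h2)).trans_eq ?_
  rw [← two_mul, ENNReal.coe_mul, ENNReal.coe_mul, ENNReal.coe_rpow_of_nonneg _ (by linarith)]
  push_cast
  ring

theorem exists_lintegral_cauchyDilate_le_of_le_two {p : ℝ} (hp : 1 < p) (hp2 : p ≤ 2) :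
    ∃ C : ℝ≥0, ∀ h : Torus → ℂ, Measurable h → Integrable h 𝔪 →
      ∀ r ∈ Ico (0 : ℝ) 1, ∫⁻ θ, ‖cauchyDilate h r θ‖ₑ ^ p ∂𝔪 ≤ C * ∫⁻ φ, ‖h φ‖ₑ ^ p ∂𝔪 := by
  obtain ⟨C, hC⟩ := exists_lintegral_cauchyDilate_le_of_real hp hp2
  have hp0 : 0 < p := by linarith
  refine ⟨2 ^ (p - 1) * (2 * C), fun h hm hh r hr => ?_⟩
  have i1 : Integrable (fun φ => (((h φ).re : ℝ) : ℂ)) 𝔪 := hh.re.ofReal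
  have i2 : Integrable (fun φ => (((h φ).im : ℝ) : ℂ)) 𝔪 := hh.im.ofReal
  have h1 : ∫⁻ θ, ‖cauchyDilate (fun φ => (((h φ).re : ℝ) : ℂ)) r θ‖ₑ ^ p ∂𝔪 ≤
      C * ∫⁻ φ, ‖h φ‖ₑ ^ p ∂𝔪 := by
    refine (hC _ (Complex.measurable_re.comp hm) hh.re r hr).trans ?_
    gcongr with φ
    exact enorm_le_iff_norm_le.2 (Complex.abs_re_le_norm _)
  have h2 : ∫⁻ θ, ‖Complex.I * cauchyDilate (fun φ => (((h φ).im : ℝ) : ℂ)) r θ‖ₑ ^ p ∂𝔪 ≤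
      C * ∫⁻ φ, ‖h φ‖ₑ ^ p ∂𝔪 := by
    have hI : ‖Complex.I‖ₑ = 1 := by rw [← ofReal_norm, Complex.norm_I, ENNReal.ofReal_one]
    simp only [enorm_mul, hI, one_mul]
    refine (hC _ (Complex.measurable_im.comp hm) hh.im r hr).trans ?_
    gcongr with φ
    exact enorm_le_iff_norm_le.2 (Complex.abs_im_le_norm _)
  have e : ∀ θ, cauchyDilate h r θ = cauchyDilate (fun φ => (((h φ).re : ℝ) : ℂ)) r θ +
      Complex.I * cauchyDilate (fun φ => (((h φ).im : ℝ) : ℂ)) r θ := by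
    intro θ
    rw [cauchyDilate, cauchyDilate, cauchyDilate, ← cauchyTransform_const_mul,
      ← cauchyTransform_add i1 (i2.const_mul _) (norm_polar_lt_one hr θ)]
    congr 1
    ext φ
    rw [mul_comm, Complex.re_add_im]
  simp only [e]
  refine (lintegral_add_rpow_le hp.le (continuous_cauchyDilate i1 hr).measurable h1 h2).trans_eq ?_
  rw [← two_mul, ENNReal.coe_mul, ENNReal.coe_mul, ENNReal.coe_rpow_of_nonneg _ (by linarith)]
  push_cast
  ring

/-- The kernel is Hermitian: exchanging `θ` and `φ` conjugates it. Self-adjointness is what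
transfers the bound to the conjugate exponent. -/
theorem integral_cauchyDilate_mul_star {h k : Torus → ℂ} (hh : Integrable h 𝔪)
    (hk : Integrable k 𝔪) {r : ℝ} (hr : r ∈ Ico (0 : ℝ) 1) :
    ∫ θ, cauchyDilate h r θ * (starRingEnd ℂ) (k θ) ∂𝔪 =
      ∫ φ, h φ * (starRingEnd ℂ) (cauchyDilate k r φ) ∂𝔪 := by
  have hint : Integrable (fun x : Torus × Torus =>
      (1 - polar r x.1 * fourier (-1) x.2)⁻¹ * ((starRingEnd ℂ) (k x.1) * h x.2)) (Measure.prod 𝔪 𝔪) := by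
    have hks : Integrable (fun θ => (starRingEnd ℂ) (k θ)) 𝔪 :=
      (Complex.conjLIE.toContinuousLinearEquiv.toContinuousLinearMap).integrable_comp hk
    refine (hks.mul_prod hh).bdd_mul (c := (1 - r)⁻¹)
      (continuous_cauchyKernel_polar hr).aestronglyMeasurable (ae_of_all _ fun x => ?_)
    refine norm_inv_one_sub_le hr.2 ?_
    rw [norm_mul, norm_fourier_apply, mul_one, norm_polar, abs_of_nonneg hr.1]
  have swap := integral_integral_swap (f := fun θ φ =>
      (1 - polar r θ * fourier (-1) φ)⁻¹ * ((starRingEnd ℂ) (k θ) * h φ)) hint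
  calc ∫ θ, cauchyDilate h r θ * (starRingEnd ℂ) (k θ) ∂𝔪
      = ∫ θ, ∫ φ, (1 - polar r θ * fourier (-1) φ)⁻¹ * ((starRingEnd ℂ) (k θ) * h φ) ∂𝔪 ∂𝔪 := by
        refine integral_congr_ae (ae_of_all _ fun θ => ?_)
        simp only [cauchyDilate, cauchyTransform]
        rw [← integral_mul_const]
        refine integral_congr_ae (ae_of_all _ fun φ => ?_)
        simp only
        ring
    _ = ∫ φ, ∫ θ, (1 - polar r θ * fourier (-1) φ)⁻¹ * ((starRingEnd ℂ) (k θ) * h φ) ∂𝔪 ∂𝔪 := swap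
    _ = _ := by
        refine integral_congr_ae (ae_of_all _ fun φ => ?_)
        simp only [cauchyDilate, cauchyTransform]
        rw [← integral_conj, ← integral_const_mul]
        refine integral_congr_ae (ae_of_all _ fun θ => ?_)
        simp only
        rw [map_mul, map_inv₀, map_sub, map_one, star_polar_mul_fourier]
        ring

/-- **M. Riesz's theorem** in its uniform version for the dilations of the Cauchy transform. -/
theorem exists_lintegral_cauchyDilate_le {p : ℝ} (hp : 1 < p) :
    ∃ C : ℝ≥0, ∀ h : Torus → ℂ, Measurable h → Integrable h 𝔪 →
      ∀ r ∈ Ico (0 : ℝ) 1, ∫⁻ θ, ‖cauchyDilate h r θ‖ₑ ^ p ∂𝔪 ≤ C * ∫⁻ φ, ‖h φ‖ₑ ^ p ∂𝔪 := by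
  rcases le_or_gt p 2 with hp2 | hp2
  · exact exists_lintegral_cauchyDilate_le_of_le_two hp hp2
  have hp0 : 0 < p := by linarith
  have hp1 : 0 < p - 1 := by linarith
  set q : ℝ := p / (p - 1) with hq
  have hpq : p.HolderConjugate q := Real.HolderConjugate.conjExponent hp
  have hq0 : 0 < q := hpq.symm.pos
  have hq2 : q ≤ 2 := by rw [hq, div_le_iff₀ hp1]; linarith
  have hqe : 1 / q = (p - 1) / p := by rw [hq, one_div_div]
  obtain ⟨C, hC⟩ := exists_lintegral_cauchyDilate_le_of_le_two hpq.symm.lt hq2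
  refine ⟨C ^ (p - 1), fun h hm hh r hr => ?_⟩
  set u := cauchyDilate h r with hu
  have huc : Continuous u := continuous_cauchyDilate hh hr
  -- The extremal function of Hölder's inequality: `u * conj k = |u|^p` and `|k|^q = |u|^p`.
  set k : Torus → ℂ := fun θ => u θ * ((‖u θ‖ ^ (p - 2) : ℝ) : ℂ) with hk
  have hkc : Continuous k := huc.mul (Complex.continuous_ofReal.comp
    (huc.norm.rpow_const fun _ => Or.inr (by linarith)))
  have hkn : ∀ θ, ‖k θ‖ = ‖u θ‖ ^ (p - 1) := fun θ => by
    simp only [hk, norm_mul, Complex.norm_real]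
    rw [Real.norm_of_nonneg (by positivity)]
    rcases (norm_nonneg (u θ)).eq_or_lt with h0 | h0
    · rw [← h0, zero_mul, Real.zero_rpow hp1.ne']
    · rw [mul_comm, ← Real.rpow_add_one h0.ne']
      congr 1
      ring
  have hkq : ∀ θ, ‖k θ‖ₑ ^ q = ‖u θ‖ₑ ^ p := fun θ => by
    rw [← ofReal_norm, ← ofReal_norm, ENNReal.ofReal_rpow_of_nonneg (norm_nonneg _) hq0.le,
      ENNReal.ofReal_rpow_of_nonneg (norm_nonneg _) hp0.le, hkn, ← Real.rpow_mul (norm_nonneg _),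
      hq, mul_div_cancel₀ _ hp1.ne']
  have huk : ∀ θ, u θ * (starRingEnd ℂ) (k θ) = ((‖u θ‖ ^ p : ℝ) : ℂ) := fun θ => by
    simp only [hk, map_mul, Complex.conj_ofReal]
    rw [← mul_assoc, Complex.mul_conj, Complex.normSq_eq_norm_sq, ← Complex.ofReal_mul]
    congr 1
    rcases (norm_nonneg (u θ)).eq_or_lt with h0 | h0
    · rw [← h0, Real.zero_rpow hp0.ne']
      simp
    · rw [← Real.rpow_two, ← Real.rpow_add h0]
      congr 1
      ring
  set J := ∫⁻ θ, ‖u θ‖ₑ ^ p ∂𝔪 with hJ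
  set H := ∫⁻ φ, ‖h φ‖ₑ ^ p ∂𝔪 with hH
  have hcu : Continuous fun θ => ‖u θ‖ ^ p := huc.norm.rpow_const fun _ => Or.inr hp0.le
  have hJint : J = ENNReal.ofReal (∫ θ, ‖u θ‖ ^ p ∂𝔪) := by
    rw [ofReal_integral_eq_lintegral_ofReal (integrable_of_continuous_torus hcu)
      (ae_of_all _ fun θ => by positivity)]
    refine lintegral_congr fun θ => ?_
    rw [← ENNReal.ofReal_rpow_of_nonneg (norm_nonneg _) hp0.le, ofReal_norm]
  have hJle : J ≤ H ^ (1 / p) * (C * J) ^ (1 / q) := by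
    calc J = ‖∫ θ, u θ * (starRingEnd ℂ) (k θ) ∂𝔪‖ₑ := by
          simp only [huk]
          rw [integral_complex_ofReal, ← ofReal_norm, Complex.norm_real, hJint,
            Real.norm_of_nonneg (integral_nonneg fun θ => by positivity)]
      _ = ‖∫ φ, h φ * (starRingEnd ℂ) (cauchyDilate k r φ) ∂𝔪‖ₑ := by
          rw [hu, integral_cauchyDilate_mul_star hh (integrable_of_continuous_torus hkc) hr]
      _ ≤ ∫⁻ φ, ‖h φ * (starRingEnd ℂ) (cauchyDilate k r φ)‖ₑ ∂𝔪 :=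
          enorm_integral_le_lintegral_enorm _
      _ = ∫⁻ φ, ((fun φ => ‖h φ‖ₑ) * fun φ => ‖cauchyDilate k r φ‖ₑ) φ ∂𝔪 := by
          refine lintegral_congr fun φ => ?_
          rw [enorm_mul, RCLike.enorm_conj]
          rfl
      _ ≤ (∫⁻ φ, ‖h φ‖ₑ ^ p ∂𝔪) ^ (1 / p) * (∫⁻ φ, ‖cauchyDilate k r φ‖ₑ ^ q ∂𝔪) ^ (1 / q) :=
          ENNReal.lintegral_mul_le_Lp_mul_Lq 𝔪 hpq hm.enorm.aemeasurable
            (continuous_cauchyDilate (integrable_of_continuous_torus hkc)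
              hr).measurable.enorm.aemeasurable
      _ ≤ H ^ (1 / p) * (C * J) ^ (1 / q) := by
          gcongr
          refine (hC k hkc.measurable (integrable_of_continuous_torus hkc) r hr).trans_eq ?_
          simp only [hkq]
          rfl
  rcases eq_or_ne J 0 with h0 | h0
  · rw [h0]
    exact zero_le
  -- Finiteness of `J`, from continuity of the dilate, permits cancelling `J^{1/q}` in `hJle`.
  have hJt : J ≠ ∞ := by rw [hJint]; exact ENNReal.ofReal_ne_top
  have hsplit : J = J ^ (1 / p) * J ^ (1 / q) := by
    rw [← ENNReal.rpow_add_of_nonneg _ _ (by positivity) (by positivity)]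
    have : 1 / p + 1 / q = 1 := by simpa [one_div] using hpq.inv_add_inv_eq_one
    rw [this, ENNReal.rpow_one]
  have h1 : J ^ (1 / p) ≤ H ^ (1 / p) * (C : ℝ≥0∞) ^ (1 / q) := by
    have hne : J ^ (1 / q) ≠ 0 := by simp [ENNReal.rpow_eq_zero_iff, h0, hJt]
    have hnt : J ^ (1 / q) ≠ ∞ := ENNReal.rpow_ne_top_of_nonneg (by positivity) hJt
    rw [← ENNReal.mul_le_mul_iff_left hne hnt, ← hsplit]
    refine hJle.trans_eq ?_
    rw [ENNReal.mul_rpow_of_nonneg _ _ (by positivity), mul_assoc]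
  calc J = (J ^ (1 / p)) ^ p := by
        rw [← ENNReal.rpow_mul, one_div_mul_cancel hp0.ne', ENNReal.rpow_one]
    _ ≤ (H ^ (1 / p) * (C : ℝ≥0∞) ^ (1 / q)) ^ p := by gcongr
    _ = _ := by
        rw [ENNReal.mul_rpow_of_nonneg _ _ hp0.le, ← ENNReal.rpow_mul, ← ENNReal.rpow_mul,
          one_div_mul_cancel hp0.ne', ENNReal.rpow_one, hqe, div_mul_cancel₀ _ hp0.ne', mul_comm,
          ENNReal.coe_rpow_of_nonneg _ hp1.le]

/-! ### Power weights via the commutator -/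

theorem polar_mul_fourier_neg_one (r : ℝ) (θ φ : Torus) :
    polar r θ * fourier (-1) φ = polar r (θ - φ) := by
  rw [polar, polar, fourier_apply, neg_one_zsmul, sub_eq_add_neg, AddCircle.toCircle_add,
    Circle.coe_mul, mul_assoc]

/-- Both `1 - r` and the distance from `e^{iψ}` to 1 less `1 - r` are at most `|1 - r e^{iψ}|`, and
the chord is at least `2|ψ|/π`. The bound does not depend on `r`. -/
theorem norm_div_pi_le_norm_one_sub_polar {r : ℝ} (hr : r ∈ Ico (0 : ℝ) 1) (ψ : Torus) :
    ‖ψ‖ / Real.pi ≤ ‖1 - polar r ψ‖ := by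
  have h1 : ‖(AddCircle.toCircle ψ : ℂ) - 1‖ ≤ (1 - r) + ‖1 - polar r ψ‖ := by
    calc ‖(AddCircle.toCircle ψ : ℂ) - 1‖
        = ‖((1 - r : ℝ) : ℂ) * AddCircle.toCircle ψ - (1 - polar r ψ)‖ := by
          rw [polar]
          congr 1
          push_cast
          ring
      _ ≤ _ := by
          refine (norm_sub_le _ _).trans_eq ?_
          rw [norm_mul, Circle.norm_coe, mul_one, Complex.norm_real,
            Real.norm_of_nonneg (by linarith [hr.2])]
  have h2 : 1 - r ≤ ‖1 - polar r ψ‖ := by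
    have := norm_sub_norm_le (1 : ℂ) (polar r ψ)
    rwa [norm_one, norm_polar, abs_of_nonneg hr.1] at this
  have h3 := mul_norm_le_norm_toCircle_sub_one ψ
  have h4 : ‖ψ‖ / Real.pi = (2 / Real.pi * ‖ψ‖) / 2 := by ring
  rw [h4]
  linarith

theorem ae_haar_iff {P : Torus → Prop} : (∀ᵐ θ ∂𝔪, P θ) ↔ ∀ᵐ θ : Torus, P θ := by
  rw [AddCircle.volume_eq_smul_haarAddCircle]
  exact (Measure.ae_ennreal_smul_measure_iff (by simp [Real.pi_pos])).symm

theorem ae_haar_norm_torus_pos : ∀ᵐ θ ∂𝔪, 0 < ‖θ‖ := ae_haar_iff.2 ae_norm_torus_pos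

theorem norm_cauchyKernel_mul_le {r b : ℝ} (hr : r ∈ Ico (0 : ℝ) 1) {θ φ : Torus} (hθ : 0 < ‖θ‖) :
    ‖(1 - polar r θ * fourier (-1) φ)⁻¹‖ * |‖θ‖ ^ b * ‖φ‖ ^ (-b) - 1| ≤
      Real.pi * (|‖θ‖ ^ b * ‖φ‖ ^ (-b) - 1| / |‖θ‖ - ‖φ‖|) := by
  -- On the diagonal `|θ| = |φ|` the difference of weights vanishes, so both sides are 0, the
  -- quotient by 0 being 0.
  rcases eq_or_ne ‖θ‖ ‖φ‖ with h | h
  · rw [← h, ← Real.rpow_add hθ, add_neg_cancel, Real.rpow_zero]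
    simp
  · have hD : 0 < |‖θ‖ - ‖φ‖| := abs_pos.2 (sub_ne_zero.2 h)
    have h1 : |‖θ‖ - ‖φ‖| / Real.pi ≤ ‖1 - polar r θ * fourier (-1) φ‖ := by
      rw [polar_mul_fourier_neg_one]
      refine le_trans ?_ (norm_div_pi_le_norm_one_sub_polar hr _)
      gcongr
      exact abs_norm_sub_norm_le θ φ
    have h2 : ‖(1 - polar r θ * fourier (-1) φ)⁻¹‖ ≤ Real.pi / |‖θ‖ - ‖φ‖| := by
      rw [norm_inv]
      refine (inv_anti₀ (div_pos hD Real.pi_pos) h1).trans_eq ?_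
      rw [inv_div]
    calc _ ≤ Real.pi / |‖θ‖ - ‖φ‖| * |‖θ‖ ^ b * ‖φ‖ ^ (-b) - 1| := by gcongr
      _ = _ := by ring

/-- Pulling the weight inside produces `|θ|^b - |φ|^b = (|θ|^b |φ|^{-b} - 1) |φ|^b`, which cancels
the singularity of the Cauchy kernel up to the homogeneous kernel treated by the Schur test. -/
theorem enorm_mul_cauchyDilate_sub_le {r b : ℝ} (hr : r ∈ Ico (0 : ℝ) 1) {h : Torus → ℂ}
    (hh : Integrable h 𝔪) (hk : Integrable (fun φ => ((‖φ‖ ^ b : ℝ) : ℂ) * h φ) 𝔪) {θ : Torus}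
    (hθ : 0 < ‖θ‖) :
    ‖((‖θ‖ ^ b : ℝ) : ℂ) * cauchyDilate h r θ -
        cauchyDilate (fun φ => ((‖φ‖ ^ b : ℝ) : ℂ) * h φ) r θ‖ₑ ≤
      ENNReal.ofReal Real.pi * ∫⁻ φ, ENNReal.ofReal
        (|‖θ‖ ^ b * ‖φ‖ ^ (-b) - 1| / |‖θ‖ - ‖φ‖|) * ‖((‖φ‖ ^ b : ℝ) : ℂ) * h φ‖ₑ ∂𝔪 := by
  have hz := norm_polar_lt_one hr θ
  rw [cauchyDilate, cauchyDilate, ← cauchyTransform_const_mul,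
    ← cauchyTransform_sub (hh.const_mul _) hk hz, cauchyTransform,
    ← lintegral_const_mul' _ _ ENNReal.ofReal_ne_top]
  refine (enorm_integral_le_lintegral_enorm _).trans (lintegral_mono_ae ?_)
  filter_upwards [ae_haar_norm_torus_pos] with φ hφ
  have e : ((‖θ‖ ^ b : ℝ) : ℂ) * h φ - ((‖φ‖ ^ b : ℝ) : ℂ) * h φ =
      ((‖θ‖ ^ b * ‖φ‖ ^ (-b) - 1 : ℝ) : ℂ) * (((‖φ‖ ^ b : ℝ) : ℂ) * h φ) := by
    have : ‖θ‖ ^ b - ‖φ‖ ^ b = (‖θ‖ ^ b * ‖φ‖ ^ (-b) - 1) * ‖φ‖ ^ b := by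
      rw [sub_mul, one_mul, mul_assoc, ← Real.rpow_add hφ, neg_add_cancel, Real.rpow_zero, mul_one]
    rw [← mul_assoc, ← Complex.ofReal_mul, ← this]
    push_cast
    ring
  rw [e, ← mul_assoc, enorm_mul, ← mul_assoc]
  gcongr
  rw [← ENNReal.ofReal_mul Real.pi_pos.le, ← ofReal_norm, norm_mul, Complex.norm_real,
    Real.norm_eq_abs]
  exact ENNReal.ofReal_le_ofReal (norm_cauchyKernel_mul_le hr hθ)

theorem integrable_of_lintegral_rpow_lt_top {p : ℝ} (hp : 1 ≤ p) {k : Torus → ℂ}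
    (hk : Measurable k) (h : ∫⁻ φ, ‖k φ‖ₑ ^ p ∂𝔪 < ∞) : Integrable k 𝔪 := by
  have hp0 : 0 < p := by linarith
  have hm : MemLp k (ENNReal.ofReal p) 𝔪 := by
    refine ⟨hk.aestronglyMeasurable, ?_⟩
    rw [eLpNorm_lt_top_iff_lintegral_rpow_enorm_lt_top (by simpa using hp0) ENNReal.ofReal_ne_top,
      ENNReal.toReal_ofReal hp0.le]
    exact h
  exact hm.integrable (by simpa using hp)

theorem enorm_rpow_mul_rpow {p a : ℝ} (hp : 0 < p) (φ : Torus) (c : ℂ) :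
    ‖((‖φ‖ ^ (a / p) : ℝ) : ℂ) * c‖ₑ ^ p = ENNReal.ofReal (‖φ‖ ^ a) * ‖c‖ₑ ^ p := by
  rw [enorm_mul, ENNReal.mul_rpow_of_nonneg _ _ hp.le, ← ofReal_norm, Complex.norm_real,
    Real.norm_of_nonneg (by positivity), ENNReal.ofReal_rpow_of_nonneg (by positivity) hp.le,
    ← Real.rpow_mul (norm_nonneg _), div_mul_cancel₀ _ hp.ne']

/-- The weighted norm inequality for power weights `|θ|^a`, `-1 < a < p - 1`. -/
theorem exists_lintegral_weight_cauchyDilate_le {p a : ℝ} (hp : 1 < p) (ha1 : -1 < a)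
    (ha2 : a < p - 1) : ∃ C : ℝ≥0, ∀ h : Torus → ℂ, Measurable h → Integrable h 𝔪 →
      ∀ r ∈ Ico (0 : ℝ) 1, ∫⁻ θ, ENNReal.ofReal (‖θ‖ ^ a) * ‖cauchyDilate h r θ‖ₑ ^ p ∂𝔪 ≤
        C * ∫⁻ φ, ENNReal.ofReal (‖φ‖ ^ a) * ‖h φ‖ₑ ^ p ∂𝔪 := by
  have hp0 : 0 < p := by linarith
  obtain ⟨C₁, hC₁⟩ := exists_lintegral_cauchyDilate_le hp
  obtain ⟨C₂, hC₂⟩ := exists_lintegral_powerKernel_torus_le (b := a / p) hp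
    (by rwa [div_mul_cancel₀ _ hp0.ne']) (by rwa [div_mul_cancel₀ _ hp0.ne'])
  -- The summand 1 keeps `D` nonzero, so that `D * ∞ = ∞` when the weighted norm of `h` is infinite.
  set D : ℝ≥0∞ := 2 ^ (p - 1) * (C₁ + ENNReal.ofReal (2 * Real.pi) ^ p * C₂) + 1 with hD
  have hDt : D ≠ ∞ := by
    refine ENNReal.add_ne_top.2 ⟨ENNReal.mul_ne_top
      (ENNReal.rpow_ne_top_of_nonneg (by linarith) (by simp)) (ENNReal.add_ne_top.2
      ⟨ENNReal.coe_ne_top, ENNReal.mul_ne_top (ENNReal.rpow_ne_top_of_nonneg hp0.le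
        ENNReal.ofReal_ne_top) ENNReal.coe_ne_top⟩), ENNReal.one_ne_top⟩
  refine ⟨D.toNNReal, fun h hm hh r hr => ?_⟩
  rw [ENNReal.coe_toNNReal hDt]
  set k : Torus → ℂ := fun φ => ((‖φ‖ ^ (a / p) : ℝ) : ℂ) * h φ with hk
  have hkm : Measurable k := by
    have : Measurable fun φ : Torus => ‖φ‖ ^ (a / p) := measurable_norm.pow_const _
    exact (Complex.measurable_ofReal.comp this).mul hm
  have hkp : ∀ φ, ‖k φ‖ₑ ^ p = ENNReal.ofReal (‖φ‖ ^ a) * ‖h φ‖ₑ ^ p := fun φ =>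
    enorm_rpow_mul_rpow hp0 φ _
  simp only [← hkp]
  set W := ∫⁻ φ, ‖k φ‖ₑ ^ p ∂𝔪 with hW
  rcases eq_or_ne W ∞ with hWt | hWt
  · rw [hWt, ENNReal.mul_top (by simp [hD])]
    exact le_top
  have hki : Integrable k 𝔪 := integrable_of_lintegral_rpow_lt_top hp.le hkm hWt.lt_top
  have hcd := continuous_cauchyDilate hh hr
  -- `E` is the commutator; the remaining term `cauchyDilate k r` falls under the unweighted
  -- theorem.
  set E : Torus → ℂ := fun θ => ((‖θ‖ ^ (a / p) : ℝ) : ℂ) * cauchyDilate h r θ - cauchyDilate k r θ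
  have hE : ∫⁻ θ, ‖E θ‖ₑ ^ p ∂𝔪 ≤ ENNReal.ofReal (2 * Real.pi) ^ p * C₂ * W := by
    set S : Torus → ℝ≥0∞ := fun θ => ∫⁻ φ : Torus, ENNReal.ofReal
        (|‖θ‖ ^ (a / p) * ‖φ‖ ^ (-(a / p)) - 1| / |‖θ‖ - ‖φ‖|) * ‖k φ‖ₑ with hS
    have h2pi : ENNReal.ofReal (2 * Real.pi) ≠ 0 := by simp [Real.pi_pos]
    have hpt : ∀ᵐ θ ∂𝔪, ‖E θ‖ₑ ^ p ≤ ENNReal.ofReal (2 * Real.pi) ^ p * S θ ^ p := by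
      filter_upwards [ae_haar_norm_torus_pos] with θ hθ
      rw [← ENNReal.mul_rpow_of_nonneg _ _ hp0.le]
      refine ENNReal.rpow_le_rpow ((enorm_mul_cauchyDilate_sub_le hr hh hki hθ).trans ?_) hp0.le
      refine mul_le_mul' (ENNReal.ofReal_le_ofReal (by linarith [Real.pi_pos])) ?_
      exact lintegral_haar_le _
    have hC := hC₂ (fun φ => ‖k φ‖ₑ) hkm.enorm
    rw [lintegral_haar_eq (fun φ => ‖k φ‖ₑ ^ p), lintegral_haar_eq, mul_left_comm,
      ENNReal.mul_le_mul_iff_right h2pi ENNReal.ofReal_ne_top] at hC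
    calc ∫⁻ θ, ‖E θ‖ₑ ^ p ∂𝔪 ≤ ∫⁻ θ, ENNReal.ofReal (2 * Real.pi) ^ p * S θ ^ p ∂𝔪 :=
          lintegral_mono_ae hpt
      _ = ENNReal.ofReal (2 * Real.pi) ^ p * ∫⁻ θ, S θ ^ p ∂𝔪 :=
          lintegral_const_mul' _ _ (ENNReal.rpow_ne_top_of_nonneg hp0.le ENNReal.ofReal_ne_top)
      _ ≤ ENNReal.ofReal (2 * Real.pi) ^ p * (C₂ * W) := by gcongr
      _ = _ := by ring
  calc ∫⁻ θ, ENNReal.ofReal (‖θ‖ ^ a) * ‖cauchyDilate h r θ‖ₑ ^ p ∂𝔪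
      = ∫⁻ θ, ‖cauchyDilate k r θ + E θ‖ₑ ^ p ∂𝔪 := by
        refine lintegral_congr fun θ => ?_
        rw [← enorm_rpow_mul_rpow hp0 θ]
        simp only [E, add_sub_cancel]
    _ ≤ 2 ^ (p - 1) * (C₁ * W + ENNReal.ofReal (2 * Real.pi) ^ p * C₂ * W) :=
        lintegral_add_rpow_le hp.le (continuous_cauchyDilate hki hr).measurable
          (hC₁ k hkm hki r hr) hE
    _ = 2 ^ (p - 1) * (C₁ + ENNReal.ofReal (2 * Real.pi) ^ p * C₂) * W := by ring
    _ ≤ D * W := by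
        gcongr
        exact le_self_add

/-! ### The Riesz projection and boundary values of Hardy functions -/

/-- The span of the characters `e^{inθ}`, `n ≥ 0`, in `L²` of the circle. -/
noncomputable def analyticSpan : Submodule ℂ (Lp ℂ 2 𝔪) :=
  Submodule.span ℂ (range fun n : ℕ => (fourierLp 2 (n : ℤ) : Lp ℂ 2 𝔪))

/-- Orthogonality to a negative character is a closed condition; conversely the Fourier series of
`f` then has all its partial sums in the span. -/
theorem mem_closure_analyticSpan_iff {f : Lp ℂ 2 𝔪} :
    f ∈ analyticSpan.topologicalClosure ↔ ∀ n : ℤ, n < 0 → fourierCoeff f n = 0 := by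
  constructor
  · intro hf n hn
    rw [fourierCoeff_eq_inner]
    have hle : analyticSpan.topologicalClosure ≤ (ℂ ∙ (fourierLp 2 n : Lp ℂ 2 𝔪))ᗮ := by
      refine Submodule.topologicalClosure_minimal _ (Submodule.span_le.2 ?_)
        (Submodule.isClosed_orthogonal _)
      rintro _ ⟨k, rfl⟩
      exact Submodule.mem_orthogonal_singleton_iff_inner_right.2
        (orthonormal_fourier.2 (by omega))
    exact Submodule.mem_orthogonal_singleton_iff_inner_right.1 (hle hf)
  · intro h
    refine (Submodule.isClosed_topologicalClosure _).mem_of_tendsto (hasSum_fourier_series_L2 f)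
      (Eventually.of_forall fun s => Submodule.sum_mem _ fun n _ => ?_)
    rcases lt_or_ge n 0 with hn | hn
    · rw [h n hn, zero_smul]
      exact Submodule.zero_mem _
    · refine Submodule.smul_mem _ _ (Submodule.le_topologicalClosure _ (Submodule.subset_span ?_))
      exact ⟨n.toNat, by simp only [Int.toNat_of_nonneg hn]⟩

/-- The Riesz projection: the orthogonal projection of `L²` onto the functions whose Fourier
coefficients of negative index vanish. -/
noncomputable def rieszProjection : Lp ℂ 2 𝔪 →L[ℂ] Lp ℂ 2 𝔪 :=
  analyticSpan.topologicalClosure.starProjection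

theorem rieszProjection_mem (h : Lp ℂ 2 𝔪) :
    rieszProjection h ∈ analyticSpan.topologicalClosure :=
  Submodule.starProjection_apply_mem _ h

theorem fourierCoeff_rieszProjection (h : Lp ℂ 2 𝔪) (n : ℤ) :
    fourierCoeff (rieszProjection h) n = if 0 ≤ n then fourierCoeff h n else 0 := by
  split_ifs with hn
  · have hmem : (fourierLp 2 n : Lp ℂ 2 𝔪) ∈ analyticSpan.topologicalClosure :=
      Submodule.le_topologicalClosure _ (Submodule.subset_span
        ⟨n.toNat, by simp only [Int.toNat_of_nonneg hn]⟩)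
    have h0 := Submodule.starProjection_inner_eq_zero h _ hmem
    rw [← inner_conj_symm, map_eq_zero, inner_sub_right, sub_eq_zero] at h0
    rw [fourierCoeff_eq_inner, fourierCoeff_eq_inner, h0]
    rfl
  · exact mem_closure_analyticSpan_iff.1 (rieszProjection_mem h) n (not_le.1 hn)

theorem integrable_Lp_two (h : Lp ℂ 2 𝔪) : Integrable h 𝔪 :=
  (Lp.memLp h).integrable one_le_two

/-- A sequence of radii in `[0, 1)` that tends to `1`. -/
noncomputable def radii (k : ℕ) : ℝ := 1 - 1 / ((k : ℝ) + 2)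

theorem radii_mem (k : ℕ) : radii k ∈ Ico (0 : ℝ) 1 := by
  have h : (0 : ℝ) < (k : ℝ) + 2 := by positivity
  refine ⟨?_, ?_⟩
  · rw [radii, sub_nonneg, div_le_one h]
    linarith [(Nat.cast_nonneg k : (0 : ℝ) ≤ k)]
  · rw [radii, sub_lt_self_iff]
    positivity

theorem tendsto_radii : Tendsto radii atTop (𝓝 1) := by
  have h : Tendsto (fun k : ℕ => 1 / ((k : ℝ) + 2)) atTop (𝓝 0) :=
    (tendsto_const_nhds.div_atTop (tendsto_natCast_atTop_atTop.atTop_add tendsto_const_nhds))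
  have := (tendsto_const_nhds (x := (1 : ℝ))).sub h
  rwa [sub_zero] at this

theorem tendsto_radii_nhdsLT : Tendsto radii atTop (𝓝[<] 1) :=
  tendsto_nhdsWithin_iff.2 ⟨tendsto_radii, Eventually.of_forall fun k => (radii_mem k).2⟩

/-- Dilates of the Cauchy transform of `h` are Abel means of `P h`. This carries bounds uniform in
the radius over to `P`. -/
theorem exists_cauchyDilate_tendsto_rieszProjection (h : Lp ℂ 2 𝔪) :
    ∃ r : ℕ → ℝ, (∀ k, r k ∈ Ico (0 : ℝ) 1) ∧
      ∀ᵐ θ ∂𝔪, Tendsto (fun k => cauchyDilate h (r k) θ) atTop (𝓝 (rieszProjection h θ)) := by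
  have hh := integrable_Lp_two h
  obtain ⟨ns, -, hns⟩ := exists_subseq_tendsto_ae (f := rieszProjection h)
    (mem_closure_analyticSpan_iff.1 (rieszProjection_mem h))
    (G := fun k => cauchyDilate h (radii k)) (fun k => continuous_cauchyDilate hh (radii_mem k))
    radii_mem tendsto_radii fun k n => by
      rw [fourierCoeff_cauchyDilate hh (radii_mem k), fourierCoeff_rieszProjection]
      split_ifs <;> rfl
  exact ⟨fun k => radii (ns k), fun k => radii_mem _, hns⟩

/-- The **Cauchy integral formula** on the circle. -/
theorem cauchyTransform_toCircle {Ψ : ℂ → ℂ} (hΨ : DiffContOnCl ℂ Ψ (Metric.ball 0 1)) {z : ℂ}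
    (hz : ‖z‖ < 1) : cauchyTransform (fun φ => Ψ (AddCircle.toCircle φ)) z = Ψ z := by
  have h := DiffContOnCl.circleAverage_smul_div (R := 1) (c := 0) (w := z) (f := Ψ)
    (by simpa using hΨ) (by simpa using hz)
  rw [← h, Real.circleAverage_def, cauchyTransform, AddCircle.integral_haarAddCircle,
    ← AddCircle.intervalIntegral_preimage (2 * Real.pi) 0, zero_add]
  congr 1
  refine intervalIntegral.integral_congr fun θ _ => ?_
  have e : circleMap 0 1 θ = (AddCircle.toCircle (θ : Torus) : ℂ) := by
    rw [toCircle_coe, circleMap, mul_comm Complex.I]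
    simp
  simp only [e, sub_zero, smul_eq_mul]
  congr 1
  have h0 : (AddCircle.toCircle (θ : Torus) : ℂ) ≠ 0 := Circle.coe_ne_zero _
  have h1 : (fourier (-1) (θ : Torus) : ℂ) = (AddCircle.toCircle (θ : Torus) : ℂ)⁻¹ := by
    rw [fourier_apply, neg_one_zsmul, AddCircle.toCircle_neg, Circle.coe_inv]
  rw [h1, ← div_eq_mul_inv, one_sub_div h0, inv_div]

/-- By Cauchy's formula for `z ↦ Ψ(Rz)`, the values of `Ψ` on radius `sR` are the `s`-dilate of its
values on radius `R`. -/
theorem fourierCoeff_comp_polar_mul {Ψ : ℂ → ℂ} (hΨ : DifferentiableOn ℂ Ψ (Metric.ball 0 1))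
    {R s : ℝ} (hR : R ∈ Ico (0 : ℝ) 1) (hs : s ∈ Ico (0 : ℝ) 1) (n : ℤ) :
    fourierCoeff (fun θ : Torus => Ψ (polar (s * R) θ)) n =
      if 0 ≤ n then (s : ℂ) ^ n.toNat * fourierCoeff (fun θ : Torus => Ψ (polar R θ)) n else 0 := by
  have hmaps : ∀ z ∈ Metric.closedBall (0 : ℂ) 1, (R : ℂ) * z ∈ Metric.ball (0 : ℂ) 1 := by
    intro z hz
    rw [mem_ball_zero_iff, norm_mul, Complex.norm_real, Real.norm_of_nonneg hR.1]
    have := mem_closedBall_zero_iff.1 hz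
    nlinarith [hR.1, hR.2]
  have hd : DiffContOnCl ℂ (fun z => Ψ (R * z)) (Metric.ball 0 1) := by
    refine DifferentiableOn.diffContOnCl ?_
    rw [closure_ball _ one_ne_zero]
    exact hΨ.comp (by fun_prop) hmaps
  have e : (fun θ : Torus => Ψ (polar (s * R) θ)) =
      cauchyDilate (fun θ => Ψ (polar R θ)) s := by
    ext θ
    have := cauchyTransform_toCircle hd (norm_polar_lt_one hs θ)
    rw [cauchyDilate]
    refine Eq.trans ?_ this.symm
    simp only [polar]
    congr 1
    push_cast
    ring
  rw [e, fourierCoeff_cauchyDilate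
    (integrable_of_continuous_torus (Generator.continuous_comp_polar hΨ hR)) hs]

theorem exists_fourierCoeff_comp_polar {Ψ : ℂ → ℂ}
    (hΨ : DifferentiableOn ℂ Ψ (Metric.ball 0 1)) : ∃ a : ℤ → ℂ, (∀ n < 0, a n = 0) ∧
      ∀ R ∈ Ioo (0 : ℝ) 1, ∀ n : ℤ, fourierCoeff (fun θ : Torus => Ψ (polar R θ)) n =
        (R : ℂ) ^ n.toNat * a n := by
  have step : ∀ {R R' : ℝ}, 0 < R → R < R' → R' < 1 → ∀ n : ℤ,
      fourierCoeff (fun θ : Torus => Ψ (polar R θ)) n = if 0 ≤ n then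
        ((R / R' : ℝ) : ℂ) ^ n.toNat * fourierCoeff (fun θ : Torus => Ψ (polar R' θ)) n else 0 := by
    intro R R' h0 h1 h2 n
    have h0' := h0.trans h1
    rw [← fourierCoeff_comp_polar_mul hΨ ⟨h0'.le, h2⟩
      ⟨by positivity, (div_lt_one h0').2 h1⟩ n, div_mul_cancel₀ _ h0'.ne']
  -- The Taylor coefficients are read off on the circle of radius `1/2`.
  refine ⟨fun n => if 0 ≤ n then
    2 ^ n.toNat * fourierCoeff (fun θ : Torus => Ψ (polar (1 / 2) θ)) n else 0,
    fun n hn => if_neg (not_le.2 hn), fun R hR n => ?_⟩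
  -- Since `step` only compares a circle with a larger one, `R` and `1/2` are both compared with a
  -- common larger radius.
  obtain ⟨R', h1, h2⟩ := exists_between (max_lt hR.2 (by norm_num : (1 / 2 : ℝ) < 1))
  have hR' : 0 < R' := hR.1.trans ((le_max_left _ _).trans_lt h1)
  simp only
  rw [step hR.1 ((le_max_left _ _).trans_lt h1) h2,
    step (by norm_num : (0 : ℝ) < 1 / 2) ((le_max_right _ _).trans_lt h1) h2]
  split_ifs with hn
  · rw [← mul_assoc, ← mul_assoc, ← mul_pow, ← mul_pow]
    congr 2
    push_cast
    have : (R' : ℂ) ≠ 0 := by exact_mod_cast hR'.ne'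
    field_simp
  · rw [mul_zero]

/-- Bounded quadratic means force square summable Taylor coefficients, hence an `L²` function `f`
with these coefficients. The restrictions of `Ψ` to circles are Abel means of `f`, so along some
radii they tend to `f` a.e., and `f` must be the given radial limit. -/
theorem exists_Lp_eq_radial_limit {Ψ : ℂ → ℂ} (hΨ : DifferentiableOn ℂ Ψ (Metric.ball 0 1))
    {M : ℝ≥0∞} (hM : M < ∞)
    (hb : ∀ r ∈ Ico (0 : ℝ) 1, ∫⁻ θ, ‖Ψ (polar r θ)‖ₑ ^ 2 ∂𝔪 ≤ M) {u : Torus → ℂ}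
    (hu : ∀ᵐ θ ∂𝔪, Tendsto (fun r : ℝ => Ψ (polar r θ)) (𝓝[<] 1) (𝓝 (u θ))) :
    ∃ f ∈ analyticSpan.topologicalClosure, f =ᵐ[𝔪] u := by
  obtain ⟨a, ha0, ha⟩ := exists_fourierCoeff_comp_polar hΨ
  -- Parseval on the circle of radius `r`; in `hsum` the factor `r^n` disappears as `r → 1` for
  -- finite sums.
  have bessel : ∀ r ∈ Ioo (0 : ℝ) 1, ∀ s : Finset ℤ,
      ∑ n ∈ s, (r ^ n.toNat * ‖a n‖) ^ 2 ≤ M.toReal := by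
    intro r hr s
    have hr' : r ∈ Ico (0 : ℝ) 1 := ⟨hr.1.le, hr.2⟩
    have hc := Generator.continuous_comp_polar hΨ hr'
    set U : Lp ℂ 2 𝔪 := ContinuousMap.toLp 2 𝔪 ℂ ⟨_, hc⟩ with hU
    have hUe : U =ᵐ[𝔪] fun θ => Ψ (polar r θ) := ContinuousMap.coeFn_toLp 𝔪 ⟨_, hc⟩
    have hcoef : ∀ n, ‖fourierCoeff U n‖ ^ 2 = (r ^ n.toNat * ‖a n‖) ^ 2 := fun n => by
      rw [fourierCoeff_congr_ae hUe, ha r hr, norm_mul, norm_pow, Complex.norm_real,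
        Real.norm_of_nonneg hr.1.le]
    have h1 := (summable_sq_fourierCoeff U).sum_le_tsum s (fun n _ => by positivity)
    simp only [hcoef] at h1
    refine h1.trans ?_
    have h2 := tsum_sq_fourierCoeff U
    simp only [hcoef] at h2
    rw [h2, integral_eq_lintegral_of_nonneg_ae (ae_of_all _ fun θ => sq_nonneg _)
      (by fun_prop)]
    refine ENNReal.toReal_mono hM.ne (le_trans (le_of_eq (lintegral_congr_ae ?_)) (hb r hr'))
    filter_upwards [hUe] with θ hθ
    rw [hθ, ENNReal.ofReal_pow (norm_nonneg _), ofReal_norm]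
  have hsum : ∀ s : Finset ℤ, ∑ n ∈ s, ‖a n‖ ^ 2 ≤ M.toReal := by
    intro s
    have ht : Tendsto (fun r : ℝ => ∑ n ∈ s, (r ^ n.toNat * ‖a n‖) ^ 2) (𝓝[<] 1)
        (𝓝 (∑ n ∈ s, (1 ^ n.toNat * ‖a n‖) ^ 2)) := by
      refine Tendsto.mono_left (Continuous.tendsto (f := fun r : ℝ =>
        ∑ n ∈ s, (r ^ n.toNat * ‖a n‖) ^ 2) ?_ 1) nhdsWithin_le_nhds
      fun_prop
    simp only [one_pow, one_mul] at ht
    refine le_of_tendsto ht ?_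
    filter_upwards [Ioo_mem_nhdsLT (zero_lt_one' ℝ)] with r hr using bessel r hr s
  have hmem : Memℓp a 2 := memℓp_gen (by
    simpa using summable_of_sum_le (f := fun n => ‖a n‖ ^ 2) (fun n => by positivity) hsum)
  set f : Lp ℂ 2 𝔪 := fourierBasis.repr.symm ⟨a, hmem⟩ with hf
  have hfa : ∀ n, fourierCoeff f n = a n := fun n => by
    rw [← fourierBasis_repr, hf, LinearIsometryEquiv.apply_symm_apply]
  have hfneg : ∀ n : ℤ, n < 0 → fourierCoeff f n = 0 := fun n hn => by rw [hfa, ha0 n hn]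
  refine ⟨f, mem_closure_analyticSpan_iff.2 hfneg, ?_⟩
  have hpos : ∀ k, 0 < radii k := fun k => by
    rw [radii, sub_pos, div_lt_one (by positivity)]
    linarith [(Nat.cast_nonneg k : (0 : ℝ) ≤ k)]
  obtain ⟨ns, hns, hae⟩ := exists_subseq_tendsto_ae hfneg
    (G := fun k θ => Ψ (polar (radii k) θ))
    (fun k => Generator.continuous_comp_polar hΨ (radii_mem k)) radii_mem tendsto_radii
    fun k n => by
      rw [ha _ ⟨hpos k, (radii_mem k).2⟩, hfa]
      split_ifs with hn
      · rfl
      · rw [ha0 n (not_le.1 hn), mul_zero]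
  filter_upwards [hae, hu] with θ h1 h2
  exact tendsto_nhds_unique h1
    (h2.comp (tendsto_radii_nhdsLT.comp hns.tendsto_atTop))

/-! ### Division by the generator and conjugation of the projections -/

namespace Generator

variable (G : Generator)

/-- The boundary function of the generator. -/
noncomputable def boundary (θ : Torus) : ℂ := G.g (polar 1 θ)

theorem polar_mem_closedBall {r : ℝ} (hr : r ∈ Icc (0 : ℝ) 1) (θ : Torus) :
    polar r θ ∈ Metric.closedBall (0 : ℂ) 1 := by
  rw [mem_closedBall_zero_iff, norm_polar, abs_of_nonneg hr.1]
  exact hr.2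

theorem continuousOn_closedBall : ContinuousOn G.g (Metric.closedBall 0 1) := by
  have := G.diffContOnCl.continuousOn
  rwa [closure_ball _ one_ne_zero] at this

theorem continuous_boundary : Continuous G.boundary :=
  G.continuousOn_closedBall.comp_continuous (continuous_polar 1)
    (polar_mem_closedBall ⟨zero_le_one, le_rfl⟩)

theorem tendsto_radial (θ : Torus) :
    Tendsto (fun r : ℝ => G.g (polar r θ)) (𝓝[<] 1) (𝓝 (G.boundary θ)) := by
  have h1 : Tendsto (fun r : ℝ => polar r θ) (𝓝[<] 1)
      (𝓝[Metric.closedBall 0 1] (polar 1 θ)) := by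
    refine tendsto_nhdsWithin_iff.2 ⟨?_, ?_⟩
    · have : Continuous fun r : ℝ => polar r θ := by
        unfold polar
        fun_prop
      exact (this.tendsto 1).mono_left nhdsWithin_le_nhds
    · filter_upwards [Ioo_mem_nhdsLT (zero_lt_one' ℝ)] with r hr
      exact polar_mem_closedBall ⟨hr.1.le, hr.2.le⟩ θ
  exact Tendsto.comp (G.continuousOn_closedBall _
    (polar_mem_closedBall ⟨zero_le_one, le_rfl⟩ θ)) h1

theorem lintegral_measure (F : Torus → ℝ≥0∞) :
    ∫⁻ θ, F θ ∂G.measure = ENNReal.ofReal (2 * Real.pi) * ∫⁻ θ, ‖G.boundary θ‖ₑ ^ 2 * F θ ∂𝔪 := by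
  rw [← lintegral_haar_eq]
  exact lintegral_withDensity_eq_lintegral_mul_non_measurable _
    (G.continuous_boundary.measurable.enorm.pow_const 2)
    (ae_of_all _ fun θ => ENNReal.pow_lt_top enorm_lt_top) F

variable {G}

/-- A density that is nonzero a.e. preserves null sets, so "a.e." may be read in either measure. -/
theorem ae_measure_iff (hG : ∀ᵐ θ ∂𝔪, G.boundary θ ≠ 0) {P : Torus → Prop} :
    (∀ᵐ θ ∂G.measure, P θ) ↔ ∀ᵐ θ ∂𝔪, P θ := by
  have h1 : G.measure ≪ (volume : Measure Torus) := withDensity_absolutelyContinuous _ _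
  have h2 : (volume : Measure Torus) ≪ G.measure := by
    refine withDensity_absolutelyContinuous'
      (G.continuous_boundary.measurable.enorm.pow_const 2).aemeasurable ?_
    filter_upwards [ae_haar_iff.1 hG] with θ hθ
    exact pow_ne_zero 2 (enorm_ne_zero.2 hθ)
  rw [ae_haar_iff]
  exact ⟨fun h => h2.ae_le h, fun h => h1.ae_le h⟩

/-- The quotient by the generator, normalized so as to be isometric from `L²` of the normalized
measure to the weighted `L²`. -/
noncomputable def divFun (G : Generator) (h : Torus → ℂ) (θ : Torus) : ℂ :=
  ((√(2 * Real.pi))⁻¹ : ℂ) * (h θ / G.boundary θ)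

theorem enorm_sqrt_two_pi_sq : ‖((√(2 * Real.pi))⁻¹ : ℂ)‖ₑ ^ 2 = (ENNReal.ofReal (2 * Real.pi))⁻¹ := by
  have h : 0 < 2 * Real.pi := Real.two_pi_pos
  rw [← ENNReal.ofReal_inv_of_pos h, ← ofReal_norm, ← ENNReal.ofReal_pow (norm_nonneg _), norm_inv,
    Complex.norm_real, Real.norm_of_nonneg (Real.sqrt_nonneg _), inv_pow, Real.sq_sqrt h.le]

theorem lintegral_divFun_sq (hG : ∀ᵐ θ ∂𝔪, G.boundary θ ≠ 0) (h : Torus → ℂ) :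
    ∫⁻ θ, ‖G.divFun h θ‖ₑ ^ 2 ∂G.measure = ∫⁻ θ, ‖h θ‖ₑ ^ 2 ∂𝔪 := by
  have h2pi : ENNReal.ofReal (2 * Real.pi) ≠ 0 := by simp [Real.pi_pos]
  rw [lintegral_measure, ← lintegral_const_mul' _ _ ENNReal.ofReal_ne_top]
  refine lintegral_congr_ae ?_
  filter_upwards [hG] with θ hθ
  rw [← one_mul (‖h θ‖ₑ ^ 2), ← ENNReal.mul_inv_cancel h2pi ENNReal.ofReal_ne_top,
    ← enorm_sqrt_two_pi_sq, divFun]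
  have : h θ = G.boundary θ * (h θ / G.boundary θ) := by field_simp
  conv_rhs => rw [this]
  simp only [enorm_mul, mul_pow]
  ring

theorem eLpNorm_two_eq {β : Type*} [MeasurableSpace β] {ν : Measure β} (f : β → ℂ) :
    eLpNorm f 2 ν = (∫⁻ x, ‖f x‖ₑ ^ 2 ∂ν) ^ (1 / 2 : ℝ) := by
  rw [eLpNorm_eq_lintegral_rpow_enorm_toReal two_ne_zero ENNReal.ofNat_ne_top]
  simp

theorem eLpNorm_divFun (hG : ∀ᵐ θ ∂𝔪, G.boundary θ ≠ 0) (h : Torus → ℂ) :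
    eLpNorm (G.divFun h) 2 G.measure = eLpNorm h 2 𝔪 := by
  rw [eLpNorm_two_eq, eLpNorm_two_eq, lintegral_divFun_sq hG]

theorem memLp_divFun (hG : ∀ᵐ θ ∂𝔪, G.boundary θ ≠ 0) {h : Torus → ℂ} (hm : Measurable h)
    (hh : MemLp h 2 𝔪) : MemLp (G.divFun h) 2 G.measure := by
  refine ⟨?_, ?_⟩
  · exact (measurable_const.mul
      (hm.div G.continuous_boundary.measurable)).aestronglyMeasurable
  · rw [eLpNorm_divFun hG]
    exact hh.2

theorem measurable_Lp {β : Type*} [MeasurableSpace β] {ν : Measure β} {q : ℝ≥0∞} (h : Lp ℂ q ν) :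
    Measurable h := (Lp.stronglyMeasurable h).measurable

/-- Division by the generator as a linear isometry between `L²` spaces. -/
noncomputable def divIsometry (G : Generator) (hG : ∀ᵐ θ ∂𝔪, G.boundary θ ≠ 0) :
    Lp ℂ 2 𝔪 →ₗᵢ[ℂ] Lp ℂ 2 G.measure where
  toFun h := (memLp_divFun hG (measurable_Lp h) (Lp.memLp h)).toLp _
  map_add' h₁ h₂ := by
    ext1
    have e := (ae_measure_iff hG).2 (Lp.coeFn_add h₁ h₂)
    filter_upwards [MemLp.coeFn_toLp (memLp_divFun hG (measurable_Lp (h₁ + h₂))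
      (Lp.memLp (h₁ + h₂))), MemLp.coeFn_toLp (memLp_divFun hG (measurable_Lp h₁) (Lp.memLp h₁)),
      MemLp.coeFn_toLp (memLp_divFun hG (measurable_Lp h₂) (Lp.memLp h₂)), e,
      Lp.coeFn_add ((memLp_divFun hG (measurable_Lp h₁) (Lp.memLp h₁)).toLp _)
        ((memLp_divFun hG (measurable_Lp h₂) (Lp.memLp h₂)).toLp _)] with θ a1 a2 a3 a4 a5
    rw [a1, a5, Pi.add_apply, a2, a3, divFun, divFun, divFun, a4, Pi.add_apply]
    ring
  map_smul' c h := by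
    ext1
    have e := (ae_measure_iff hG).2 (Lp.coeFn_smul c h)
    filter_upwards [MemLp.coeFn_toLp (memLp_divFun hG (measurable_Lp (c • h))
      (Lp.memLp (c • h))), MemLp.coeFn_toLp (memLp_divFun hG (measurable_Lp h) (Lp.memLp h)), e,
      Lp.coeFn_smul c ((memLp_divFun hG (measurable_Lp h) (Lp.memLp h)).toLp _)] with θ a1 a2 a3 a4
    rw [a1, RingHom.id_apply, a4, Pi.smul_apply, a2, divFun, divFun, a3, Pi.smul_apply,
      smul_eq_mul, smul_eq_mul]
    ring
  norm_map' h := by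
    change ‖(memLp_divFun hG (measurable_Lp h) (Lp.memLp h)).toLp _‖ = ‖h‖
    rw [Lp.norm_toLp, eLpNorm_divFun hG, Lp.norm_def]

theorem coeFn_divIsometry (hG : ∀ᵐ θ ∂𝔪, G.boundary θ ≠ 0) (h : Lp ℂ 2 𝔪) :
    ∀ᵐ θ ∂𝔪, G.divIsometry hG h θ = G.divFun h θ :=
  (ae_measure_iff hG).1 (MemLp.coeFn_toLp (memLp_divFun hG (measurable_Lp h) (Lp.memLp h)))

theorem sqrt_two_pi_ne_zero : ((√(2 * Real.pi) : ℝ) : ℂ) ≠ 0 :=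
  Complex.ofReal_ne_zero.2 (Real.sqrt_pos.2 Real.two_pi_pos).ne'

theorem divFun_mul (h : Torus → ℂ) {θ : Torus} (hθ : G.boundary θ ≠ 0) :
    G.divFun (fun θ => √(2 * Real.pi) * (G.boundary θ * h θ)) θ = h θ := by
  have := sqrt_two_pi_ne_zero
  rw [divFun]
  field_simp

theorem divIsometry_surjective (hG : ∀ᵐ θ ∂𝔪, G.boundary θ ≠ 0) (f : Lp ℂ 2 G.measure) :
    ∃ h : Lp ℂ 2 𝔪, G.divIsometry hG h = f ∧
      ∀ᵐ θ ∂𝔪, h θ = √(2 * Real.pi) * (G.boundary θ * f θ) := by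
  set u : Torus → ℂ := fun θ => √(2 * Real.pi) * (G.boundary θ * f θ) with hu
  have hum : Measurable u :=
    measurable_const.mul (G.continuous_boundary.measurable.mul (measurable_Lp f))
  have hdiv : G.divFun u =ᵐ[G.measure] f := by
    refine (ae_measure_iff hG).2 ?_
    filter_upwards [hG] with θ hθ using divFun_mul _ hθ
  have hu2 : MemLp u 2 𝔪 := by
    refine ⟨hum.aestronglyMeasurable, ?_⟩
    rw [← eLpNorm_divFun hG, eLpNorm_congr_ae hdiv]
    exact (Lp.memLp f).2
  refine ⟨hu2.toLp u, ?_, MemLp.coeFn_toLp hu2⟩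
  ext1
  refine (ae_measure_iff hG).2 ?_
  filter_upwards [coeFn_divIsometry hG (hu2.toLp u), MemLp.coeFn_toLp hu2,
    (ae_measure_iff hG).1 hdiv] with θ h1 h2 h3
  rw [h1, ← h3, divFun, divFun, h2]

/-- The holomorphic representative is a multiple of `z^n / g`: dividing is legitimate as `g` has no
zeros inside, the weight cancels `1/|g|²`, and the radial limit exists wherever the boundary value
of `g` is nonzero. -/
theorem divIsometry_fourierLp_mem (hG : ∀ᵐ θ ∂𝔪, G.boundary θ ≠ 0) (n : ℕ) :
    G.divIsometry hG (fourierLp 2 (n : ℤ)) ∈ G.hardySpace := by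
  set c : ℂ := ((√(2 * Real.pi))⁻¹ : ℂ) with hc
  refine ⟨fun z => c * (z ^ n / G.g z), ⟨?_, ?_⟩, ?_⟩
  · exact ((differentiableOn_id.pow n).div G.diffContOnCl.differentiableOn
      G.ne_zero).const_mul c
  · refine (iSup₂_le fun r hr => ?_ : _ ≤ ∫⁻ _ : Torus, ‖c‖ₑ ^ 2).trans_lt ?_
    · refine lintegral_mono fun θ => ?_
      rw [← mul_pow, ← enorm_mul, mul_assoc, div_mul_cancel₀ _ (G.ne_zero _ (polar_mem_ball hr θ)),
        enorm_mul]
      refine pow_le_pow_left' (mul_le_of_le_one_right' ?_) 2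
      rw [← ofReal_norm, norm_pow, norm_polar, abs_of_nonneg hr.1, ENNReal.ofReal_le_one]
      exact pow_le_one₀ hr.1 hr.2.le
    · rw [lintegral_const]
      exact ENNReal.mul_lt_top (ENNReal.pow_lt_top enorm_lt_top) (measure_lt_top _ _)
  · refine (ae_measure_iff hG).2 ?_
    filter_upwards [coeFn_divIsometry hG (fourierLp 2 (n : ℤ)), coeFn_fourierLp 2 (n : ℤ), hG]
      with θ h1 h2 h3
    rw [h1, divFun, h2, ← one_mul (fourier (n : ℤ) θ), ← one_pow (M := ℂ) n, ← Complex.ofReal_one,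
      ← polar_pow]
    refine Tendsto.const_mul _ (Tendsto.div ?_ (G.tendsto_radial θ) h3)
    have : Continuous fun r : ℝ => polar r θ ^ n := by
      unfold polar
      fun_prop
    exact (this.tendsto 1).mono_left nhdsWithin_le_nhds

/-- If `F` is in the weighted Hardy space, `√(2π) g F` has bounded unweighted means and radial limit
`√(2π) g f`, so the boundary value theorem applies. -/
theorem hardySpace_le_map (hG : ∀ᵐ θ ∂𝔪, G.boundary θ ≠ 0) :
    G.hardySpace ≤ analyticSpan.topologicalClosure.map (G.divIsometry hG).toLinearMap := by
  rintro f ⟨F, ⟨hF, hsup⟩, hb⟩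
  obtain ⟨h, hhf, hh⟩ := divIsometry_surjective hG f
  refine ⟨h, ?_, hhf⟩
  have hd : DifferentiableOn ℂ (fun z => √(2 * Real.pi) * (G.g z * F z)) (Metric.ball 0 1) :=
    (G.diffContOnCl.differentiableOn.mul hF).const_mul _
  set S := ⨆ r ∈ Ico (0 : ℝ) 1, ∫⁻ θ : Torus, ‖F (polar r θ)‖ₑ ^ 2 * ‖G.g (polar r θ)‖ₑ ^ 2
  obtain ⟨k, hk, hku⟩ := exists_Lp_eq_radial_limit hd
    (M := ‖((√(2 * Real.pi) : ℝ) : ℂ)‖ₑ ^ 2 * S)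
    (ENNReal.mul_lt_top (ENNReal.pow_lt_top enorm_lt_top) hsup) (fun r hr => by
      calc ∫⁻ θ, ‖√(2 * Real.pi) * (G.g (polar r θ) * F (polar r θ))‖ₑ ^ 2 ∂𝔪
          = ∫⁻ θ, ‖((√(2 * Real.pi) : ℝ) : ℂ)‖ₑ ^ 2 *
              (‖F (polar r θ)‖ₑ ^ 2 * ‖G.g (polar r θ)‖ₑ ^ 2) ∂𝔪 := by
            refine lintegral_congr fun θ => ?_
            simp only [enorm_mul, mul_pow]
            ring
        _ = ‖((√(2 * Real.pi) : ℝ) : ℂ)‖ₑ ^ 2 *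
              ∫⁻ θ, ‖F (polar r θ)‖ₑ ^ 2 * ‖G.g (polar r θ)‖ₑ ^ 2 ∂𝔪 :=
            lintegral_const_mul' _ _ (ENNReal.pow_ne_top enorm_ne_top)
        _ ≤ _ := by
            gcongr
            exact (lintegral_haar_le _).trans (le_iSup₂ (f := fun r (_ : r ∈ Ico (0 : ℝ) 1) =>
              ∫⁻ θ : Torus, ‖F (polar r θ)‖ₑ ^ 2 * ‖G.g (polar r θ)‖ₑ ^ 2) r hr))
    (u := h) (by
      filter_upwards [hh, (ae_measure_iff hG).1 hb] with θ h1 h2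
      rw [h1]
      exact ((G.tendsto_radial θ).mul h2).const_mul _)
  have : h = k := by
    ext1
    exact hku.symm
  rw [this]
  exact hk

theorem map_le_topologicalClosure_hardySpace (hG : ∀ᵐ θ ∂𝔪, G.boundary θ ≠ 0) :
    analyticSpan.topologicalClosure.map (G.divIsometry hG).toLinearMap ≤
      G.hardySpace.topologicalClosure := by
  rw [Submodule.map_le_iff_le_comap]
  refine Submodule.topologicalClosure_minimal _ (Submodule.span_le.2 ?_)
    (G.hardySpace.isClosed_topologicalClosure.preimage (G.divIsometry hG).continuous)
  rintro _ ⟨n, rfl⟩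
  exact Submodule.le_topologicalClosure _ (divIsometry_fourierLp_mem hG n)

theorem topologicalClosure_hardySpace_le (hG : ∀ᵐ θ ∂𝔪, G.boundary θ ≠ 0) :
    G.hardySpace.topologicalClosure ≤
      analyticSpan.topologicalClosure.map (G.divIsometry hG).toLinearMap := by
  refine Submodule.topologicalClosure_minimal _ (hardySpace_le_map hG) ?_
  rw [Submodule.map_coe]
  exact (G.divIsometry hG).isometry.isClosedEmbedding.isClosedMap _
    (Submodule.isClosed_topologicalClosure _)

/-- The weighted Szegő projection is conjugate to the Riesz projection. -/
theorem szegoProjection_divIsometry (hG : ∀ᵐ θ ∂𝔪, G.boundary θ ≠ 0) (h : Lp ℂ 2 𝔪) :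
    G.szegoProjection (G.divIsometry hG h) = G.divIsometry hG (rieszProjection h) := by
  refine Submodule.eq_starProjection_of_mem_of_inner_eq_zero
    (map_le_topologicalClosure_hardySpace hG ⟨_, rieszProjection_mem h, rfl⟩) fun w hw => ?_
  obtain ⟨y, hy, rfl⟩ := topologicalClosure_hardySpace_le hG hw
  change inner ℂ (G.divIsometry hG h - G.divIsometry hG (rieszProjection h))
    (G.divIsometry hG y) = 0
  rw [← map_sub, LinearIsometry.inner_map_map]
  exact Submodule.starProjection_inner_eq_zero h y hy

end Generator

/-! ### Weighted bounds for the Riesz projection and the transfer to `S_μ` -/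

/-- The Riesz projection is bounded on `L^p` with respect to the weight `w`. -/
def RieszBoundedOn (p : ℝ) (w : Torus → ℝ≥0∞) : Prop :=
  ∃ C : ℝ≥0, ∀ h : Lp ℂ 2 𝔪, ∫⁻ θ, w θ * ‖h θ‖ₑ ^ p ∂𝔪 < ∞ →
    ∫⁻ θ, w θ * ‖rieszProjection h θ‖ₑ ^ p ∂𝔪 ≤ C * ∫⁻ θ, w θ * ‖h θ‖ₑ ^ p ∂𝔪

theorem RieszBoundedOn.of_equiv {p : ℝ} {w w' : Torus → ℝ≥0∞} {A B : ℝ≥0}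
    (hA : ∀ᵐ θ ∂𝔪, w θ ≤ A * w' θ) (hB : ∀ᵐ θ ∂𝔪, w' θ ≤ B * w θ) (h : RieszBoundedOn p w') :
    RieszBoundedOn p w := by
  obtain ⟨C, hC⟩ := h
  have comp : ∀ {v v' : Torus → ℝ≥0∞} {D : ℝ≥0}, (∀ᵐ θ ∂𝔪, v θ ≤ D * v' θ) → ∀ u : Torus → ℂ,
      ∫⁻ θ, v θ * ‖u θ‖ₑ ^ p ∂𝔪 ≤ D * ∫⁻ θ, v' θ * ‖u θ‖ₑ ^ p ∂𝔪 := by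
    intro v v' D hD u
    rw [← lintegral_const_mul' _ _ ENNReal.coe_ne_top]
    refine lintegral_mono_ae ?_
    filter_upwards [hD] with θ hθ
    rw [← mul_assoc]
    gcongr
  refine ⟨A * (C * B), fun h hh => ?_⟩
  have h' : ∫⁻ θ, w' θ * ‖h θ‖ₑ ^ p ∂𝔪 < ∞ :=
    (comp hB h).trans_lt (ENNReal.mul_lt_top ENNReal.coe_lt_top hh)
  calc _ ≤ A * ∫⁻ θ, w' θ * ‖rieszProjection h θ‖ₑ ^ p ∂𝔪 := comp hA _
    _ ≤ A * (C * (B * ∫⁻ θ, w θ * ‖h θ‖ₑ ^ p ∂𝔪)) := by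
        gcongr
        refine (hC h h').trans ?_
        gcongr
        exact comp hB h
    _ = _ := by
        push_cast
        ring

theorem rieszBoundedOn_congr {p : ℝ} {w w' : Torus → ℝ≥0∞} {A B : ℝ≥0}
    (hA : ∀ᵐ θ ∂𝔪, w θ ≤ A * w' θ) (hB : ∀ᵐ θ ∂𝔪, w' θ ≤ B * w θ) :
    RieszBoundedOn p w ↔ RieszBoundedOn p w' :=
  ⟨fun h => h.of_equiv hB hA, fun h => h.of_equiv hA hB⟩

theorem lintegral_le_of_tendsto_ae {β : Type*} [MeasurableSpace β] {ν : Measure β}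
    {F : ℕ → β → ℝ≥0∞} (hF : ∀ n, Measurable (F n)) {f : β → ℝ≥0∞}
    (h : ∀ᵐ x ∂ν, Tendsto (fun n => F n x) atTop (𝓝 (f x))) {K : ℝ≥0∞}
    (hK : ∀ n, ∫⁻ x, F n x ∂ν ≤ K) : ∫⁻ x, f x ∂ν ≤ K := by
  calc ∫⁻ x, f x ∂ν = ∫⁻ x, liminf (fun n => F n x) atTop ∂ν := by
        refine lintegral_congr_ae ?_
        filter_upwards [h] with x hx using hx.liminf_eq.symm
    _ ≤ liminf (fun n => ∫⁻ x, F n x ∂ν) atTop := lintegral_liminf_le hF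
    _ ≤ liminf (fun _ : ℕ => K) atTop := liminf_le_liminf (Eventually.of_forall hK)
    _ = K := liminf_const K

/-- The power weight `|θ|^a`. -/
noncomputable def powerWeight (a : ℝ) (θ : Torus) : ℝ≥0∞ := ENNReal.ofReal (‖θ‖ ^ a)

theorem measurable_powerWeight (a : ℝ) : Measurable (powerWeight a) :=
  (measurable_norm.pow_const a).ennreal_ofReal

theorem rieszBoundedOn_powerWeight {p a : ℝ} (hp : 1 < p) (ha1 : -1 < a) (ha2 : a < p - 1) :
    RieszBoundedOn p (powerWeight a) := by
  obtain ⟨C, hC⟩ := exists_lintegral_weight_cauchyDilate_le hp ha1 ha2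
  refine ⟨C, fun h _ => ?_⟩
  obtain ⟨r, hr, ht⟩ := exists_cauchyDilate_tendsto_rieszProjection h
  have hi := integrable_Lp_two h
  -- Fatou's lemma along radii tending to the boundary; the constant is uniform in the radius.
  refine lintegral_le_of_tendsto_ae
    (F := fun k θ => powerWeight a θ * ‖cauchyDilate h (r k) θ‖ₑ ^ p) (fun k => ?_) ?_
    fun k => hC h (Generator.measurable_Lp h) hi (r k) (hr k)
  · exact (measurable_powerWeight a).mul
      ((continuous_cauchyDilate hi (hr k)).measurable.enorm.pow_const p)
  · filter_upwards [ht] with θ hθ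
    exact ENNReal.Tendsto.const_mul ((ENNReal.continuous_rpow_const.tendsto _).comp
      ((continuous_enorm.tendsto _).comp hθ)) (Or.inr ENNReal.ofReal_ne_top)

theorem eLpNorm_le_mul_iff {β : Type*} [MeasurableSpace β] {ν : Measure β} {p : ℝ} (hp : 0 < p)
    (C : ℝ≥0) (f h : β → ℂ) :
    eLpNorm f (ENNReal.ofReal p) ν ≤ C * eLpNorm h (ENNReal.ofReal p) ν ↔
      ∫⁻ x, ‖f x‖ₑ ^ p ∂ν ≤ (C : ℝ≥0∞) ^ p * ∫⁻ x, ‖h x‖ₑ ^ p ∂ν := by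
  have h0 : ENNReal.ofReal p ≠ 0 := by simpa using hp
  rw [eLpNorm_eq_lintegral_rpow_enorm_toReal h0 ENNReal.ofReal_ne_top,
    eLpNorm_eq_lintegral_rpow_enorm_toReal h0 ENNReal.ofReal_ne_top, ENNReal.toReal_ofReal hp.le,
    ← ENNReal.rpow_le_rpow_iff hp, ENNReal.mul_rpow_of_nonneg _ _ hp.le, ← ENNReal.rpow_mul,
    ← ENNReal.rpow_mul, one_div_mul_cancel hp.ne', ENNReal.rpow_one, ENNReal.rpow_one]

namespace Generator

variable {G : Generator}

/-- The density `|g|²` and the factor `|g|^{-p}` from the division combine to `|g|^{2-p}`. -/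
theorem lintegral_divIsometry_rpow (hG : ∀ᵐ θ ∂𝔪, G.boundary θ ≠ 0) {p : ℝ} (hp : 0 ≤ p)
    (h : Lp ℂ 2 𝔪) : ∫⁻ θ, ‖G.divIsometry hG h θ‖ₑ ^ p ∂G.measure =
      (ENNReal.ofReal (2 * Real.pi) * ‖((√(2 * Real.pi))⁻¹ : ℂ)‖ₑ ^ p) *
        ∫⁻ θ, ‖G.boundary θ‖ₑ ^ (2 - p) * ‖h θ‖ₑ ^ p ∂𝔪 := by
  rw [lintegral_measure, mul_assoc,
    ← lintegral_const_mul' _ _ (ENNReal.rpow_ne_top_of_nonneg hp enorm_ne_top)]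
  congr 1
  refine lintegral_congr_ae ?_
  filter_upwards [hG, coeFn_divIsometry hG h] with θ h1 h2
  have h0 : ‖G.boundary θ‖ₑ ≠ 0 := enorm_ne_zero.2 h1
  have e : h θ = G.boundary θ * (h θ / G.boundary θ) := by field_simp
  rw [h2, divFun]
  conv_rhs => rw [e]
  rw [enorm_mul, enorm_mul (G.boundary θ), ENNReal.mul_rpow_of_nonneg _ _ hp,
    ENNReal.mul_rpow_of_nonneg _ _ hp, ENNReal.rpow_sub _ _ h0 enorm_ne_top, ENNReal.rpow_two,
    ENNReal.div_eq_inv_mul]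
  have h3 : ‖G.boundary θ‖ₑ ^ p ≠ 0 := by simp [ENNReal.rpow_eq_zero_iff, h0]
  have h4 : ‖G.boundary θ‖ₑ ^ p ≠ ∞ := ENNReal.rpow_ne_top_of_nonneg hp enorm_ne_top
  set X := ‖G.boundary θ‖ₑ ^ p
  calc _ = 1 * (‖G.boundary θ‖ₑ ^ 2 * (‖((√(2 * Real.pi))⁻¹ : ℂ)‖ₑ ^ p *
        ‖h θ / G.boundary θ‖ₑ ^ p)) := (one_mul _).symm
    _ = _ := by
        rw [← ENNReal.inv_mul_cancel h3 h4]
        ring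

/-- Every element of weighted `L²` is a quotient by `g`. The normalizing constant `κ` occurs on both
sides and cancels; constants for norms and for `p`-th powers differ by the exponent `p`. -/
theorem szegoBoundedOn_iff (hG : ∀ᵐ θ ∂𝔪, G.boundary θ ≠ 0) {p : ℝ} (hp : 1 ≤ p) :
    G.SzegoBoundedOn (ENNReal.ofReal p) ↔
      RieszBoundedOn p fun θ => ‖G.boundary θ‖ₑ ^ (2 - p) := by
  have hp0 : 0 < p := by linarith
  set κ : ℝ≥0∞ := ENNReal.ofReal (2 * Real.pi) * ‖((√(2 * Real.pi))⁻¹ : ℂ)‖ₑ ^ p with hκ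
  have hc : ‖((√(2 * Real.pi))⁻¹ : ℂ)‖ₑ ≠ 0 := enorm_ne_zero.2 (inv_ne_zero sqrt_two_pi_ne_zero)
  have hκ0 : κ ≠ 0 := mul_ne_zero (by simp [Real.pi_pos])
    (ENNReal.rpow_pos (pos_iff_ne_zero.2 hc) enorm_ne_top).ne'
  have hκt : κ ≠ ∞ := ENNReal.mul_ne_top ENNReal.ofReal_ne_top
    (ENNReal.rpow_ne_top_of_nonneg hp0.le enorm_ne_top)
  have hmem : ∀ h : Lp ℂ 2 𝔪, MemLp (G.divIsometry hG h) (ENNReal.ofReal p) G.measure ↔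
      ∫⁻ θ, ‖G.boundary θ‖ₑ ^ (2 - p) * ‖h θ‖ₑ ^ p ∂𝔪 < ∞ := by
    intro h
    have h1 : MemLp (G.divIsometry hG h) (ENNReal.ofReal p) G.measure ↔
        eLpNorm (G.divIsometry hG h) (ENNReal.ofReal p) G.measure < ∞ :=
      ⟨fun h => h.2, fun h => ⟨Lp.aestronglyMeasurable _, h⟩⟩
    rw [h1, eLpNorm_lt_top_iff_lintegral_rpow_enorm_lt_top (by simpa using hp0)
      ENNReal.ofReal_ne_top, ENNReal.toReal_ofReal hp0.le, lintegral_divIsometry_rpow hG hp0.le]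
    constructor
    · intro h2
      by_contra h3
      rw [not_lt, top_le_iff] at h3
      rw [h3, ENNReal.mul_top hκ0] at h2
      exact lt_irrefl _ h2
    · exact fun h2 => ENNReal.mul_lt_top hκt.lt_top h2
  have key : ∀ (C : ℝ≥0) (h : Lp ℂ 2 𝔪),
      eLpNorm (G.szegoProjection (G.divIsometry hG h)) (ENNReal.ofReal p) G.measure ≤
        C * eLpNorm (G.divIsometry hG h) (ENNReal.ofReal p) G.measure ↔
      ∫⁻ θ, ‖G.boundary θ‖ₑ ^ (2 - p) * ‖rieszProjection h θ‖ₑ ^ p ∂𝔪 ≤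
        (C : ℝ≥0∞) ^ p * ∫⁻ θ, ‖G.boundary θ‖ₑ ^ (2 - p) * ‖h θ‖ₑ ^ p ∂𝔪 := by
    intro C h
    rw [eLpNorm_le_mul_iff hp0, szegoProjection_divIsometry hG,
      lintegral_divIsometry_rpow hG hp0.le, lintegral_divIsometry_rpow hG hp0.le, mul_left_comm,
      ENNReal.mul_le_mul_iff_right hκ0 hκt]
  constructor
  · rintro ⟨C, hC⟩
    refine ⟨C ^ p, fun h hh => ?_⟩
    rw [ENNReal.coe_rpow_of_nonneg _ hp0.le]
    exact (key C h).1 (hC _ ((hmem h).2 hh))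
  · rintro ⟨C, hC⟩
    refine ⟨C ^ (1 / p), fun f hf => ?_⟩
    obtain ⟨h, rfl, -⟩ := divIsometry_surjective hG f
    refine (key _ h).2 ?_
    rw [← ENNReal.coe_rpow_of_nonneg _ hp0.le, ← NNReal.rpow_mul, one_div_mul_cancel hp0.ne', NNReal.rpow_one]
    exact hC h ((hmem h).1 hf)

end Generator

/-! ### The weight of `g_α` as a power weight -/

theorem norm_boundary_gAlpha (α : ℝ) (hα : 0 ≤ α) (θ : Torus) :
    ‖(gAlpha α hα).boundary θ‖ = ‖(AddCircle.toCircle θ : ℂ) - 1‖ ^ α := by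
  have h := norm_gAlpha_sq α hα (polar 1 θ)
  rw [mul_comm, Real.rpow_mul (norm_nonneg _), Real.rpow_two] at h
  have h2 := (pow_left_inj₀ (norm_nonneg _) (by positivity) two_ne_zero).1 h
  rw [Generator.boundary, h2, polar, Complex.ofReal_one, one_mul]

theorem norm_toCircle_sub_one_pos {θ : Torus} (hθ : 0 < ‖θ‖) :
    0 < ‖(AddCircle.toCircle θ : ℂ) - 1‖ :=
  lt_of_lt_of_le (by have := Real.pi_pos; positivity) (mul_norm_le_norm_toCircle_sub_one θ)

theorem ae_boundary_gAlpha_ne_zero (α : ℝ) (hα : 0 ≤ α) :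
    ∀ᵐ θ ∂𝔪, (gAlpha α hα).boundary θ ≠ 0 := by
  filter_upwards [ae_haar_norm_torus_pos] with θ hθ
  rw [← norm_pos_iff, norm_boundary_gAlpha]
  exact Real.rpow_pos_of_pos (norm_toCircle_sub_one_pos hθ) α

theorem rpow_le_max_mul_rpow {c x y : ℝ} (hc : 0 < c) (hx : 0 < x) (h1 : c * x ≤ y) (h2 : y ≤ x)
    (a : ℝ) : y ^ a ≤ max 1 (c ^ a) * x ^ a := by
  have hy : 0 < y := (mul_pos hc hx).trans_le h1
  rcases le_total 0 a with ha | ha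
  · calc y ^ a ≤ 1 * x ^ a := by rw [one_mul]; gcongr
      _ ≤ _ := by gcongr; exact le_max_left _ _
  · calc y ^ a ≤ (c * x) ^ a := Real.rpow_le_rpow_of_nonpos (mul_pos hc hx) h1 ha
      _ = c ^ a * x ^ a := Real.mul_rpow hc.le hx.le
      _ ≤ _ := by gcongr; exact le_max_right _ _

theorem szegoBoundedOn_gAlpha_iff {α : ℝ} (hα : 0 ≤ α) {p : ℝ} (hp : 1 ≤ p) :
    (gAlpha α hα).SzegoBoundedOn (ENNReal.ofReal p) ↔
      RieszBoundedOn p (powerWeight (α * (2 - p))) := by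
  rw [Generator.szegoBoundedOn_iff (ae_boundary_gAlpha_ne_zero α hα) hp]
  set a := α * (2 - p) with ha
  have hc : 0 < 2 / Real.pi := by have := Real.pi_pos; positivity
  have hw : ∀ θ : Torus, 0 < ‖θ‖ → ‖(gAlpha α hα).boundary θ‖ₑ ^ (2 - p) =
      ENNReal.ofReal (‖(AddCircle.toCircle θ : ℂ) - 1‖ ^ a) := by
    intro θ hθ
    have h := norm_toCircle_sub_one_pos hθ
    rw [← ofReal_norm, norm_boundary_gAlpha, ENNReal.ofReal_rpow_of_pos (by positivity),
      ← Real.rpow_mul h.le]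
  have conv : ∀ (D x y : ℝ), 0 ≤ D → y ≤ D * x →
      ENNReal.ofReal y ≤ (D.toNNReal : ℝ≥0∞) * ENNReal.ofReal x := by
    intro D x y hD h
    refine (ENNReal.ofReal_le_ofReal h).trans_eq ?_
    rw [ENNReal.ofReal_mul hD]
    rfl
  refine rieszBoundedOn_congr (A := (max 1 ((2 / Real.pi) ^ a)).toNNReal)
    (B := (max 1 ((2 / Real.pi) ^ (-a))).toNNReal) ?_ ?_
  · filter_upwards [ae_haar_norm_torus_pos] with θ hθ
    rw [hw θ hθ]
    exact conv _ _ _ (by positivity) (rpow_le_max_mul_rpow hc hθ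
      (mul_norm_le_norm_toCircle_sub_one θ) (norm_toCircle_sub_one_le θ) a)
  · filter_upwards [ae_haar_norm_torus_pos] with θ hθ
    rw [hw θ hθ]
    refine conv _ _ _ (by positivity) ?_
    have h := norm_toCircle_sub_one_pos hθ
    have h1 := rpow_le_max_mul_rpow hc hθ
      (mul_norm_le_norm_toCircle_sub_one θ) (norm_toCircle_sub_one_le θ) (-a)
    rw [Real.rpow_neg h.le, Real.rpow_neg hθ.le] at h1
    have hy : 0 < ‖(AddCircle.toCircle θ : ℂ) - 1‖ ^ a := by positivity
    have hx : 0 < ‖θ‖ ^ a := by positivity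
    rwa [← div_eq_mul_inv, inv_eq_one_div, div_le_div_iff₀ hy hx, one_mul] at h1

/-! ### Necessary conditions on the exponent -/

theorem lintegral_rpow_Ioc_eq_top {s c : ℝ} (hs : s ≤ -1) (hc : 0 < c) :
    ∫⁻ t in Ioc (0 : ℝ) c, ENNReal.ofReal (t ^ s) = ∞ := by
  by_contra h
  have hlt : ∫⁻ t in Ioo (0 : ℝ) c, ENNReal.ofReal (t ^ s) < ∞ :=
    (lintegral_mono_set Ioo_subset_Ioc_self).trans_lt (Ne.lt_top h)
  have hi : IntegrableOn (fun t : ℝ => t ^ s) (Ioo 0 c) := by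
    refine ⟨(measurable_id.pow_const s).aestronglyMeasurable, ?_⟩
    refine lt_of_eq_of_lt (setLIntegral_congr_fun measurableSet_Ioo fun t ht => ?_) hlt
    have : 0 < t := ht.1
    simp only
    rw [← ofReal_norm, Real.norm_of_nonneg (by positivity)]
  exact absurd ((intervalIntegral.integrableOn_Ioo_rpow_iff hc).1 hi) (not_lt.2 hs)

theorem setLIntegral_powerWeight_eq_top {s c : ℝ} (hs : s ≤ -1) (hc : 0 < c) (hcpi : c ≤ Real.pi) :
    ∫⁻ θ in {θ : Torus | ‖θ‖ ≤ c}, powerWeight s θ ∂𝔪 = ∞ := by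
  have hms : MeasurableSet {θ : Torus | ‖θ‖ ≤ c} := measurableSet_le measurable_norm measurable_const
  have h2pi : ENNReal.ofReal (2 * Real.pi) ≠ ∞ := ENNReal.ofReal_ne_top
  have h : ∫⁻ θ : Torus, (Iic c).indicator (fun t => ENNReal.ofReal (t ^ s)) ‖θ‖ = ∞ := by
    rw [lintegral_comp_norm_torus, setLIntegral_indicator measurableSet_Iic]
    have : Iic c ∩ Ioc 0 Real.pi = Ioc 0 c := by
      ext t
      simp only [mem_inter_iff, mem_Iic, mem_Ioc]
      exact ⟨fun h => ⟨h.2.1, h.1⟩, fun h => ⟨h.2, h.1, h.2.trans hcpi⟩⟩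
    rw [this, lintegral_rpow_Ioc_eq_top hs hc, ENNReal.mul_top two_ne_zero]
  rw [lintegral_haar_eq, ENNReal.mul_eq_top] at h
  rw [← lintegral_indicator hms]
  exact (h.resolve_right fun h => h2pi h.1).2

theorem lintegral_powerWeight_eq_top {s : ℝ} (hs : s ≤ -1) : ∫⁻ θ, powerWeight s θ ∂𝔪 = ∞ :=
  top_le_iff.1 ((setLIntegral_powerWeight_eq_top hs Real.pi_pos le_rfl).ge.trans
    (setLIntegral_le_lintegral _ _))

theorem fourierCoeff_fourier_mul (k n : ℤ) (h : Torus → ℂ) :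
    fourierCoeff (fun θ => fourier k θ * h θ) n = fourierCoeff h (n - k) := by
  simp only [fourierCoeff, smul_eq_mul]
  refine integral_congr_ae (ae_of_all _ fun θ => ?_)
  simp only
  rw [← mul_assoc, ← fourier_add]
  congr 3
  ring

theorem enorm_fourier_apply (k : ℤ) (θ : Torus) : ‖(fourier k θ : ℂ)‖ₑ = 1 := by
  rw [← ofReal_norm, norm_fourier_apply, ENNReal.ofReal_one]

theorem memLp_fourier_mul (k : ℤ) {h : Torus → ℂ} (hh : MemLp h 2 𝔪) :
    MemLp (fun θ => fourier k θ * h θ) 2 𝔪 := by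
  refine ⟨(map_continuous (fourier k)).aestronglyMeasurable.mul hh.1, ?_⟩
  have : eLpNorm (fun θ => fourier k θ * h θ) 2 𝔪 = eLpNorm h 2 𝔪 := by
    rw [Generator.eLpNorm_two_eq, Generator.eLpNorm_two_eq]
    simp only [enorm_mul, enorm_fourier_apply, one_mul]
  rw [this]
  exact hh.2

/-- `P h - e^{iθ} P (e^{-iθ} h)` is the mean of `h`. -/
theorem exists_rieszProjection_sub_eq_fourierCoeff (h : Lp ℂ 2 𝔪) :
    ∃ h' : Lp ℂ 2 𝔪, (∀ᵐ θ ∂𝔪, ‖h' θ‖ₑ = ‖h θ‖ₑ) ∧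
      ∀ᵐ θ ∂𝔪, rieszProjection h θ - fourier 1 θ * rieszProjection h' θ = fourierCoeff h 0 := by
  set h' : Lp ℂ 2 𝔪 := (memLp_fourier_mul (-1) (Lp.memLp h)).toLp _ with hh'
  have e' : h' =ᵐ[𝔪] fun θ => fourier (-1) θ * h θ := MemLp.coeFn_toLp _
  set u : Lp ℂ 2 𝔪 := (memLp_fourier_mul 1 (Lp.memLp (rieszProjection h'))).toLp _ with hu
  have eu : u =ᵐ[𝔪] fun θ => fourier 1 θ * rieszProjection h' θ := MemLp.coeFn_toLp _
  refine ⟨h', ?_, ?_⟩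
  · filter_upwards [e'] with θ hθ
    rw [hθ, enorm_mul, enorm_fourier_apply, one_mul]
  -- Conjugating by the shift moves the cut-off from `n ≥ 0` to `n ≥ 1`, so the two sides differ
  -- only in the coefficient of index 0.
  · have key : rieszProjection h - u = fourierCoeff h 0 • fourierLp 2 0 := by
      refine eq_of_fourierCoeff_eq fun n => ?_
      rw [fourierCoeff_sub_Lp, fourierCoeff_rieszProjection, fourierCoeff_congr_ae eu,
        fourierCoeff_fourier_mul, fourierCoeff_rieszProjection, fourierCoeff_congr_ae e',
        fourierCoeff_fourier_mul, fourierCoeff_eq_inner (fourierCoeff h 0 • fourierLp 2 0),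
        inner_smul_right, orthonormal_iff_ite.1 orthonormal_fourier n 0]
      have : n - 1 - -1 = n := by ring
      rw [this]
      split_ifs <;> first | omega | simp_all
    have key' : ((rieszProjection h - u : Lp ℂ 2 𝔪) : Torus → ℂ) =ᵐ[𝔪]
        ((fourierCoeff h 0 • fourierLp 2 0 : Lp ℂ 2 𝔪) : Torus → ℂ) := by rw [key]
    filter_upwards [key', Lp.coeFn_sub (rieszProjection h) u, eu,
      Lp.coeFn_smul (fourierCoeff h 0) (fourierLp 2 0 : Lp ℂ 2 𝔪), coeFn_fourierLp 2 0]
      with θ h1 h2 h3 h4 h5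
    rw [← h3, ← Pi.sub_apply, ← h2, h1, h4, Pi.smul_apply, h5, fourier_zero, smul_eq_mul, mul_one]

/-- The mean of `h` is a difference of two terms whose weighted norms are controlled, because `h'`
and `h` have the same modulus. -/
theorem RieszBoundedOn.exists_fourierCoeff_le {p : ℝ} (hp : 1 ≤ p) {w : Torus → ℝ≥0∞}
    (hw : Measurable w) (hb : RieszBoundedOn p w) :
    ∃ D : ℝ≥0, ∀ h : Lp ℂ 2 𝔪, ∫⁻ θ, w θ * ‖h θ‖ₑ ^ p ∂𝔪 < ∞ →
      ‖fourierCoeff h 0‖ₑ ^ p * ∫⁻ θ, w θ ∂𝔪 ≤ D * ∫⁻ θ, w θ * ‖h θ‖ₑ ^ p ∂𝔪 := by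
  obtain ⟨C, hC⟩ := hb
  have hp0 : 0 < p := by linarith
  refine ⟨2 ^ (p - 1) * (2 * C), fun h hh => ?_⟩
  obtain ⟨h', h1, h2⟩ := exists_rieszProjection_sub_eq_fourierCoeff h
  have e : ∫⁻ θ, w θ * ‖h' θ‖ₑ ^ p ∂𝔪 = ∫⁻ θ, w θ * ‖h θ‖ₑ ^ p ∂𝔪 := by
    refine lintegral_congr_ae ?_
    filter_upwards [h1] with θ hθ
    rw [hθ]
  have b1 := hC h hh
  have b2 := hC h' (by rwa [e])
  rw [e] at b2
  have h2t : (2 : ℝ≥0∞) ^ (p - 1) ≠ ∞ := ENNReal.rpow_ne_top_of_nonneg (by linarith) (by simp)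
  calc ‖fourierCoeff h 0‖ₑ ^ p * ∫⁻ θ, w θ ∂𝔪
      = ∫⁻ θ, ‖fourierCoeff h 0‖ₑ ^ p * w θ ∂𝔪 := (lintegral_const_mul _ hw).symm
    _ ≤ ∫⁻ θ, 2 ^ (p - 1) * (w θ * ‖rieszProjection h θ‖ₑ ^ p +
          w θ * ‖rieszProjection h' θ‖ₑ ^ p) ∂𝔪 := by
        refine lintegral_mono_ae ?_
        filter_upwards [h2] with θ hθ
        rw [← hθ, mul_comm, ← mul_add, mul_left_comm]
        gcongr
        refine (enorm_sub_rpow_le hp _ _).trans_eq ?_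
        rw [enorm_mul, enorm_fourier_apply, one_mul]
    _ = 2 ^ (p - 1) * (∫⁻ θ, w θ * ‖rieszProjection h θ‖ₑ ^ p ∂𝔪 +
          ∫⁻ θ, w θ * ‖rieszProjection h' θ‖ₑ ^ p ∂𝔪) := by
        have hm : Measurable fun θ => w θ * ‖rieszProjection h θ‖ₑ ^ p :=
          hw.mul ((Generator.measurable_Lp _).enorm.pow_const p)
        rw [lintegral_const_mul' _ _ h2t, lintegral_add_left hm]
    _ ≤ 2 ^ (p - 1) * (C * ∫⁻ θ, w θ * ‖h θ‖ₑ ^ p ∂𝔪 + C * ∫⁻ θ, w θ * ‖h θ‖ₑ ^ p ∂𝔪) := by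
        gcongr
    _ = _ := by
        rw [← two_mul, ENNReal.coe_mul, ENNReal.coe_mul, ENNReal.coe_rpow_of_nonneg _ (by linarith)]
        push_cast
        ring

/-- The function `|θ|⁻¹` truncated near the origin. -/
noncomputable def truncInv (δ : ℝ) (θ : Torus) : ℝ := if δ ≤ ‖θ‖ then ‖θ‖⁻¹ else 0

theorem measurable_truncInv (δ : ℝ) : Measurable (truncInv δ) :=
  Measurable.ite (measurableSet_le measurable_const measurable_norm) measurable_norm.inv
    measurable_const

theorem truncInv_nonneg (δ : ℝ) (θ : Torus) : 0 ≤ truncInv δ θ := by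
  unfold truncInv
  split_ifs <;> positivity

theorem truncInv_le {δ : ℝ} (hδ : 0 < δ) (θ : Torus) : truncInv δ θ ≤ δ⁻¹ := by
  unfold truncInv
  split_ifs with h
  · exact inv_anti₀ hδ h
  · positivity

theorem memLp_truncInv {δ : ℝ} (hδ : 0 < δ) : MemLp (fun θ => (truncInv δ θ : ℂ)) 2 𝔪 :=
  MemLp.of_bound (Complex.measurable_ofReal.comp (measurable_truncInv δ)).aestronglyMeasurable δ⁻¹
    (ae_of_all _ fun θ => by
      rw [Complex.norm_real, Real.norm_of_nonneg (truncInv_nonneg δ θ)]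
      exact truncInv_le hδ θ)

theorem RieszBoundedOn.exists_truncInv_le {p a : ℝ} (hp : 1 ≤ p)
    (hb : RieszBoundedOn p (powerWeight a)) :
    ∃ D : ℝ≥0, ∀ δ : ℝ, 0 < δ →
      ∫⁻ θ, powerWeight a θ * ENNReal.ofReal (truncInv δ θ) ^ p ∂𝔪 < ∞ ∧
      (∫⁻ θ, ENNReal.ofReal (truncInv δ θ) ∂𝔪) ^ p * ∫⁻ θ, powerWeight a θ ∂𝔪 ≤
        D * ∫⁻ θ, powerWeight a θ * ENNReal.ofReal (truncInv δ θ) ^ p ∂𝔪 := by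
  have hp0 : 0 < p := by linarith
  obtain ⟨D, hD⟩ := hb.exists_fourierCoeff_le hp (measurable_powerWeight a)
  refine ⟨D, fun δ hδ => ?_⟩
  have hmem := memLp_truncInv hδ
  set h : Lp ℂ 2 𝔪 := hmem.toLp _ with hh
  have he : h =ᵐ[𝔪] fun θ => (truncInv δ θ : ℂ) := MemLp.coeFn_toLp _
  have hI : ∫⁻ θ, powerWeight a θ * ‖h θ‖ₑ ^ p ∂𝔪 =
      ∫⁻ θ, powerWeight a θ * ENNReal.ofReal (truncInv δ θ) ^ p ∂𝔪 := by
    refine lintegral_congr_ae ?_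
    filter_upwards [he] with θ hθ
    rw [hθ, ← ofReal_norm, Complex.norm_real, Real.norm_of_nonneg (truncInv_nonneg δ θ)]
  have hfin : ∫⁻ θ, powerWeight a θ * ENNReal.ofReal (truncInv δ θ) ^ p ∂𝔪 < ∞ := by
    calc ∫⁻ θ, powerWeight a θ * ENNReal.ofReal (truncInv δ θ) ^ p ∂𝔪
        ≤ ∫⁻ _ : Torus, ENNReal.ofReal (δ ^ a + Real.pi ^ a) * ENNReal.ofReal δ⁻¹ ^ p ∂𝔪 := by
          refine lintegral_mono fun θ => ?_
          by_cases hθ : δ ≤ ‖θ‖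
          · have hθ0 := hδ.trans_le hθ
            have hpa : 0 < Real.pi ^ a := Real.rpow_pos_of_pos Real.pi_pos a
            have hda : 0 < δ ^ a := by positivity
            refine mul_le_mul' (ENNReal.ofReal_le_ofReal ?_)
              (ENNReal.rpow_le_rpow (ENNReal.ofReal_le_ofReal (truncInv_le hδ θ)) hp0.le)
            rcases le_total 0 a with ha | ha
            · have := Real.rpow_le_rpow hθ0.le (norm_torus_le_pi θ) ha
              linarith
            · have := Real.rpow_le_rpow_of_nonpos hδ hθ ha
              linarith
          · rw [truncInv, if_neg hθ, ENNReal.ofReal_zero, ENNReal.zero_rpow_of_pos hp0, mul_zero]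
            exact zero_le
      _ < ∞ := by
          rw [lintegral_const]
          exact ENNReal.mul_lt_top (ENNReal.mul_lt_top ENNReal.ofReal_lt_top
            (ENNReal.rpow_lt_top_of_nonneg hp0.le ENNReal.ofReal_ne_top)) (measure_lt_top _ _)
  refine ⟨hfin, ?_⟩
  have hc : ‖fourierCoeff h 0‖ₑ = ∫⁻ θ, ENNReal.ofReal (truncInv δ θ) ∂𝔪 := by
    have hint : Integrable (truncInv δ) 𝔪 := by
      simpa using (hmem.integrable one_le_two).re
    rw [fourierCoeff_congr_ae he, fourierCoeff]
    simp only [neg_zero, fourier_zero, one_smul]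
    rw [integral_complex_ofReal, ← ofReal_norm, Complex.norm_real,
      Real.norm_of_nonneg (integral_nonneg (truncInv_nonneg δ)),
      ofReal_integral_eq_lintegral_ofReal hint (ae_of_all _ (truncInv_nonneg δ))]
  have := hD h (by rwa [hI])
  rwa [hc, hI] at this

theorem lintegral_truncInv_ne_zero {δ : ℝ} (hδ : δ < Real.pi) :
    ∫⁻ θ, ENNReal.ofReal (truncInv δ θ) ∂𝔪 ≠ 0 := by
  intro h
  rw [lintegral_eq_zero_iff (measurable_truncInv δ).ennreal_ofReal] at h
  have h2 : ∀ᵐ θ : Torus, ¬ δ ≤ ‖θ‖ := by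
    filter_upwards [ae_haar_iff.1 h, ae_norm_torus_pos] with θ h1 h2 h3
    rw [truncInv, if_pos h3, Pi.zero_apply, ENNReal.ofReal_eq_zero] at h1
    exact absurd (inv_pos.2 h2) (not_lt.2 h1)
  have h3 : ∫⁻ θ : Torus, (Ici δ).indicator (fun _ => (1 : ℝ≥0∞)) ‖θ‖ = 0 := by
    rw [lintegral_eq_zero_iff' (by
      exact ((measurable_const.indicator measurableSet_Ici).comp measurable_norm).aemeasurable)]
    filter_upwards [h2] with θ hθ
    exact indicator_of_notMem hθ _
  rw [lintegral_comp_norm_torus, mul_eq_zero, setLIntegral_indicator measurableSet_Ici] at h3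
  have h4 := h3.resolve_left two_ne_zero
  rw [setLIntegral_const, one_mul] at h4
  have h5 : Ioo (max δ 0) Real.pi ⊆ Ici δ ∩ Ioc 0 Real.pi := fun t ht =>
    ⟨((le_max_left _ _).trans_lt ht.1).le, (le_max_right _ _).trans_lt ht.1, ht.2.le⟩
  have h6 := measure_mono_null h5 h4
  rw [Real.volume_Ioo, ENNReal.ofReal_eq_zero, sub_nonpos] at h6
  exact absurd (max_lt hδ Real.pi_pos) (not_lt.2 h6)

/-- If `a ≤ -1` the weight has infinite mass, while a test function supported away from 0 has
positive mean and finite weighted norm. -/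
theorem RieszBoundedOn.neg_one_lt {p a : ℝ} (hp : 1 ≤ p) (hb : RieszBoundedOn p (powerWeight a)) :
    -1 < a := by
  by_contra ha
  obtain ⟨D, hD⟩ := hb.exists_truncInv_le hp
  obtain ⟨h1, h2⟩ := hD 1 one_pos
  rw [lintegral_powerWeight_eq_top (not_lt.1 ha), ENNReal.mul_top] at h2
  · exact absurd h2 (not_le.2 (ENNReal.mul_lt_top ENNReal.coe_lt_top h1))
  · have h0 := lintegral_truncInv_ne_zero (δ := 1) (by linarith [Real.pi_gt_three])
    intro h
    rw [ENNReal.rpow_eq_zero_iff] at h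
    rcases h with h | h
    · exact h0 h.1
    · linarith [h.2]

/-- If `a ≥ p - 1`, then `|θ|^a |θ|^{-p}` is dominated by a multiple of `|θ|⁻¹`. With `L` the mean
of the truncation, this gives `L^p W ≤ D E L`, so `L` stays bounded as `δ → 0`, against the
divergence of `∫ |θ|⁻¹`. -/
theorem RieszBoundedOn.lt_sub_one {p a : ℝ} (hp : 1 < p) (hb : RieszBoundedOn p (powerWeight a)) :
    a < p - 1 := by
  by_contra ha
  rw [not_lt] at ha
  have hp0 : 0 < p := by linarith
  have hp1 : 0 < p - 1 := by linarith
  obtain ⟨D, hD⟩ := hb.exists_truncInv_le hp.le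
  set W := ∫⁻ θ, powerWeight a θ ∂𝔪 with hW
  have hW0 : W ≠ 0 := by
    intro h
    rw [hW, lintegral_eq_zero_iff (measurable_powerWeight a)] at h
    have : ∀ᵐ _ : Torus ∂𝔪, False := by
      filter_upwards [h, ae_haar_norm_torus_pos] with θ h1 h2
      rw [powerWeight, Pi.zero_apply, ENNReal.ofReal_eq_zero] at h1
      exact absurd (Real.rpow_pos_of_pos h2 a) (not_lt.2 h1)
    rw [ae_iff] at this
    simp at this
  set E := ENNReal.ofReal (Real.pi ^ (a - p + 1)) with hE
  have hcomp : ∀ δ : ℝ, 0 < δ → ∫⁻ θ, powerWeight a θ * ENNReal.ofReal (truncInv δ θ) ^ p ∂𝔪 ≤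
      E * ∫⁻ θ, ENNReal.ofReal (truncInv δ θ) ∂𝔪 := by
    intro δ hδ
    rw [← lintegral_const_mul _ (measurable_truncInv δ).ennreal_ofReal]
    refine lintegral_mono fun θ => ?_
    by_cases hθ : δ ≤ ‖θ‖
    · have hθ0 := hδ.trans_le hθ
      rw [truncInv, if_pos hθ, powerWeight, hE, ENNReal.ofReal_rpow_of_pos (by positivity),
        ← ENNReal.ofReal_mul (by positivity), ← ENNReal.ofReal_mul (by have := Real.pi_pos; positivity)]
      refine ENNReal.ofReal_le_ofReal ?_
      calc ‖θ‖ ^ a * ‖θ‖⁻¹ ^ p = ‖θ‖ ^ (a - p + 1) * ‖θ‖⁻¹ := by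
            rw [Real.inv_rpow hθ0.le, ← Real.rpow_neg hθ0.le, ← Real.rpow_neg_one,
              ← Real.rpow_add hθ0, ← Real.rpow_add hθ0]
            congr 1
            ring
        _ ≤ _ := by
            gcongr
            · linarith
            · exact norm_torus_le_pi θ
    · rw [truncInv, if_neg hθ, ENNReal.ofReal_zero, ENNReal.zero_rpow_of_pos hp0, mul_zero]
      exact zero_le
  set K := (D * E / W) ^ (1 / (p - 1)) with hK
  have hKt : K ≠ ∞ := ENNReal.rpow_ne_top_of_nonneg (by positivity)
    (ENNReal.div_ne_top (ENNReal.mul_ne_top ENNReal.coe_ne_top ENNReal.ofReal_ne_top) hW0)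
  have hbound : ∀ δ : ℝ, 0 < δ → ∫⁻ θ, ENNReal.ofReal (truncInv δ θ) ∂𝔪 ≤ K := by
    intro δ hδ
    set L := ∫⁻ θ, ENNReal.ofReal (truncInv δ θ) ∂𝔪 with hL
    have hLt : L ≠ ∞ := by
      refine ((lintegral_mono fun θ => ENNReal.ofReal_le_ofReal (truncInv_le hδ θ)).trans_lt ?_).ne
      rw [lintegral_const]
      exact ENNReal.mul_lt_top ENNReal.ofReal_lt_top (measure_lt_top _ _)
    rcases eq_or_ne L 0 with hL0 | hL0
    · rw [hL0]
      exact zero_le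
    have h1 : L ^ p * W ≤ D * (E * L) := (hD δ hδ).2.trans (by gcongr; exact hcomp δ hδ)
    have h2 : L ^ (p - 1) * W ≤ D * E := by
      rw [← ENNReal.mul_le_mul_iff_left hL0 hLt]
      calc L ^ (p - 1) * W * L = (L ^ (p - 1) * L ^ (1 : ℝ)) * W := by
            rw [ENNReal.rpow_one]
            ring
        _ = L ^ p * W := by rw [← ENNReal.rpow_add _ _ hL0 hLt, sub_add_cancel]
        _ ≤ _ := h1.trans_eq (by ring)
    have h3 : L ^ (p - 1) ≤ D * E / W :=
      (ENNReal.le_div_iff_mul_le (Or.inl hW0) (Or.inr (ENNReal.mul_ne_top ENNReal.coe_ne_top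
        ENNReal.ofReal_ne_top))).2 h2
    calc L = (L ^ (p - 1)) ^ (1 / (p - 1)) := by
          rw [← ENNReal.rpow_mul, mul_one_div_cancel hp1.ne', ENNReal.rpow_one]
      _ ≤ K := ENNReal.rpow_le_rpow h3 (by positivity)
  have hlim : ∫⁻ θ, powerWeight (-1) θ ∂𝔪 ≤ K := by
    refine lintegral_le_of_tendsto_ae
      (F := fun (n : ℕ) θ => ENNReal.ofReal (truncInv (1 / ((n : ℝ) + 1)) θ))
      (fun n => (measurable_truncInv _).ennreal_ofReal) ?_ fun n => hbound _ (by positivity)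
    filter_upwards [ae_haar_norm_torus_pos] with θ hθ
    refine tendsto_const_nhds.congr' ?_
    filter_upwards [(tendsto_one_div_add_atTop_nhds_zero_nat (𝕜 := ℝ)).eventually_lt_const hθ]
      with n hn
    rw [truncInv, if_pos hn.le, powerWeight, Real.rpow_neg_one]
  rw [lintegral_powerWeight_eq_top le_rfl, top_le_iff] at hlim
  exact hKt hlim

/-! ### Failure at `p = 1` -/

/-- The Cauchy kernel with pole at `e^{iφ} / r`. -/
noncomputable def poleKernel (φ : Torus) (r : ℝ) (θ : Torus) : ℂ :=
  (1 - polar r θ * fourier (-1) φ)⁻¹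

theorem differentiableOn_inv_one_sub (φ : Torus) :
    DifferentiableOn ℂ (fun z : ℂ => (1 - z * fourier (-1) φ)⁻¹) (Metric.ball 0 1) := fun z hz =>
  DifferentiableAt.differentiableWithinAt (DifferentiableAt.inv (by fun_prop)
    (one_sub_mul_fourier_ne_zero (mem_ball_zero_iff.1 hz) _ _))

theorem continuous_poleKernel (φ : Torus) {r : ℝ} (hr : r ∈ Ico (0 : ℝ) 1) :
    Continuous (poleKernel φ r) :=
  Generator.continuous_comp_polar (differentiableOn_inv_one_sub φ) hr

theorem fourierCoeff_poleKernel_neg (φ : Torus) {r : ℝ} (hr : r ∈ Ioo (0 : ℝ) 1) {n : ℤ}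
    (hn : n < 0) : fourierCoeff (poleKernel φ r) n = 0 := by
  obtain ⟨a, ha0, ha⟩ := exists_fourierCoeff_comp_polar (differentiableOn_inv_one_sub φ)
  have := ha r hr n
  rw [ha0 n hn, mul_zero] at this
  exact this

theorem fourierCoeff_poleKernel_zero (φ : Torus) {r : ℝ} (hr : r ∈ Ico (0 : ℝ) 1) :
    fourierCoeff (poleKernel φ r) 0 = 1 := by
  rw [fourierCoeff]
  simp only [neg_zero, fourier_zero, one_smul]
  have := integral_comp_polar (differentiableOn_inv_one_sub φ) hr
  simp only [zero_mul, sub_zero, inv_one] at this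
  exact this

theorem fourierCoeff_conj (u : Torus → ℂ) (n : ℤ) :
    fourierCoeff (fun θ => (starRingEnd ℂ) (u θ)) n = (starRingEnd ℂ) (fourierCoeff u (-n)) := by
  rw [fourierCoeff, fourierCoeff, ← integral_conj]
  refine integral_congr_ae (ae_of_all _ fun θ => ?_)
  simp only [smul_eq_mul, map_mul, neg_neg]
  rw [← fourier_neg]

theorem fourierCoeff_ofReal_re {u : Torus → ℂ} (hu : Integrable u 𝔪) (n : ℤ) :
    fourierCoeff (fun θ => ((u θ).re : ℂ)) n =
      (fourierCoeff u n + (starRingEnd ℂ) (fourierCoeff u (-n))) / 2 := by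
  have hconj : Integrable (fun θ => (starRingEnd ℂ) (u θ)) 𝔪 :=
    (Complex.conjLIE.toContinuousLinearEquiv.toContinuousLinearMap).integrable_comp hu
  have e : (fun θ => ((u θ).re : ℂ)) =
      fun θ => (2⁻¹ : ℂ) * (u + fun θ => (starRingEnd ℂ) (u θ)) θ := by
    ext θ
    rw [Pi.add_apply, Complex.re_eq_add_conj]
    ring
  rw [e, fourierCoeff.const_mul, fourierCoeff.add hu hconj, Pi.add_apply, fourierCoeff_conj]
  ring

/-- Write `Re k = (k + conj k)/2`. The kernel `k` is analytic with mean 1, so the projection keeps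
`k` and retains only the mean of `conj k`. -/
theorem exists_rieszProjection_re_poleKernel (φ : Torus) {r : ℝ} (hr : r ∈ Ioo (0 : ℝ) 1) :
    ∃ h : Lp ℂ 2 𝔪, (∀ᵐ θ ∂𝔪, h θ = ((poleKernel φ r θ).re : ℂ)) ∧
      ∀ᵐ θ ∂𝔪, rieszProjection h θ = (poleKernel φ r θ + 1) / 2 := by
  have hr' : r ∈ Ico (0 : ℝ) 1 := ⟨hr.1.le, hr.2⟩
  have hc := continuous_poleKernel φ hr'
  have hi := integrable_of_continuous_torus hc
  have hcre : Continuous fun θ => ((poleKernel φ r θ).re : ℂ) :=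
    Complex.continuous_ofReal.comp (Complex.continuous_re.comp hc)
  have hck : Continuous fun θ => (poleKernel φ r θ + 1) / 2 := (hc.add_const 1).div_const 2
  set h : Lp ℂ 2 𝔪 := ContinuousMap.toLp 2 𝔪 ℂ
    ⟨_, hcre⟩ with hh
  have he : h =ᵐ[𝔪] fun θ => ((poleKernel φ r θ).re : ℂ) :=
    ContinuousMap.coeFn_toLp 𝔪 ⟨_, hcre⟩
  set k : Lp ℂ 2 𝔪 := ContinuousMap.toLp 2 𝔪 ℂ
    ⟨_, hck⟩ with hk
  have hke : k =ᵐ[𝔪] fun θ => (poleKernel φ r θ + 1) / 2 :=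
    ContinuousMap.coeFn_toLp 𝔪 ⟨_, hck⟩
  have hone : fourierCoeff (fun _ : Torus => (1 : ℂ)) = Pi.single 0 1 := by
    rw [← fourierCoeff_fourier (T := 2 * Real.pi) 0]
    congr 1
    ext θ
    exact fourier_zero.symm
  have e : (fun θ => (poleKernel φ r θ + 1) / 2) =
      fun θ => (2⁻¹ : ℂ) * (poleKernel φ r + fun _ : Torus => (1 : ℂ)) θ := by
    ext θ
    rw [Pi.add_apply]
    ring
  have key : rieszProjection h = k := by
    refine eq_of_fourierCoeff_eq fun n => ?_
    rw [fourierCoeff_rieszProjection, fourierCoeff_congr_ae he, fourierCoeff_congr_ae hke,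
      fourierCoeff_ofReal_re hi, e, fourierCoeff.const_mul,
      fourierCoeff.add hi (integrable_const _), Pi.add_apply, hone]
    rcases lt_trichotomy n 0 with hn | rfl | hn
    · rw [if_neg (not_le.2 hn), fourierCoeff_poleKernel_neg φ hr hn, Pi.single_eq_of_ne hn.ne]
      simp
    · rw [if_pos le_rfl, neg_zero, fourierCoeff_poleKernel_zero φ hr', Pi.single_eq_same, map_one]
      ring
    · rw [if_pos hn.le, fourierCoeff_poleKernel_neg φ hr (neg_lt_zero.2 hn),
        Pi.single_eq_of_ne hn.ne', map_zero]
      ring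
  exact ⟨h, he, by rw [key]; exact hke⟩

/-- The point `-1` of the circle. -/
noncomputable def antipode : Torus := ((Real.pi : ℝ) : Torus)

theorem one_le_norm_add_antipode {ψ : Torus} (hψ : ‖ψ‖ ≤ 1) : 1 ≤ ‖ψ + antipode‖ := by
  have h1 : ‖antipode‖ = Real.pi := by
    rw [antipode, norm_coe_torus (by rw [abs_of_pos Real.pi_pos]), abs_of_pos Real.pi_pos]
  have h2 := norm_sub_le (ψ + antipode) ψ
  rw [add_sub_cancel_left, h1] at h2
  linarith [Real.pi_gt_three]

/-- With `ζ = e^{iψ}` the kernel equals `(2 - ζ) / (2(1 - ζ))`, where `|2 - ζ| ≥ 1` and `|1 - ζ| ≤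
|ψ|`. -/
theorem half_norm_inv_le_norm_kernel {ψ : Torus} (hψ : 0 < ‖ψ‖) :
    1 / 2 * ‖ψ‖⁻¹ ≤ ‖((1 - polar 1 ψ)⁻¹ + 1) / 2‖ := by
  have e0 : polar 1 ψ = AddCircle.toCircle ψ := by rw [polar, Complex.ofReal_one, one_mul]
  rw [e0]
  have hpos := norm_toCircle_sub_one_pos hψ
  have hne : (1 : ℂ) - AddCircle.toCircle ψ ≠ 0 := by
    rw [← norm_pos_iff, norm_sub_rev]
    exact hpos
  have e : ((1 - (AddCircle.toCircle ψ : ℂ))⁻¹ + 1) / 2 =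
      1 / 2 * ((2 - AddCircle.toCircle ψ) * (1 - (AddCircle.toCircle ψ : ℂ))⁻¹) := by
    field_simp
    ring
  have h2 : 1 ≤ ‖(2 : ℂ) - AddCircle.toCircle ψ‖ := by
    have := norm_sub_norm_le (2 : ℂ) (AddCircle.toCircle ψ)
    rw [Circle.norm_coe, Complex.norm_ofNat] at this
    linarith
  rw [e, norm_mul, norm_mul, norm_inv, norm_sub_rev 1]
  have h3 : ‖ψ‖⁻¹ ≤ ‖(AddCircle.toCircle ψ : ℂ) - 1‖⁻¹ :=
    inv_anti₀ hpos (norm_toCircle_sub_one_le ψ)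
  have h4 : ‖(1 / 2 : ℂ)‖ = 1 / 2 := by norm_num
  rw [h4]
  have : 0 ≤ ‖(AddCircle.toCircle ψ : ℂ) - 1‖⁻¹ := by positivity
  nlinarith

/-- Translating the pole to 0 leaves a singularity of order `|ψ|⁻¹`. Near the pole the weight is at
least 1, since `a ≥ 0` and the points are at distance at least 1 from its zero. -/
theorem lintegral_powerWeight_mul_poleKernel_eq_top {a : ℝ} (ha : 0 ≤ a) :
    ∫⁻ θ, powerWeight a θ * ‖(poleKernel antipode 1 θ + 1) / 2‖ₑ ∂𝔪 = ∞ := by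
  set F : Torus → ℝ≥0∞ := fun θ => powerWeight a θ * ‖(poleKernel antipode 1 θ + 1) / 2‖ₑ
  rw [← lintegral_add_right_eq_self F antipode]
  set S : Set Torus := {ψ | ‖ψ‖ ≤ 1}
  have hS : MeasurableSet S := measurableSet_le measurable_norm measurable_const
  have hle : ∫⁻ ψ in S, ENNReal.ofReal (1 / 2) * powerWeight (-1) ψ ∂𝔪 ≤
      ∫⁻ ψ, F (ψ + antipode) ∂𝔪 := by
    refine (lintegral_mono_ae ?_).trans (setLIntegral_le_lintegral S _)
    filter_upwards [ae_restrict_mem hS, ae_restrict_of_ae ae_haar_norm_torus_pos] with ψ h1 h2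
    have h3 : (1 : ℝ≥0∞) ≤ powerWeight a (ψ + antipode) :=
      ENNReal.one_le_ofReal.2 (Real.one_le_rpow (one_le_norm_add_antipode h1) ha)
    have h4 : ENNReal.ofReal (1 / 2) * powerWeight (-1) ψ ≤
        ‖(poleKernel antipode 1 (ψ + antipode) + 1) / 2‖ₑ := by
      rw [powerWeight, ← ENNReal.ofReal_mul (by norm_num), ← ofReal_norm, Real.rpow_neg_one,
        poleKernel, polar_mul_fourier_neg_one, add_sub_cancel_right]
      exact ENNReal.ofReal_le_ofReal (half_norm_inv_le_norm_kernel h2)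
    calc _ = 1 * (ENNReal.ofReal (1 / 2) * powerWeight (-1) ψ) := (one_mul _).symm
      _ ≤ _ := mul_le_mul' h3 h4
  rw [lintegral_const_mul _ (measurable_powerWeight _), setLIntegral_powerWeight_eq_top le_rfl
    one_pos (by linarith [Real.pi_gt_three]), ENNReal.mul_top (by simp)] at hle
  exact top_le_iff.1 hle

/-- The real parts of the kernels are positive of mass 1, so their weighted norms are at most `π^a`.
By Fatou a bound on the projections would pass to the limit kernel, which is not integrable. -/
theorem not_rieszBoundedOn_one {a : ℝ} (ha : 0 ≤ a) : ¬ RieszBoundedOn 1 (powerWeight a) := by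
  rintro ⟨C, hC⟩
  set E := ENNReal.ofReal (Real.pi ^ a) with hE
  have hre : ∀ r ∈ Ico (0 : ℝ) 1, ∀ θ, 0 ≤ (poleKernel antipode r θ).re := fun r hr θ =>
    le_trans (by norm_num)
      (half_le_re_inv_one_sub (norm_mul_fourier_lt_one (norm_polar_lt_one hr θ) _ _))
  have hbound : ∀ r ∈ Ioo (0 : ℝ) 1,
      ∫⁻ θ, powerWeight a θ * ‖(poleKernel antipode r θ + 1) / 2‖ₑ ∂𝔪 ≤ C * E := by
    intro r hr
    have hr' : r ∈ Ico (0 : ℝ) 1 := ⟨hr.1.le, hr.2⟩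
    obtain ⟨h, h1, h2⟩ := exists_rieszProjection_re_poleKernel antipode hr
    have hI : ∫⁻ θ, powerWeight a θ * ‖h θ‖ₑ ^ (1 : ℝ) ∂𝔪 ≤ E := by
      calc ∫⁻ θ, powerWeight a θ * ‖h θ‖ₑ ^ (1 : ℝ) ∂𝔪
          ≤ ∫⁻ θ, E * ENNReal.ofReal (poleKernel antipode r θ).re ∂𝔪 := by
            refine lintegral_mono_ae ?_
            filter_upwards [h1] with θ hθ
            rw [hθ, ENNReal.rpow_one, ← ofReal_norm, Complex.norm_real,
              Real.norm_of_nonneg (hre r hr' θ)]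
            gcongr
            exact ENNReal.ofReal_le_ofReal
              (Real.rpow_le_rpow (norm_nonneg _) (norm_torus_le_pi θ) ha)
        _ = E * ∫⁻ θ, ENNReal.ofReal (poleKernel antipode r θ).re ∂𝔪 :=
            lintegral_const_mul' _ _ ENNReal.ofReal_ne_top
        _ = E := by
            rw [show ∫⁻ θ, ENNReal.ofReal (poleKernel antipode r θ).re ∂𝔪 = 1 from
              lintegral_re_cauchyKernel_left hr' antipode, mul_one]
    calc ∫⁻ θ, powerWeight a θ * ‖(poleKernel antipode r θ + 1) / 2‖ₑ ∂𝔪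
        = ∫⁻ θ, powerWeight a θ * ‖rieszProjection h θ‖ₑ ^ (1 : ℝ) ∂𝔪 := by
          refine lintegral_congr_ae ?_
          filter_upwards [h2] with θ hθ
          rw [hθ, ENNReal.rpow_one]
      _ ≤ C * ∫⁻ θ, powerWeight a θ * ‖h θ‖ₑ ^ (1 : ℝ) ∂𝔪 :=
          hC h (hI.trans_lt ENNReal.ofReal_lt_top)
      _ ≤ C * E := by gcongr
  have hlim : ∫⁻ θ, powerWeight a θ * ‖(poleKernel antipode 1 θ + 1) / 2‖ₑ ∂𝔪 ≤ C * E := by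
    have hpos : ∀ k, radii k ∈ Ioo (0 : ℝ) 1 := fun k => by
      refine ⟨?_, (radii_mem k).2⟩
      rw [radii, sub_pos, div_lt_one (by positivity)]
      linarith [(Nat.cast_nonneg k : (0 : ℝ) ≤ k)]
    refine lintegral_le_of_tendsto_ae
      (F := fun k θ => powerWeight a θ * ‖(poleKernel antipode (radii k) θ + 1) / 2‖ₑ)
      (fun k => ?_) ?_ fun k => hbound _ (hpos k)
    · exact (measurable_powerWeight a).mul
        (((continuous_poleKernel antipode (radii_mem k)).add_const 1).div_const 2).measurable.enorm
    · have hne : ∀ᵐ θ ∂𝔪, 0 < ‖θ - antipode‖ := by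
        rw [ae_haar_iff, ae_iff]
        have : {θ : Torus | ¬ 0 < ‖θ - antipode‖} = {antipode} := by
          ext θ
          simp [sub_eq_zero]
        rw [this, volume_torus_singleton]
      filter_upwards [hne] with θ hθ
      have hcont : ContinuousAt (fun r : ℝ => (poleKernel antipode r θ + 1) / 2) 1 := by
        have hpc : Continuous fun r : ℝ => polar r θ := by
          unfold polar
          fun_prop
        refine ((ContinuousAt.inv₀ ?_ ?_).add_const 1).div_const 2
        · exact (continuous_const.sub (hpc.mul continuous_const)).continuousAt
        · rw [polar_mul_fourier_neg_one, polar, Complex.ofReal_one, one_mul, ← norm_pos_iff,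
            norm_sub_rev]
          exact norm_toCircle_sub_one_pos hθ
      exact ENNReal.Tendsto.const_mul ((continuous_enorm.tendsto _).comp
        (hcont.tendsto.comp tendsto_radii)) (Or.inr ENNReal.ofReal_ne_top)
  rw [lintegral_powerWeight_mul_poleKernel_eq_top ha, top_le_iff] at hlim
  exact ENNReal.mul_ne_top ENNReal.coe_ne_top ENNReal.ofReal_ne_top hlim

end WeightedSzego

/-! ### The range of exponents -/

theorem theorem2p5 (α : ℝ) (hα : 0 ≤ α) (p : ℝ) (hp : 1 ≤ p) :
    (WeightedSzego.gAlpha α hα).SzegoBoundedOn (ENNReal.ofReal p) ↔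
      (2 * α + 1) / (α + 1) < p ∧ (0 < α → p < (2 * α + 1) / α) := by
  rw [WeightedSzego.szegoBoundedOn_gAlpha_iff hα hp, div_lt_iff₀ (by positivity)]
  constructor
  · intro h
    rcases hp.eq_or_lt with rfl | hp1
    · exact absurd h (WeightedSzego.not_rieszBoundedOn_one (by linarith))
    -- For `a = α(2-p)`, `-1 < a` reads `pα < 2α + 1` and `a < p - 1` reads `2α + 1 < p(α + 1)`.
    · have h1 := h.neg_one_lt hp
      have h2 := h.lt_sub_one hp1
      refine ⟨by linarith, fun hα0 => ?_⟩
      rw [lt_div_iff₀ hα0]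
      linarith
  · rintro ⟨h1, h2⟩
    -- The left end point `(2α+1)/(α+1)` is at least 1.
    have hp1 : 1 < p := by
      by_contra h
      nlinarith
    refine WeightedSzego.rieszBoundedOn_powerWeight hp1 ?_ (by linarith)
    rcases hα.eq_or_lt with rfl | hα0
    · simp
    · have := h2 hα0
      rw [lt_div_iff₀ hα0] at this
      linarith
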